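/- \textbf{Conventions.} Strings are finite sequences of natural numbers, $|\sigma|$ is the length of $\sigma$, and $\sigma\subseteq\tau$ means that $\tau$ extends $\sigma$; reals are elements of $\omega^\omega$. Strings and pairs of strings are identified with their codes. $\Phi_e$ is the $e$-th computable functional, $X'$ is the Turing jump of $X$, and $f\oplus g$ is the join. A tree is a set of strings that is closed under initial segments, $[T]$ is the set of its infinite paths (with the topology of Baire space $\omega^\omega$), and $T{\restriction}l=\{\sigma\in T:|\sigma|\le l\}$. A tree $T$ is \emph{nice} if, for every string $\sigma$ with $|\sigma|\equiv 2\pmod 4$ and every $x$, $\sigma^\frown x\in T$ iff $\sigma\in T$ and $x\in\{0,1\}$. An index for a set as an $A$-computable set is an $e$ such that $\Phi_e^A$ is its characteristic function. A partial function $\Gamma$ from strings to strings is \emph{expansionary} if, whenever $\Gamma(\tau){\downarrow}$, $\sigma\subsetneq\tau$ iff $\Gamma(\sigma)\subsetneq\Gamma(\tau)$ for all $\sigma$, and $\Gamma$ respects the left-of relation (lexicographically below and incompatible) and longest common initial segments; for a real $f$ let $\Gamma(f)$ be the real $\bigcup_n\Gamma(f{\restriction}n)$ if this is infinite. A real $g$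 \emph{meets} a set $W$ of strings if some initial segment of $g$ is in $W$, and \emph{strongly avoids} $W$ on $T$ if some initial segment of $g$ has no extension in $T\cap W$. For a string $\rho$, $\Phi_i(\rho)$ is the longest string $\upsilon$ with $|\upsilon|\le|\rho|$ such that $\upsilon(n)$ is computed by $\Phi_i$ from $\rho$ in $|\rho|$ steps for each $n<|\upsilon|$; strings $\tau_0,\tau_1$ are \emph{$i$-splitting} (over $X$) if $\Phi_i(\tau_0\oplus X)$ and $\Phi_i(\tau_1\oplus X)$ are incompatible, where $\tau\oplus X$ stands for the string of length $2|\tau|$ that interleaves $\tau$ and $X{\restriction}|\tau|$. \textbf{Pulldown Lemma.} Let $X$ be a real, let $l\in\omega$, and let $T'\le_T X'$ be a nice tree such that $T'{\restriction}l\le_T X$. Then there are a tree $T$ and a partial function $\Gamma\le_T X'$ from strings to strings such that \begin{enumerate} \item $T$ is computable in $X$; \item $T$ is nice; \item $T{\restriction}l=T'{\restriction}l$, and $\Gamma$ is the identity on $T'{\restriction}l$; \item $\Gamma$ is expansionary, and $\Gamma(\sigma^\frown x)\supseteq\Gamma(\sigma)^\frown x$ whenever $\Gamma(\sigma^\frown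 x){\downarrow}$; \item $\operatorname{dom}\Gamma=T'$ and $\operatorname{rng}\Gamma\subseteq T$; \item $f\mapsto\Gamma(f)$ is a homeomorphism of $[T']$ onto $[T]$; \item every $g\in[T]$ either meets or strongly avoids on $T$ each $X$-r.e.\ set of strings; \item for every $f\in[T]$ there is a unique $\hat f\in[T']$ with $\Gamma(\hat f)=f$, and $(f\oplus X)'\equiv_T f\oplus X'\equiv_T\hat f\oplus X'$, each of the reductions being given by a single functional that works for all $f\in[T]$; \item $g\nleq_T X$ for every $g\in[T]$; \item $g\nleq_T h\oplus X$ for all distinct $g,h\in[T]$; \item if $4i+2>l$, $\sigma\in T'$ and $|\sigma|=4i+2$, then either $\Gamma(\sigma^\frown 0),\Gamma(\sigma^\frown 1)$ are $i$-splitting, or no two extensions of $\Gamma(\sigma)$ in $T$ are $i$-splitting. \end{enumerate} Moreover, this is uniform: there are computable functions, independent of $X$, that from $l$, an index $e$ for $T'$ as an $X'$-computable set and an index $e_0$ for $T'{\restriction}l$ as an $X$-computable set give an index for $T$ as an $X$-computable set, indices for $\Gamma$ as a partial $X'$-computable function and for its graph as an $X'$-computable set, and indices for the reductions in (8). Finally,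 the same computable functions also work for bad indices $e$, in the following sense. Let $X$, $l$, $e$ be arbitrary and let $e_0$ be an index for a nice $X$-computable tree $T_0$ all of whose strings have length at most $l$. Then there is a largest nice tree $T'$ such that $T'{\restriction}l=T_0$ and $\Phi_e^{X'}(\sigma){\downarrow}=1$ for all $\sigma\in T'\setminus T_0$, and for this $T'$ there are $T$ and $\Gamma$ with the indices computed from $l,e,e_0$ that satisfy (1)--(11), where now $\Gamma$ is partial $X'$-computable (its graph is r.e.\ in $X'$), and its graph is again computable in $X'$, with the computed index, if $\Phi_e^{X'}$ is total. -/

import Mathlib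

namespace Pulldown

/-! ### Strings and reals

Strings are elements of `List ℕ`, reals are functions `ℕ → ℕ`, and `σ <+: τ` says that `τ` extends
`σ` (not necessarily strictly). -/

/-- The initial segment of length `n` of the real `f`. -/
def initSeg (f : ℕ → ℕ) (n : ℕ) : List ℕ := (List.range n).map f

/-- The string `σ` is an initial segment of the real `f`. -/
def IsInit (σ : List ℕ) (f : ℕ → ℕ) : Prop := σ = initSeg f σ.length

/-- Neither of the two strings extends the other one. -/
def Incompat (σ τ : List ℕ) : Prop := ¬ σ <+: τ ∧ ¬ τ <+: σ

/-- The left-of relation: `σ` is lexicographically below `τ` and incompatible with `τ`. -/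
def LeftOf (σ τ : List ℕ) : Prop := σ ≤ τ ∧ Incompat σ τ

/-- The longest common initial segment of two strings. -/
def meet : List ℕ → List ℕ → List ℕ
  | a :: σ, b :: τ => if a = b then a :: meet σ τ else []
  | _, _ => []

/-- The join `f ⊕ g` of two reals. -/
def join (f g : ℕ → ℕ) (n : ℕ) : ℕ := if n % 2 = 0 then f (n / 2) else g (n / 2)

/-- The string `τ ⊕ X`, the initial segment of length `2 * |τ|` of `f ⊕ X` for any real `f`
that extends `τ`. -/
def joinStr (τ : List ℕ) (X : ℕ → ℕ) : List ℕ :=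
  initSeg (join (fun n => τ.getD n 0) X) (2 * τ.length)

/-! ### Computable functionals

The `e`-th functional runs the `e`-th program on pairs of an initial segment of the oracle and an
argument, dovetailing over the initial segments and the numbers of steps. -/

/-- The `k`-th probe, with `k = ⟨j, s⟩`, of the `e`-th functional with oracle string `ρ` at `n`:
run the `e`-th program for `s` steps on the pair of `ρ ↾ j` and `n`. -/
def probe (e : ℕ) (ρ : List ℕ) (k n : ℕ) : Option ℕ :=
  Nat.Partrec.Code.evaln k.unpair.2 (Denumerable.ofNat Nat.Partrec.Code e)
    (Nat.pair (Encodable.encode (ρ.take k.unpair.1)) n)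

/-- `Φ_e(X; n)`: the result of the first probe that halts, the `k`-th probe using at most the first
`k` values of the oracle. -/
def Phi (e : ℕ) (X : ℕ → ℕ) (n : ℕ) : Part ℕ :=
  Nat.rfindOpt fun k => probe e (initSeg X k) k n

/-- `Φ_{e,s}(ρ; n)` with the string `ρ` as oracle and `s = |ρ|`. -/
def phiVal (e : ℕ) (ρ : List ℕ) (n : ℕ) : Option ℕ :=
  (List.range (ρ.length + 1)).findSome? fun k => probe e ρ k n

/-- `Φ_e(ρ)` for a string `ρ`: the longest string `τ` with `|τ| ≤ |ρ|` such that
`τ(n) = Φ_{e,|ρ|}(ρ; n)↓` for all `n < |τ|`. -/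
def phiStr (e : ℕ) (ρ : List ℕ) : List ℕ :=
  (((List.range ρ.length).map (phiVal e ρ)).takeWhile Option.isSome).reduceOption

/-- `τ₀` and `τ₁` are `i`-splitting (over `X`): `Φ_i(τ₀ ⊕ X)` and `Φ_i(τ₁ ⊕ X)` are incompatible. -/
def Splitting (i : ℕ) (X : ℕ → ℕ) (τ₀ τ₁ : List ℕ) : Prop :=
  Incompat (phiStr i (joinStr τ₀ X)) (phiStr i (joinStr τ₁ X))

open Classical in
/-- The Turing jump of `X`, as a characteristic function. -/
noncomputable def jump (X : ℕ → ℕ) (n : ℕ) : ℕ := if (Phi n X n).Dom then 1 else 0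

/-- `e` is an index for `S` as an `A`-computable set. -/
def Decides {α : Type} [Encodable α] (e : ℕ) (A : ℕ → ℕ) (S : Set α) : Prop :=
  ∀ a, (a ∈ S → 1 ∈ Phi e A (Encodable.encode a)) ∧ (a ∉ S → 0 ∈ Phi e A (Encodable.encode a))

/-- The functional with index `r` computes the real `B` from the real `A`. -/
def Reduces (r : ℕ) (A B : ℕ → ℕ) : Prop := ∀ n, B n ∈ Phi r A n

/-- `W` is an `X`-r.e. set of strings. -/
def REIn (X : ℕ → ℕ) (W : Set (List ℕ)) : Prop :=
  ∃ e, ∀ σ, σ ∈ W ↔ (Phi e X (Encodable.encode σ)).Dom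

/-! ### Trees -/

/-- Trees are downward closed sets of strings. -/
def IsTree (T : Set (List ℕ)) : Prop := ∀ σ τ, σ <+: τ → τ ∈ T → σ ∈ T

/-- Every string of the tree of length `2` modulo `4` has exactly the two immediate successors
given by `0` and `1`. -/
def IsNice (T : Set (List ℕ)) : Prop :=
  ∀ σ x, (σ ++ [x]).length % 4 = 3 → (σ ++ [x] ∈ T ↔ σ ∈ T ∧ (x = 0 ∨ x = 1))

/-- `T ↾ l`, the strings in `T` of length at most `l`. -/
def restr (T : Set (List ℕ)) (l : ℕ) : Set (List ℕ) := {σ | σ ∈ T ∧ σ.length ≤ l}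

/-- `[T]`, the set of paths through the tree `T`. -/
def paths (T : Set (List ℕ)) : Set (ℕ → ℕ) := {f | ∀ n, initSeg f n ∈ T}

/-- The real `g` meets the set `W` of strings. -/
def Meets (g : ℕ → ℕ) (W : Set (List ℕ)) : Prop := ∃ σ ∈ W, IsInit σ g

/-- The real `g` strongly avoids `W` on `T`. -/
def StronglyAvoids (g : ℕ → ℕ) (W T : Set (List ℕ)) : Prop :=
  ∃ σ, IsInit σ g ∧ ∀ τ, σ <+: τ → τ ∉ T ∩ W

/-- A partial function on strings is expansionary if it is monotone and respects the left-of
relation and longest common initial segments. -/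
structure IsExpansionary (Γ : List ℕ →. List ℕ) : Prop where
  monotone : ∀ τ τ', τ' ∈ Γ τ →
    ∀ σ, (σ <+: τ ∧ σ ≠ τ) ↔ ∃ σ' ∈ Γ σ, σ' <+: τ' ∧ σ' ≠ τ'
  leftOf : ∀ σ τ σ' τ', σ' ∈ Γ σ → τ' ∈ Γ τ → (LeftOf σ τ ↔ LeftOf σ' τ')
  meet : ∀ σ τ σ' τ', σ' ∈ Γ σ → τ' ∈ Γ τ → meet σ' τ' ∈ Γ (meet σ τ)

/-- `Γ(f) = g` for the functional on reals induced by the function `Γ` on strings: `g` extends the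
values of `Γ` on initial segments of `f`, and these get arbitrarily long. -/
def MapsReal (Γ : List ℕ →. List ℕ) (f g : ℕ → ℕ) : Prop :=
  (∀ n, ∀ τ ∈ Γ (initSeg f n), IsInit τ g) ∧ ∀ k, ∃ n, ∃ τ ∈ Γ (initSeg f n), k ≤ τ.length

/-- What it means for `T` and `Γ` to be a pulldown of the tree `T'` over `X` that copies `T'` up to
length `l`, with indices `t` for `T`, `γ` for `Γ` as a partial `X'`-computable function, and
`r₁`, `r₂`, `r₃`, `r₄` for the reductions in the inversion of the jump. -/
structure IsPulldown (X : ℕ → ℕ) (l : ℕ) (T' T : Set (List ℕ)) (Γ : List ℕ →. List ℕ)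
    (t γ r₁ r₂ r₃ r₄ : ℕ) : Prop where
  tree : IsTree T
  computable : Decides t X T
  map_index : ∀ σ, Phi γ (jump X) (Encodable.encode σ) = (Γ σ).map Encodable.encode
  nice : IsNice T
  copy : restr T l = restr T' l
  map_copy : ∀ σ ∈ restr T' l, σ ∈ Γ σ
  expansionary : IsExpansionary Γ
  map_concat : ∀ σ x τ', τ' ∈ Γ (σ ++ [x]) → ∃ σ' ∈ Γ σ, σ' ++ [x] <+: τ'
  dom : ∀ σ, (Γ σ).Dom ↔ σ ∈ T'
  range : ∀ σ, ∀ τ ∈ Γ σ, τ ∈ T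
  homeo : ∃ h : paths T' ≃ₜ paths T, ∀ f : paths T', MapsReal Γ (f : ℕ → ℕ) (h f : ℕ → ℕ)
  generic : ∀ g ∈ paths T, ∀ W, REIn X W → Meets g W ∨ StronglyAvoids g W T
  jump_inversion : ∀ f ∈ paths T, (∃! f', f' ∈ paths T' ∧ MapsReal Γ f' f) ∧
    Reduces r₁ (join f (jump X)) (jump (join f X)) ∧
    Reduces r₂ (jump (join f X)) (join f (jump X)) ∧
    ∀ f' ∈ paths T', MapsReal Γ f' f →
      Reduces r₃ (join f' (jump X)) (join f (jump X)) ∧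
      Reduces r₄ (join f (jump X)) (join f' (jump X))
  noncomputable_path : ∀ g ∈ paths T, ¬ TuringReducible (g : ℕ →. ℕ) (X : ℕ →. ℕ)
  incomparable : ∀ g ∈ paths T, ∀ h ∈ paths T, g ≠ h →
    ¬ TuringReducible (g : ℕ →. ℕ) (join h X : ℕ →. ℕ)
  splitting : ∀ i, l < 4 * i + 2 → ∀ σ ∈ T', σ.length = 4 * i + 2 →
    (∃ τ₀ ∈ Γ (σ ++ [0]), ∃ τ₁ ∈ Γ (σ ++ [1]), Splitting i X τ₀ τ₁) ∨
    ∃ ρ ∈ Γ σ, ∀ τ₀ ∈ T, ∀ τ₁ ∈ T, ρ <+: τ₀ → ρ <+: τ₁ → ¬ Splitting i X τ₀ τ₁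

/-- The graph of a partial function. -/
def graphOf (Γ : List ℕ →. List ℕ) : Set (List ℕ × List ℕ) := {p | p.2 ∈ Γ p.1}

/-! ### The functionals `Phi` capture relative computability in the sense of Mathlib -/

theorem take_initSeg (X : ℕ → ℕ) {j k : ℕ} (h : j ≤ k) :
    (initSeg X k).take j = initSeg X j := by
  simp [initSeg, ← List.map_take, List.take_range, h]

theorem probe_initSeg (e : ℕ) (X : ℕ → ℕ) (k n : ℕ) :
    probe e (initSeg X k) k n =
      Nat.Partrec.Code.evaln k.unpair.2 (Denumerable.ofNat Nat.Partrec.Code e)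
        (Nat.pair (Encodable.encode (initSeg X k.unpair.1)) n) := by
  rw [probe, take_initSeg X (Nat.unpair_left_le k)]

theorem exists_index_of_approx {X : ℕ → ℕ} {f : ℕ →. ℕ} {g : List ℕ → ℕ → Part ℕ}
    (hg : Partrec₂ g) (h : ∀ n m, m ∈ f n ↔ ∃ j, m ∈ g (initSeg X j) n) :
    ∃ e, ∀ n, Phi e X n = f n := by
  have h1 : Nat.Partrec fun p => g (Denumerable.ofNat (List ℕ) p.unpair.1) p.unpair.2 :=
    Partrec.nat_iff.1 (hg.comp ((Computable.ofNat _).comp (Computable.fst.comp Computable.unpair))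
      (Computable.snd.comp Computable.unpair))
  obtain ⟨c, hc⟩ := Nat.Partrec.Code.exists_code.1 h1
  have key : ∀ n m, (∃ k, m ∈ probe (Encodable.encode c) (initSeg X k) k n) ↔ m ∈ f n := by
    intro n m
    simp only [probe_initSeg, h, Denumerable.ofNat_encode]
    constructor
    · rintro ⟨k, hk⟩
      have := Nat.Partrec.Code.evaln_sound hk
      rw [hc] at this
      exact ⟨k.unpair.1, by simpa using this⟩
    · rintro ⟨j, hj⟩
      have : m ∈ c.eval (Nat.pair (Encodable.encode (initSeg X j)) n) := by
        rw [hc]; simpa using hj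
      obtain ⟨s, hs⟩ := Nat.Partrec.Code.evaln_complete.1 this
      exact ⟨Nat.pair j s, by simpa using hs⟩
  refine ⟨Encodable.encode c, fun n => Part.ext fun m => ?_⟩
  rw [← key]
  constructor
  · exact fun hm => Nat.rfindOpt_spec hm
  · rintro ⟨k, hk⟩
    have hd : (Phi (Encodable.encode c) X n).Dom := Nat.rfindOpt_dom.2 ⟨k, m, hk⟩
    obtain ⟨k', hk'⟩ := Nat.rfindOpt_spec (Part.get_mem hd)
    have := Part.mem_unique ((key n m).1 ⟨k, hk⟩) ((key n _).1 ⟨k', hk'⟩)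
    rw [this]; exact Part.get_mem hd

def Approx (X : ℕ → ℕ) (f : ℕ →. ℕ) (g : List ℕ → ℕ → Part ℕ) : Prop :=
  Partrec₂ g ∧ (∀ n m i j, i ≤ j → m ∈ g (initSeg X i) n → m ∈ g (initSeg X j) n) ∧
    ∀ n m, m ∈ f n ↔ ∃ j, m ∈ g (initSeg X j) n

theorem approx_of_partrec (X : ℕ → ℕ) {f : ℕ →. ℕ} (hf : Nat.Partrec f) :
    ∃ g, Approx X f g :=
  ⟨fun _ n => f n, (Partrec.nat_iff.2 hf).comp Computable.snd, fun _ _ _ _ _ h => h,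
    fun _ _ => by simp⟩

theorem approx_of_recursiveIn (X : ℕ → ℕ) {f : ℕ →. ℕ}
    (hf : Nat.RecursiveIn {(X : ℕ →. ℕ)} f) : ∃ g, Approx X f g := by
  induction hf with
  | zero => exact approx_of_partrec X Nat.Partrec.zero
  | succ => exact approx_of_partrec X Nat.Partrec.succ
  | left => exact approx_of_partrec X Nat.Partrec.left
  | right => exact approx_of_partrec X Nat.Partrec.right
  | oracle g hg =>
    obtain rfl := Set.mem_singleton_iff.1 hg
    refine ⟨fun σ n => (σ[n]? : Option ℕ), ?_, ?_, ?_⟩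
    · exact Computable.ofOption Computable.list_getElem?
    · intro n m i j hij
      simp only [initSeg, Part.mem_ofOption, List.getElem?_map, Option.mem_def,
        Option.map_eq_some_iff, List.getElem?_eq_some_iff, List.length_range, List.getElem_range]
      rintro ⟨a, ⟨h1, h2⟩, h3⟩
      exact ⟨a, ⟨by omega, h2⟩, h3⟩
    · intro n m
      simp only [initSeg, Part.mem_ofOption, List.getElem?_map, Option.mem_def,
        Option.map_eq_some_iff, List.getElem?_eq_some_iff, List.length_range, List.getElem_range]
      constructor
      · intro h
        exact ⟨n + 1, n, ⟨by omega, rfl⟩, by simpa [eq_comm] using h⟩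
      · rintro ⟨j, a, ⟨h1, h2⟩, h3⟩
        subst h2; simp [← h3]
  | @pair f h _ _ ihf ihh =>
    obtain ⟨gf, hf1, hf2, hf3⟩ := ihf
    obtain ⟨gh, hh1, hh2, hh3⟩ := ihh
    refine ⟨fun σ n => (gf σ n).bind fun a => (gh σ n).map fun b => Nat.pair a b, ?_, ?_, ?_⟩
    · refine Partrec.bind hf1 (Partrec.map (f := fun q : (List ℕ × ℕ) × ℕ => gh q.1.1 q.1.2)
        (g := fun q b => Nat.pair q.2 b)
        (hh1.comp (Computable.fst.comp Computable.fst) (Computable.snd.comp Computable.fst)) ?_)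
      exact (Primrec₂.natPair.comp (Primrec.snd.comp Primrec.fst) Primrec.snd).to_comp
    · intro n m i j hij
      simp only [Part.mem_bind_iff, Part.mem_map_iff]
      rintro ⟨a, ha, b, hb, rfl⟩
      exact ⟨a, hf2 _ _ _ _ hij ha, b, hh2 _ _ _ _ hij hb, rfl⟩
    · intro n m
      simp only [Seq.seq, Part.map_eq_map, Part.bind_map, Part.mem_bind_iff,
        Part.mem_map_iff, hf3, hh3]
      constructor
      · rintro ⟨a, ⟨i, ha⟩, b, ⟨j, hb⟩, rfl⟩
        exact ⟨max i j, a, hf2 _ _ _ _ (le_max_left _ _) ha, b,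
          hh2 _ _ _ _ (le_max_right _ _) hb, rfl⟩
      · rintro ⟨j, a, ha, b, hb, rfl⟩
        exact ⟨a, ⟨j, ha⟩, b, ⟨j, hb⟩, rfl⟩
  | @comp f h _ _ ihf ihh =>
    obtain ⟨gf, hf1, hf2, hf3⟩ := ihf
    obtain ⟨gh, hh1, hh2, hh3⟩ := ihh
    refine ⟨fun σ n => (gh σ n).bind fun a => gf σ a, ?_, ?_, ?_⟩
    · exact Partrec.bind hh1 (hf1.comp (Computable.fst.comp Computable.fst) Computable.snd)
    · intro n m i j hij
      simp only [Part.mem_bind_iff]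
      rintro ⟨a, ha, hb⟩
      exact ⟨a, hh2 _ _ _ _ hij ha, hf2 _ _ _ _ hij hb⟩
    · intro n m
      have e1 : m ∈ (h n >>= f) ↔ ∃ a ∈ h n, m ∈ f a := Part.mem_bind_iff
      rw [e1]
      simp only [Part.mem_bind_iff, hf3, hh3]
      constructor
      · rintro ⟨a, ⟨i, ha⟩, ⟨j, hb⟩⟩
        exact ⟨max i j, a, hh2 _ _ _ _ (le_max_left _ _) ha,
          hf2 _ _ _ _ (le_max_right _ _) hb⟩
      · rintro ⟨j, a, ha, hb⟩
        exact ⟨a, ⟨j, ha⟩, ⟨j, hb⟩⟩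
  | @prec f h _ _ ihf ihh =>
    obtain ⟨gf, hf1, hf2, hf3⟩ := ihf
    obtain ⟨gh, hh1, hh2, hh3⟩ := ihh
    let G : List ℕ → ℕ → ℕ → Part ℕ := fun σ a n =>
      n.rec (gf σ a) fun y IH => IH.bind fun i => gh σ (Nat.pair a (Nat.pair y i))
    have mono : ∀ a n m i j, i ≤ j → m ∈ G (initSeg X i) a n → m ∈ G (initSeg X j) a n := by
      intro a n
      induction n with
      | zero => exact hf2 a
      | succ n ih =>
        intro m i j hij
        simp only [G, Part.mem_bind_iff]
        rintro ⟨b, hb, hm⟩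
        exact ⟨b, ih _ _ _ hij hb, hh2 _ _ _ _ hij hm⟩
    refine ⟨fun σ p => G σ p.unpair.1 p.unpair.2, ?_, fun n m i j hij => mono _ _ _ _ _ hij, ?_⟩
    · refine Partrec.nat_rec (f := fun q : List ℕ × ℕ => q.2.unpair.2)
        (g := fun q : List ℕ × ℕ => gf q.1 q.2.unpair.1)
        (h := fun q yi => gh q.1 (Nat.pair q.2.unpair.1 (Nat.pair yi.1 yi.2)))
        (Computable.snd.comp (Computable.unpair.comp Computable.snd))
        (hf1.comp Computable.fst (Computable.fst.comp (Computable.unpair.comp Computable.snd))) ?_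
      refine hh1.comp (Computable.fst.comp Computable.fst) ?_
      exact (Primrec₂.natPair.comp
        (Primrec.fst.comp (Primrec.unpair.comp (Primrec.snd.comp Primrec.fst)))
        (Primrec₂.natPair.comp (Primrec.fst.comp Primrec.snd)
          (Primrec.snd.comp Primrec.snd))).to_comp
    · intro p
      simp only
      generalize p.unpair.1 = a
      generalize p.unpair.2 = n
      induction n with
      | zero => exact hf3 a
      | succ n ih =>
        intro m
        simp only [G, Part.bind_eq_bind, Part.mem_bind_iff] at ih ⊢
        constructor
        · rintro ⟨b, hb, hm⟩
          obtain ⟨i, hi⟩ := (ih b).1 hb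
          obtain ⟨j, hj⟩ := (hh3 _ _).1 hm
          exact ⟨max i j, b, mono _ _ _ _ _ (le_max_left _ _) hi,
            hh2 _ _ _ _ (le_max_right _ _) hj⟩
        · rintro ⟨j, b, hb, hm⟩
          exact ⟨b, (ih b).2 ⟨j, hb⟩, (hh3 _ _).2 ⟨j, hm⟩⟩
  | @rfind f _ ihf =>
    obtain ⟨gf, hf1, hf2, hf3⟩ := ihf
    refine ⟨fun σ a => Nat.rfind fun n => (fun m => decide (m = 0)) <$> gf σ (Nat.pair a n),
      ?_, ?_, ?_⟩
    · refine Partrec.rfind (p := fun (q : List ℕ × ℕ) n =>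
        (gf q.1 (Nat.pair q.2 n)).map fun m => decide (m = 0)) (Partrec.map
          (f := fun r : (List ℕ × ℕ) × ℕ => gf r.1.1 (Nat.pair r.1.2 r.2))
          (g := fun _ m => decide (m = 0)) ?_ ?_)
      · exact hf1.comp (Computable.fst.comp Computable.fst)
          ((Primrec₂.natPair.comp (Primrec.snd.comp Primrec.fst) Primrec.snd).to_comp)
      · exact ((PrimrecRel.comp Primrec.eq Primrec.snd (Primrec.const 0)).decide).to_comp
    · intro n m i j hij
      have e1 : ∀ q : ℕ → Part ℕ, m ∈ Nat.rfind (fun k => (fun m => decide (m = 0)) <$> q k) ↔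
          true ∈ (q m).map (fun m => decide (m = 0)) ∧
            ∀ {k}, k < m → false ∈ (q k).map fun m => decide (m = 0) := fun q => Nat.mem_rfind
      refine fun h => (e1 fun k => gf (initSeg X j) (Nat.pair n k)).2 ?_
      replace h := (e1 fun k => gf (initSeg X i) (Nat.pair n k)).1 h
      simp only [Part.mem_map_iff] at h ⊢
      revert h
      rintro ⟨⟨a, ha, h0⟩, h2⟩
      refine ⟨⟨a, hf2 _ _ _ _ hij ha, h0⟩, fun {k} hk => ?_⟩
      obtain ⟨b, hb, h1⟩ := h2 hk
      exact ⟨b, hf2 _ _ _ _ hij hb, h1⟩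
    · intro n m
      have e1 : ∀ q : ℕ → Part ℕ, m ∈ Nat.rfind (fun k => (fun m => decide (m = 0)) <$> q k) ↔
          true ∈ (q m).map (fun m => decide (m = 0)) ∧
            ∀ {k}, k < m → false ∈ (q k).map fun m => decide (m = 0) := fun q => Nat.mem_rfind
      refine (e1 fun k => f (Nat.pair n k)).trans (Iff.trans ?_
        (exists_congr fun j => (e1 fun k => gf (initSeg X j) (Nat.pair n k)).symm))
      simp only [Part.mem_map_iff]
      constructor
      · rintro ⟨⟨a, ha, h0⟩, h2⟩
        obtain ⟨i, hi⟩ := (hf3 _ _).1 ha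
        have : ∃ J, ∀ k < m, ∃ b ∈ gf (initSeg X J) (Nat.pair n k), decide (b = 0) = false := by
          have h3 : ∀ k, ∃ J, k < m →
              ∃ b ∈ gf (initSeg X J) (Nat.pair n k), decide (b = 0) = false := by
            intro k
            by_cases hk : k < m
            · obtain ⟨b, hb, h1⟩ := h2 hk
              obtain ⟨J, hJ⟩ := (hf3 _ _).1 hb
              exact ⟨J, fun _ => ⟨b, hJ, h1⟩⟩
            · exact ⟨0, fun h => absurd h hk⟩
          choose J hJ using h3
          refine ⟨(Finset.range m).sup J, fun k hk => ?_⟩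
          obtain ⟨b, hb, h1⟩ := hJ k hk
          exact ⟨b, hf2 _ _ _ _ (Finset.le_sup (Finset.mem_range.2 hk)) hb, h1⟩
        obtain ⟨J, hJ⟩ := this
        refine ⟨max i J, ⟨a, hf2 _ _ _ _ (le_max_left _ _) hi, h0⟩, fun {k} hk => ?_⟩
        obtain ⟨b, hb, h1⟩ := hJ k hk
        exact ⟨b, hf2 _ _ _ _ (le_max_right _ _) hb, h1⟩
      · rintro ⟨j, ⟨a, ha, h0⟩, h2⟩
        refine ⟨⟨a, (hf3 _ _).2 ⟨j, ha⟩, h0⟩, fun {k} hk => ?_⟩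
        obtain ⟨b, hb, h1⟩ := h2 hk
        exact ⟨b, (hf3 _ _).2 ⟨j, hb⟩, h1⟩

theorem recursiveIn_initSeg (X : ℕ → ℕ) :
    Nat.RecursiveIn {(X : ℕ →. ℕ)} fun k => Part.some (Encodable.encode (initSeg X k)) := by
  have hX : Nat.RecursiveIn {(X : ℕ →. ℕ)} (X : ℕ →. ℕ) := .oracle _ rfl
  have hP : Nat.Primrec fun q => Encodable.encode
      ((Denumerable.ofNat (List ℕ) q.unpair.1) ++ [q.unpair.2]) :=
    Primrec.nat_iff.1 <| Primrec.encode.comp <| Primrec.list_concat.comp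
      ((Primrec.ofNat _).comp (Primrec.fst.comp Primrec.unpair)) (Primrec.snd.comp Primrec.unpair)
  have hl : Nat.Primrec fun q : ℕ => q.unpair.2.unpair.2 := Nat.Primrec.right.comp Nat.Primrec.right
  have hr : Nat.Primrec fun q : ℕ => q.unpair.2.unpair.1 := Nat.Primrec.left.comp Nat.Primrec.right
  have step := Nat.RecursiveIn.comp (Nat.Primrec.recursiveIn hP)
    (Nat.RecursiveIn.pair (Nat.Primrec.recursiveIn hl) (hX.comp (Nat.Primrec.recursiveIn hr)))
  have h := (Nat.RecursiveIn.prec (Nat.Primrec.recursiveIn (Nat.Primrec.const 0)) step).comp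
    (Nat.Primrec.recursiveIn (Nat.Primrec.pair (Nat.Primrec.const 0) Nat.Primrec.id))
  refine h.of_eq fun k => ?_
  simp
  induction k with
  | zero => simp [initSeg]
  | succ k ih =>
    simp only [ih]
    have hk : (Part.some k >>= (X : ℕ →. ℕ)) = Part.some (X k) := Part.bind_some _ _
    simp [initSeg, List.range_succ, Seq.seq, hk]

theorem recursiveIn_Phi (e : ℕ) (X : ℕ → ℕ) :
    Nat.RecursiveIn {(X : ℕ →. ℕ)} (Phi e X) := by
  have hpr : Primrec fun q : ℕ =>
      probe e (Denumerable.ofNat (List ℕ) q.unpair.2) q.unpair.1.unpair.2 q.unpair.1.unpair.1 := by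
    have h1 : Primrec fun q : ℕ => q.unpair.1 := Primrec.fst.comp Primrec.unpair
    have h2 : Primrec fun q : ℕ => q.unpair.2 := Primrec.snd.comp Primrec.unpair
    have hk := h2.comp h1
    exact Nat.Partrec.Code.primrec_evaln.comp
      (Primrec.pair (Primrec.pair (h2.comp hk) (Primrec.const _))
        (Primrec₂.natPair.comp
          (Primrec.encode.comp (Primrec.list_take.comp (h1.comp hk) ((Primrec.ofNat _).comp h2)))
          (h1.comp h1)))
  have hS : Nat.RecursiveIn {(X : ℕ →. ℕ)} fun p => Part.some
      (Nat.pair p (Encodable.encode (initSeg X p.unpair.2))) := by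
    refine ((Nat.Primrec.recursiveIn Nat.Primrec.id).pair
      ((recursiveIn_initSeg X).comp (Nat.Primrec.recursiveIn Nat.Primrec.right))).of_eq fun p => ?_
    simp [Seq.seq]
  have hstat : Nat.RecursiveIn {(X : ℕ →. ℕ)} fun p => Part.some
      (if (probe e (initSeg X p.unpair.2) p.unpair.2 p.unpair.1).isSome then 0 else 1) := by
    refine ((Nat.Primrec.recursiveIn (Primrec.nat_iff.1 (Primrec.ite
      (Primrec.eq.comp (Primrec.option_isSome.comp hpr) (Primrec.const true))
      (Primrec.const 0) (Primrec.const 1)))).comp hS).of_eq fun p => ?_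
    simp
  have hval : Nat.RecursiveIn {(X : ℕ →. ℕ)} fun p => Part.some
      ((probe e (initSeg X p.unpair.2) p.unpair.2 p.unpair.1).getD 0) := by
    refine ((Nat.Primrec.recursiveIn (Primrec.nat_iff.1
      (Primrec.option_getD.comp hpr (Primrec.const 0)))).comp hS).of_eq fun p => ?_
    simp
  refine (hval.comp ((Nat.Primrec.recursiveIn Nat.Primrec.id).pair hstat.rfind)).of_eq fun n => ?_
  have e1 : (Nat.rfind fun k => (fun m => decide (m = 0)) <$> (Part.some
      (if (probe e (initSeg X (Nat.pair n k).unpair.2) (Nat.pair n k).unpair.2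
        (Nat.pair n k).unpair.1).isSome then 0 else 1) : Part ℕ)) =
      Nat.rfind fun k => Part.some (probe e (initSeg X k) k n).isSome := by
    congr 1
    funext k
    by_cases hk : (probe e (initSeg X k) k n).isSome <;> simp [hk]
  rw [e1]
  refine Part.ext fun m => ?_
  rw [Phi, Nat.rfindOpt]
  have e2 : ∀ k, k ∈ (Nat.rfind fun k => Part.some (probe e (initSeg X k) k n).isSome) →
      (probe e (initSeg X k) k n).isSome := fun k hk => by
    have := (Nat.mem_rfind.1 hk).1
    exact (Part.mem_some_iff.1 this).symm
  have e3 : (m ∈ (Nat.pair <$> Part.some n <*> Nat.rfind fun k =>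
        Part.some (probe e (initSeg X k) k n).isSome) >>= (fun p => Part.some
          ((probe e (initSeg X p.unpair.2) p.unpair.2 p.unpair.1).getD 0))) ↔
      ∃ k ∈ (Nat.rfind fun k => Part.some (probe e (initSeg X k) k n).isSome),
        m = (probe e (initSeg X k) k n).getD 0 := by
    simp [Seq.seq]
  refine Iff.trans e3 ?_
  rw [Part.mem_bind_iff]
  refine exists_congr fun k => and_congr_right fun hk => ?_
  obtain ⟨v, hv⟩ := Option.isSome_iff_exists.1 (e2 k hk)
  simp [hv]

theorem turingReducible_iff_exists_index (f : ℕ →. ℕ) (X : ℕ → ℕ) :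
    TuringReducible f X ↔ ∃ e, Phi e X = f := by
  rw [TuringReducible, RecursiveIn.iff_nat]
  constructor
  · intro h
    obtain ⟨g, hg1, _, hg3⟩ := approx_of_recursiveIn X h
    obtain ⟨e, he⟩ := exists_index_of_approx hg1 hg3
    exact ⟨e, funext he⟩
  · rintro ⟨e, rfl⟩
    exact recursiveIn_Phi e X

theorem mem_Phi_iff (e : ℕ) (X : ℕ → ℕ) (n m : ℕ) :
    m ∈ Phi e X n ↔ ∃ s, phiVal e (initSeg X s) n = some m := by
  have hlen : ∀ s, (initSeg X s).length = s := fun s => by simp [initSeg]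
  have hsame : ∀ s k, k < s + 1 → probe e (initSeg X s) k n = probe e (initSeg X k) k n := by
    intro s k hk
    rw [probe, probe, take_initSeg X (Nat.unpair_left_le k),
      take_initSeg X ((Nat.unpair_left_le k).trans (by omega))]
  have hval : ∀ s, phiVal e (initSeg X s) n =
      (List.range (s + 1)).findSome? fun k => probe e (initSeg X k) k n := by
    intro s
    rw [phiVal, hlen]
    have : ∀ L : List ℕ, (∀ k ∈ L, k < s + 1) →
        (L.findSome? fun k => probe e (initSeg X s) k n) =
          L.findSome? fun k => probe e (initSeg X k) k n := by
      intro L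
      induction L with
      | nil => simp
      | cons a L ih =>
        intro h
        rw [List.findSome?_cons, List.findSome?_cons, hsame s a (h a (by simp)),
          ih fun k hk => h k (by simp [hk])]
    exact this _ fun k hk => List.mem_range.1 hk
  have hstep : ∀ s m, (((List.range (s + 1)).findSome? fun k => probe e (initSeg X k) k n) = some m)
      → m ∈ Phi e X n := by
    intro s
    induction s with
    | zero =>
      intro m h
      have h0 : probe e (initSeg X 0) 0 n = none := by simp [probe, Nat.Partrec.Code.evaln]
      simp [h0] at h
    | succ s ih =>
      intro m h
      rw [List.range_succ, List.findSome?_append] at h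
      rcases hc : (List.range (s + 1)).findSome? (fun k => probe e (initSeg X k) k n) with _ | v
      · rw [hc] at h
        have hm : probe e (initSeg X (s + 1)) (s + 1) n = some m := by simpa using h
        have hnone : ∀ k < s + 1, probe e (initSeg X k) k n = none := by
          intro k hk
          exact List.findSome?_eq_none_iff.1 hc k (List.mem_range.2 hk)
        rw [Phi, Nat.rfindOpt, Part.mem_bind_iff]
        refine ⟨s + 1, Nat.mem_rfind.2 ⟨Part.mem_some_iff.2 (by rw [hm]; rfl), fun {k} hk =>
          Part.mem_some_iff.2 (by rw [hnone k hk]; rfl)⟩, Part.mem_ofOption.2 hm⟩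
      · rw [hc] at h
        have : v = m := by simpa using h
        exact ih m (this ▸ hc)
  constructor
  · intro h
    obtain ⟨k, hk⟩ := Nat.rfindOpt_spec h
    have hs : (phiVal e (initSeg X k) n).isSome := by
      rw [hval, List.findSome?_isSome_iff]
      exact ⟨k, by simp, by rw [Option.mem_def.1 hk]; rfl⟩
    obtain ⟨v, hv⟩ := Option.isSome_iff_exists.1 hs
    have := hstep k v ((hval k).symm.trans hv)
    exact ⟨k, hv.trans (congrArg some (Part.mem_unique this h))⟩
  · rintro ⟨s, hs⟩
    exact hstep s m ((hval s).symm.trans hs)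

end Pulldown

open Pulldown

/-!
# The pulldown lemma

The tree `T` is built by a finite injury construction that is computable in `X`, while membership
in `T'` can only be approximated.

**Nodes.** By the limit lemma (`one_mem_Phi_jump_iff`), a computation from `X'` that accepts a
string is the limit of computations from approximations to `X'`, and a *certificate* is the least
stage from which on this approximation does not change. A *node* is a string of length at most `l`
followed by further numbers with their certificates. A wrong certificate is refuted at some stage,
and a string has exactly one node with right certificates iff it satisfies the condition for
membership in `T'` (`exists_isTrue`, `IsTrue.unique`). The tree of these strings is `upperTree`.
It makes sense for every index, is the given tree if the index is good, and contains all nice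
trees whose strings are accepted (`subset_upperTree`).

**Construction.** Each node has a value, a string in `T`; the value of a successor for the number
`x` extends the value of its predecessor followed by `x`, and by a new number that codes the
successor and the stage. Whether a string is in `T` is decided at the stage given by its code:
up to length `l` the tree `T'` is copied, niceness is obeyed where it applies, and otherwise a
string longer than `l + 1` enters only if it is an initial segment of the value of a living node,
or a one-number extension of such a value. A node acts by extending its value inside the part of the tree
enumerated so far, and then all nodes with larger codes start again. The length `n` of the string
of a node modulo `4` tells what the node wants:

* for `n = 4i + 3`, a value that extends a member of an r.e. set. If there is none, then the r.e.
  set is strongly avoided. This makes the paths of `T` generic (`meets_or_stronglyAvoids`).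
* for `n = 4i`, a value from which a long string of small numbers is computed. Later nodes are
  then given values with larger numbers, so that no path through them extends this string
  (`not_reducible`).
* for `n = 4i + 2`, values of the two successors that are `i`-splitting, or else a value above
  which nothing is `i`-splitting (`nodeMap_splitting`). If a splitting pair is found that lies
  above one of the two successors, the node moves above the other one and from then on goes to
  extensions that compute more and more. This ends, because a string that computes enough splits
  with a member of the pair.

Each node acts only finitely often (`eventually_want_none`), and the map `nodeMap` takes a string
in `T'` to the final value of its node with right certificates. All final values are in `T`,
because the values of living nodes are in the tree as far as it has been decided
(`supported_start`).

**Paths.** A path of `T` extends values of living nodes at arbitrarily late stages. As the number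
placed after the start of a successor codes this successor, it is always the same successor that
these values go through, so that its certificates are right (`exists_child_of_path`). Hence the
final values along each path of `T` come from a path of `T'`, and the map is a homeomorphism
(`Branches.exists_homeomorph`). As the paths are generic, none is computable in `X`, and the jump
of `f ⊕ X` is decided by initial segments of `f` (`exists_jump_index`).

**Uniformity.** The stages of the construction are primitive recursive in `l`, `e`, `e₀` and an
initial segment of `X` (`primrec_stateStr`), and searches through oracle segments and witnesses
have indices that are primitive recursive in their parameters (`exists_index`, `exists_query`).
-/


namespace Pulldown

open Encodable Denumerable

/-! ### Strings, codes and initial segments -/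

@[simp] theorem length_initSeg (f : ℕ → ℕ) (n : ℕ) : (initSeg f n).length = n := by simp [initSeg]

theorem initSeg_succ (f : ℕ → ℕ) (n : ℕ) : initSeg f (n + 1) = initSeg f n ++ [f n] := by
  simp [initSeg, List.range_succ]

theorem getElem?_initSeg (f : ℕ → ℕ) (n i : ℕ) :
    (initSeg f n)[i]? = if i < n then some (f i) else none := by
  by_cases h : i < n
  · rw [if_pos h, List.getElem?_eq_getElem (by simpa using h)]
    simp [initSeg]
  · rw [if_neg h, List.getElem?_eq_none (by simpa using h)]

theorem initSeg_prefix (f : ℕ → ℕ) {m n : ℕ} (h : m ≤ n) : initSeg f m <+: initSeg f n := by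
  rw [← take_initSeg f h]; exact List.take_prefix _ _

theorem isInit_initSeg (f : ℕ → ℕ) (n : ℕ) : IsInit (initSeg f n) f := by simp [IsInit]

theorem IsInit.of_prefix {σ τ : List ℕ} {f : ℕ → ℕ} (h : IsInit τ f) (hs : σ <+: τ) :
    IsInit σ f := by
  have h1 := List.prefix_iff_eq_take.1 hs
  rw [h, take_initSeg f hs.length_le] at h1
  exact h1

theorem IsInit.prefix_initSeg {σ : List ℕ} {f : ℕ → ℕ} (h : IsInit σ f) {n : ℕ}
    (hn : σ.length ≤ n) : σ <+: initSeg f n := by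
  rw [h]; exact initSeg_prefix f hn

theorem IsInit.prefix_of_le {σ τ : List ℕ} {f : ℕ → ℕ} (h : IsInit σ f) (h' : IsInit τ f)
    (hl : σ.length ≤ τ.length) : σ <+: τ := by
  rw [h']; exact h.prefix_initSeg hl

theorem isInit_iff {σ : List ℕ} {f : ℕ → ℕ} : IsInit σ f ↔ ∀ n x, σ[n]? = some x → f n = x := by
  constructor
  · intro h n x hx
    rw [h, getElem?_initSeg] at hx
    split_ifs at hx
    exact Option.some.inj hx
  · intro h
    refine List.ext_getElem? fun n => ?_
    rw [getElem?_initSeg]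
    split_ifs with hn
    · rw [List.getElem?_eq_getElem hn, h n _ (List.getElem?_eq_getElem hn)]
    · exact List.getElem?_eq_none (not_lt.1 hn)

theorem IsInit.concat {σ : List ℕ} {f : ℕ → ℕ} (h : IsInit σ f) : IsInit (σ ++ [f σ.length]) f := by
  rw [IsInit, List.length_append, List.length_singleton, initSeg_succ, ← h]

theorem IsInit.eq_concat {σ : List ℕ} {x : ℕ} {f : ℕ → ℕ} (h : IsInit (σ ++ [x]) f) :
    f σ.length = x := isInit_iff.1 h _ _ (by simp)

theorem eq_of_initSeg {f g : ℕ → ℕ} (h : ∀ n, initSeg f n = initSeg g n) : f = g := by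
  funext n
  have := congrArg (fun L : List ℕ => L[n]?) (h (n + 1))
  simpa only [getElem?_initSeg, Nat.lt_succ_self, if_true, Option.some.injEq] using this

theorem prefix_concat_iff {σ τ : List ℕ} {x : ℕ} : σ <+: τ ++ [x] ↔ σ = τ ++ [x] ∨ σ <+: τ := by
  rw [List.prefix_concat_iff]

/-- If `σ ⌢ x` and `σ ⌢ y` are initial segments of one string, then `x = y`. -/
theorem concat_prefix_inj {σ τ : List ℕ} {x y : ℕ} (h : σ ++ [x] <+: τ) (h' : σ ++ [y] <+: τ) :
    x = y := by
  have := List.prefix_of_prefix_length_le h h' (by simp)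
  have := this.eq_of_length (by simp)
  simpa using this

theorem encode_cons (a : ℕ) (σ : List ℕ) : encode (a :: σ) = (Nat.pair a (encode σ)).succ := by
  rw [Encodable.encode_list_cons]; rfl

theorem lt_encode_of_mem {a : ℕ} {σ : List ℕ} (h : a ∈ σ) : a < encode σ := by
  induction σ with
  | nil => simp at h
  | cons b σ ih =>
    rw [encode_cons, Nat.lt_succ_iff]
    rcases List.mem_cons.1 h with rfl | h
    · exact Nat.left_le_pair _ _
    · exact (ih h).le.trans (Nat.right_le_pair _ _)

theorem length_le_encode (σ : List ℕ) : σ.length ≤ encode σ := by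
  induction σ with
  | nil => simp
  | cons b σ ih =>
    rw [encode_cons, List.length_cons]
    exact Nat.succ_le_succ (ih.trans (Nat.right_le_pair _ _))

theorem encode_tail_lt (y : ℕ) (q : List ℕ) : encode q < encode (y :: q) := by
  rw [encode_cons, Nat.lt_succ_iff]; exact Nat.right_le_pair _ _

theorem encode_le_of_prefix {σ τ : List ℕ} (h : σ <+: τ) : encode σ ≤ encode τ := by
  induction σ generalizing τ with
  | nil => simp
  | cons a σ ih =>
    obtain ⟨ρ, rfl⟩ := h
    rw [List.cons_append, encode_cons, encode_cons]
    refine Nat.succ_le_succ ?_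
    rcases (ih ⟨ρ, rfl⟩ : encode σ ≤ encode (σ ++ ρ)).lt_or_eq with h | h
    · exact (Nat.pair_lt_pair_right _ h).le
    · rw [h]

theorem encode_lt_of_prefix {σ τ : List ℕ} (h : σ <+: τ) (hne : σ ≠ τ) : encode σ < encode τ :=
  lt_of_le_of_ne (encode_le_of_prefix h) fun he => hne (encode_injective he)

/-! ### Computations from strings -/

theorem probe_mono {e k n m : ℕ} {ρ ρ' : List ℕ} (h : ρ <+: ρ') (hk : k ≤ ρ.length) :
    probe e ρ k n = some m ↔ probe e ρ' k n = some m := by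
  have : ρ.take k.unpair.1 = ρ'.take k.unpair.1 := by
    obtain ⟨t, rfl⟩ := h
    rw [List.take_append_of_le_length ((Nat.unpair_left_le k).trans hk)]
  rw [probe, probe, this]

theorem phiVal_mono {e n m : ℕ} {ρ ρ' : List ℕ} (h : ρ <+: ρ') (hm : phiVal e ρ n = some m) :
    phiVal e ρ' n = some m := by
  have hle := h.length_le
  rw [phiVal] at hm ⊢
  have h1 : ((List.range (ρ.length + 1)).findSome? fun k => probe e ρ' k n) = some m := by
    rw [← hm]
    have : ∀ L : List ℕ, (∀ k ∈ L, k < ρ.length + 1) →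
        (L.findSome? fun k => probe e ρ' k n) = L.findSome? fun k => probe e ρ k n := by
      intro L
      induction L with
      | nil => simp
      | cons a L ih =>
        intro h2
        have ha : probe e ρ' a n = probe e ρ a n := Option.ext fun v =>
          (probe_mono h (by have := h2 a (by simp); omega)).symm
        rw [List.findSome?_cons, List.findSome?_cons, ih fun k hk => h2 k (by simp [hk]), ha]
    exact this _ fun k hk => List.mem_range.1 hk
  obtain ⟨d, hd⟩ := Nat.exists_eq_add_of_le hle
  rw [hd, show ρ.length + d + 1 = ρ.length + 1 + d by omega, List.range_add, List.findSome?_append,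
    h1]
  rfl

theorem mem_Phi_of_phiVal {e : ℕ} {X : ℕ → ℕ} {n m s : ℕ}
    (h : phiVal e (initSeg X s) n = some m) : m ∈ Phi e X n := (mem_Phi_iff e X n m).2 ⟨s, h⟩

theorem Phi_dom_iff {e : ℕ} {X : ℕ → ℕ} {n : ℕ} :
    (Phi e X n).Dom ↔ ∃ s, (phiVal e (initSeg X s) n).isSome := by
  rw [Part.dom_iff_mem]
  simp only [mem_Phi_iff, Option.isSome_iff_exists]
  exact ⟨fun ⟨m, s, h⟩ => ⟨s, m, h⟩, fun ⟨s, m, h⟩ => ⟨m, s, h⟩⟩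

theorem prefix_reduceOption_takeWhile {σ : List ℕ} {L : List (Option ℕ)} :
    σ <+: (L.takeWhile Option.isSome).reduceOption ↔ σ.map some <+: L := by
  induction L generalizing σ with
  | nil => simp [List.reduceOption]
  | cons a L ih =>
    cases σ with
    | nil => simp
    | cons b σ =>
      cases a with
      | none => simp [List.reduceOption]
      | some c => simp [List.cons_prefix_cons, ih]

theorem prefix_phiStr_iff {e : ℕ} {σ ρ : List ℕ} :
    σ <+: phiStr e ρ ↔
      σ.length ≤ ρ.length ∧ ∀ n x, σ[n]? = some x → phiVal e ρ n = some x := by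
  rw [phiStr, prefix_reduceOption_takeWhile, List.prefix_iff_getElem?]
  constructor
  · intro h
    have hlen : σ.length ≤ ρ.length := by
      by_contra hc
      have := h ρ.length (by simpa using not_le.1 hc)
      simp at this
    refine ⟨hlen, fun n x hx => ?_⟩
    obtain ⟨hn, hx⟩ := List.getElem?_eq_some_iff.1 hx
    have := h n (by simpa using hn)
    rw [List.getElem?_map, List.getElem?_range (hn.trans_le hlen)] at this
    simpa [hx] using this
  · rintro ⟨h1, h2⟩ i hi
    have hi' : i < σ.length := by simpa using hi
    rw [List.getElem?_map, List.getElem?_range (hi'.trans_le h1)]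
    simp [h2 i _ (List.getElem?_eq_getElem hi')]

theorem phiStr_mono {e : ℕ} {ρ ρ' : List ℕ} (h : ρ <+: ρ') : phiStr e ρ <+: phiStr e ρ' := by
  obtain ⟨h1, h2⟩ := prefix_phiStr_iff.1 (List.prefix_refl (phiStr e ρ))
  exact prefix_phiStr_iff.2 ⟨h1.trans h.length_le, fun n x hx => phiVal_mono h (h2 n x hx)⟩

theorem joinStr_initSeg (f X : ℕ → ℕ) (n : ℕ) : joinStr (initSeg f n) X = initSeg (join f X) (2 * n) := by
  rw [joinStr, length_initSeg]
  refine List.ext_getElem? fun i => ?_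
  rw [getElem?_initSeg, getElem?_initSeg]
  split_ifs with hi
  · rw [join, join]
    split_ifs with h2
    · rw [List.getD_eq_getElem?_getD, getElem?_initSeg, if_pos (by omega)]; rfl
    · rfl
  · rfl

theorem isInit_getD (τ : List ℕ) : IsInit τ (fun n => τ.getD n 0) :=
  isInit_iff.2 fun n x h => by simp [List.getD_eq_getElem?_getD, h]

theorem joinStr_mono {τ τ' : List ℕ} (X : ℕ → ℕ) (h : τ <+: τ') : joinStr τ X <+: joinStr τ' X := by
  have h2 := (isInit_getD τ').of_prefix h
  have h3 := initSeg_prefix (join (fun n => τ'.getD n 0) X)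
    (Nat.mul_le_mul_left 2 h.length_le)
  rwa [← joinStr_initSeg, ← joinStr_initSeg, ← isInit_getD τ', ← h2] at h3

theorem joinStr_congr {τ : List ℕ} {X Y : ℕ → ℕ} (h : ∀ n < τ.length, X n = Y n) :
    joinStr τ X = joinStr τ Y := by
  rw [joinStr, joinStr]
  refine List.ext_getElem? fun i => ?_
  rw [getElem?_initSeg, getElem?_initSeg]
  split_ifs with hi
  · rw [join, join]
    split_ifs with h2
    · rfl
    · rw [h _ (by omega)]
  · rfl

/-- The string computed by the `i`-th functional from `τ ⊕ X`. -/
def phiOn (i : ℕ) (X : ℕ → ℕ) (τ : List ℕ) : List ℕ := phiStr i (joinStr τ X)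

theorem phiOn_mono {i : ℕ} {X : ℕ → ℕ} {τ τ' : List ℕ} (h : τ <+: τ') :
    phiOn i X τ <+: phiOn i X τ' := phiStr_mono (joinStr_mono X h)

theorem isInit_phiStr {e : ℕ} {A g : ℕ → ℕ} (h : ∀ n, g n ∈ Phi e A n) (s : ℕ) :
    IsInit (phiStr e (initSeg A s)) g := by
  refine isInit_iff.2 fun n x hx => ?_
  have := (prefix_phiStr_iff.1 (List.prefix_refl _)).2 n x hx
  exact Part.mem_unique (h n) (mem_Phi_of_phiVal this)

theorem exists_prefix_phiStr {e : ℕ} {A g : ℕ → ℕ} (h : ∀ n, g n ∈ Phi e A n) (N : ℕ) :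
    ∃ M, ∀ s ≥ M, initSeg g N <+: phiStr e (initSeg A s) := by
  have h1 : ∀ n, ∃ s, phiVal e (initSeg A s) n = some (g n) := fun n => (mem_Phi_iff _ _ _ _).1 (h n)
  choose S hS using h1
  refine ⟨N + (Finset.range N).sup S, fun s hs => prefix_phiStr_iff.2 ⟨by simp; omega, ?_⟩⟩
  intro n x hx
  rw [getElem?_initSeg] at hx
  split_ifs at hx with hn
  rw [← Option.some.inj hx]
  refine phiVal_mono (initSeg_prefix A ?_) (hS n)
  have := Finset.le_sup (f := S) (Finset.mem_range.2 hn)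
  omega

theorem isInit_phiOn {e : ℕ} {f X g : ℕ → ℕ} (h : ∀ n, g n ∈ Phi e (join f X) n) {τ : List ℕ}
    (hτ : IsInit τ f) : IsInit (phiOn e X τ) g := by
  rw [phiOn, hτ, joinStr_initSeg]; exact isInit_phiStr h _

theorem exists_prefix_phiOn {e : ℕ} {f X g : ℕ → ℕ} (h : ∀ n, g n ∈ Phi e (join f X) n) (N : ℕ) :
    ∃ M, ∀ s ≥ M, initSeg g N <+: phiOn e X (initSeg f s) := by
  obtain ⟨M, hM⟩ := exists_prefix_phiStr h N
  exact ⟨M, fun s hs => by rw [phiOn, joinStr_initSeg]; exact hM _ (by omega)⟩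

theorem Splitting.mono {i : ℕ} {X : ℕ → ℕ} {τ₀ τ₁ τ₀' τ₁' : List ℕ} (h : Splitting i X τ₀ τ₁)
    (h₀ : τ₀ <+: τ₀') (h₁ : τ₁ <+: τ₁') : Splitting i X τ₀' τ₁' := by
  have m0 : phiOn i X τ₀ <+: phiOn i X τ₀' := phiOn_mono h₀
  have m1 : phiOn i X τ₁ <+: phiOn i X τ₁' := phiOn_mono h₁
  have key : ∀ {a b c : List ℕ}, a <+: c → b <+: c → a <+: b ∨ b <+: a := fun ha hb =>
    List.prefix_or_prefix_of_prefix ha hb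
  constructor
  · intro hc
    rcases key (m0.trans hc) m1 with h2 | h2
    · exact h.1 h2
    · exact h.2 h2
  · intro hc
    rcases key (m1.trans hc) m0 with h2 | h2
    · exact h.2 h2
    · exact h.1 h2

theorem turingReducible_iff {g A : ℕ → ℕ} :
    TuringReducible (g : ℕ →. ℕ) (A : ℕ →. ℕ) ↔ ∃ e, ∀ n, g n ∈ Phi e A n := by
  rw [turingReducible_iff_exists_index]
  refine exists_congr fun e => ⟨fun h n => by rw [h]; exact Part.mem_some _, fun h => ?_⟩
  funext n
  exact Part.eq_some_iff.2 (h n)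

/-! ### Approximating the jump -/

/-- The approximation to the jump of `X` computed from the string `χ`, an initial segment
of `X`. -/
def jumpApprox (χ : List ℕ) : List ℕ :=
  (List.range χ.length).map fun n => if (phiVal n χ n).isSome then 1 else 0

@[simp] theorem length_jumpApprox (χ : List ℕ) : (jumpApprox χ).length = χ.length := by
  simp [jumpApprox]

theorem jump_eq_one_iff {X : ℕ → ℕ} {n : ℕ} : jump X n = 1 ↔ (Phi n X n).Dom := by
  rw [jump]; split_ifs <;> simp_all

theorem jump_eq_zero_iff {X : ℕ → ℕ} {n : ℕ} : jump X n = 0 ↔ ¬ (Phi n X n).Dom := by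
  rw [jump]; split_ifs <;> simp_all

theorem phiVal_isSome_mono {e n : ℕ} {ρ ρ' : List ℕ} (h : ρ <+: ρ') (hm : (phiVal e ρ n).isSome) :
    (phiVal e ρ' n).isSome := by
  obtain ⟨m, hm⟩ := Option.isSome_iff_exists.1 hm
  rw [phiVal_mono h hm]; rfl

theorem exists_jumpApprox_take (X : ℕ → ℕ) (k : ℕ) :
    ∃ s₀, ∀ s ≥ s₀, (jumpApprox (initSeg X s)).take k = initSeg (jump X) k := by
  have h1 : ∀ n, ∃ s, (Phi n X n).Dom → (phiVal n (initSeg X s) n).isSome := by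
    intro n
    by_cases h : (Phi n X n).Dom
    · obtain ⟨s, hs⟩ := Phi_dom_iff.1 h
      exact ⟨s, fun _ => hs⟩
    · exact ⟨0, fun h' => absurd h' h⟩
  choose S hS using h1
  refine ⟨k + (Finset.range k).sup S, fun s hs => List.ext_getElem? fun i => ?_⟩
  rw [List.getElem?_take, getElem?_initSeg]
  split_ifs with hi
  · rw [jumpApprox, List.getElem?_map, List.getElem?_range (by simp; omega), jump]
    have hle := Finset.le_sup (f := S) (Finset.mem_range.2 hi)
    have : (phiVal i (initSeg X s) i).isSome ↔ (Phi i X i).Dom :=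
      ⟨fun h => Phi_dom_iff.2 ⟨s, h⟩, fun h =>
        phiVal_isSome_mono (initSeg_prefix X (by omega)) (hS i h)⟩
    by_cases hd : (Phi i X i).Dom <;> simp [hd, this]
  · rfl

/-- The first halting probe of the `e`-th functional on `n` with the approximation to the jump as
oracle, together with its value. -/
def firstProbe (e : ℕ) (χ : List ℕ) (n : ℕ) : Option (ℕ × ℕ) :=
  (List.range (χ.length + 1)).findSome? fun k =>
    (probe e (jumpApprox χ) k n).map fun w => (k, w)

/-- A positive number if the `e`-th functional with the approximation to the jump as oracle gives
`1` at `n`, and `0` otherwise. A positive value codes the part of the oracle the computation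
uses, so that it stays the same exactly as long as the computation does. -/
def accept (e : ℕ) (χ : List ℕ) (n : ℕ) : ℕ :=
  ((firstProbe e χ n).bind fun kw =>
    if kw.2 = 1 then some (encode ((jumpApprox χ).take kw.1) + 1) else none).getD 0

theorem firstProbe_eq_some {e : ℕ} {χ : List ℕ} {n k w : ℕ} :
    firstProbe e χ n = some (k, w) ↔
      k ≤ χ.length ∧ probe e (jumpApprox χ) k n = some w ∧
        ∀ j < k, probe e (jumpApprox χ) j n = none := by
  have gen : ∀ N (F : ℕ → Option ℕ),
      ((List.range N).findSome? fun k => (F k).map fun w => (k, w)) = some (k, w) ↔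
        k < N ∧ F k = some w ∧ ∀ j < k, F j = none := by
    intro N F
    induction N with
    | zero => simp
    | succ N ih =>
      rw [List.range_succ, List.findSome?_append]
      by_cases hN : ∃ j < N, F j ≠ none
      · obtain ⟨j, hj, hj2⟩ := hN
        have h1 : ((List.range N).findSome? fun k => (F k).map fun w => (k, w)).isSome := by
          rw [List.findSome?_isSome_iff]
          exact ⟨j, by simpa using hj, by
            obtain ⟨v, hv⟩ := Option.ne_none_iff_exists'.1 hj2; simp [hv]⟩
        obtain ⟨v, hv⟩ := Option.isSome_iff_exists.1 h1
        rw [hv]; rw [hv] at ih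
        simp only [Option.some_or, ih]
        constructor
        · rintro ⟨a, b⟩; exact ⟨by omega, b⟩
        · rintro ⟨a, b, c⟩
          refine ⟨?_, b, c⟩
          by_contra hc
          exact hj2 (c j (by omega))
      · push Not at hN
        have h1 : ((List.range N).findSome? fun k => (F k).map fun w => (k, w)) = none := by
          rw [List.findSome?_eq_none_iff]
          intro j hj; simp [hN j (by simpa using hj)]
        rw [h1]
        simp only [Option.none_or, List.findSome?_singleton, Option.map_eq_some_iff, Prod.mk.injEq]
        constructor
        · rintro ⟨a, b, rfl, rfl⟩; exact ⟨by omega, b, hN⟩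
        · rintro ⟨a, b, c⟩
          have : N = k := by
            by_contra hc
            have := hN k (by omega)
            simp [this] at b
          subst this
          exact ⟨w, b, rfl, rfl⟩
  rw [firstProbe, gen, Nat.lt_succ_iff]

theorem accept_pos_iff {e : ℕ} {χ : List ℕ} {n c : ℕ} :
    accept e χ n = c + 1 ↔
      ∃ k, firstProbe e χ n = some (k, 1) ∧ encode ((jumpApprox χ).take k) = c := by
  rw [accept]
  rcases h : firstProbe e χ n with _ | ⟨k, w⟩
  · simp
  · by_cases hw : w = 1
    · subst hw; simp
    · simp [hw]

theorem mem_Phi_iff_probe {e n m : ℕ} {A : ℕ → ℕ} :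
    m ∈ Phi e A n ↔ ∃ k, probe e (initSeg A k) k n = some m ∧
      ∀ j < k, probe e (initSeg A j) j n = none := by
  rw [Phi, Nat.rfindOpt, Part.mem_bind_iff]
  refine exists_congr fun k => ?_
  refine Iff.trans (and_congr Nat.mem_rfind (by rw [Part.mem_ofOption, Option.mem_def])) ?_
  constructor
  · rintro ⟨⟨_, h1⟩, h2⟩
    exact ⟨h2, fun j hj => by simpa using (Part.mem_some_iff.1 (h1 hj)).symm⟩
  · rintro ⟨h1, h2⟩
    exact ⟨⟨Part.mem_some_iff.2 (by rw [h1]; rfl),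
      fun {j} hj => Part.mem_some_iff.2 (by rw [h2 j hj]; rfl)⟩, h1⟩

theorem probe_take {e : ℕ} {ρ : List ℕ} {k n : ℕ} : probe e (ρ.take k) k n = probe e ρ k n := by
  rw [probe, probe, List.take_take, min_eq_left (Nat.unpair_left_le k)]

/-- The limit lemma for computations from the jump: the `e`-th functional gives `1` from the jump
iff its approximations settle on one accepting computation. -/
theorem one_mem_Phi_jump_iff (e : ℕ) (X : ℕ → ℕ) (n : ℕ) :
    1 ∈ Phi e (jump X) n ↔ ∃ v ≠ 0, ∃ c, ∀ s ≥ c, accept e (initSeg X s) n = v := by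
  constructor
  · intro h
    obtain ⟨k, hk, hlt⟩ := mem_Phi_iff_probe.1 h
    obtain ⟨s₀, hs₀⟩ := exists_jumpApprox_take X k
    refine ⟨encode (initSeg (jump X) k) + 1, by simp, s₀ + k, fun s hs => ?_⟩
    rw [accept_pos_iff]
    have ht := hs₀ s (by omega)
    refine ⟨k, firstProbe_eq_some.2 ⟨by simp; omega, ?_, fun j hj => ?_⟩, by rw [ht]⟩
    · rw [← probe_take, ht]; exact hk
    · rw [← probe_take, ← hlt j hj, ← take_initSeg (jump X) hj.le, ← ht, List.take_take,
        min_eq_left hj.le]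
  · rintro ⟨v, hv, c, hc⟩
    obtain ⟨v, rfl⟩ := Nat.exists_eq_succ_of_ne_zero hv
    obtain ⟨k, hk, hv1⟩ := accept_pos_iff.1 (hc c le_rfl)
    have hkc : k ≤ c := by simpa using (firstProbe_eq_some.1 hk).1
    have same : ∀ s ≥ c, firstProbe e (initSeg X s) n = some (k, 1) ∧
        (jumpApprox (initSeg X s)).take k = (jumpApprox (initSeg X c)).take k := by
      intro s hs
      obtain ⟨k', hk', hv'⟩ := accept_pos_iff.1 (hc s hs)
      have h1 := encode_injective (hv'.trans hv1.symm)
      have h2 := congrArg List.length h1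
      have := (firstProbe_eq_some.1 hk').1
      simp only [List.length_take, length_jumpApprox, length_initSeg] at h2 this
      have : k' = k := by omega
      subst this
      exact ⟨hk', h1⟩
    obtain ⟨s₀, hs₀⟩ := exists_jumpApprox_take X k
    obtain ⟨h1, h2⟩ := same (s₀ + c) (by omega)
    have ht := hs₀ (s₀ + c) (by omega)
    obtain ⟨_, h4, h5⟩ := firstProbe_eq_some.1 h1
    refine mem_Phi_iff_probe.2 ⟨k, ?_, fun j hj => ?_⟩
    · rw [← ht, probe_take]; exact h4
    · rw [← take_initSeg (jump X) hj.le, ← ht, List.take_take, min_eq_left hj.le, probe_take]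
      exact h5 j hj

end Pulldown

namespace Pulldown

open Encodable Denumerable

/-! ### The construction -/

/-- The data `(l, e, e₀)` that the indices are computed from. -/
abbrev Params := ℕ × ℕ × ℕ

/-- The strings that have to be accepted when `σ` is put into the tree `T'`: besides `σ`, the two
successors that niceness demands. -/
def required (σ : List ℕ) : List (List ℕ) :=
  if σ.length % 4 = 2 then [σ, σ ++ [0], σ ++ [1]] else [σ]

open Classical in
/-- The approximation from the string `χ` to the statement that `σ` satisfies the condition for
membership in `T'`. The statement is true iff the values settle on a positive number. -/
noncomputable def certVal (p : Params) (χ σ : List ℕ) : ℕ :=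
  if phiVal p.2.2 χ (encode (σ.take p.1)) = some 1 ∧ (σ.length % 4 = 3 → σ.getLastD 0 ≤ 1) ∧
      ∀ τ ∈ required σ, accept p.2.1 χ (encode τ) ≠ 0
  then encode ((required σ).map fun τ => accept p.2.1 χ (encode τ)) + 1 else 0

/-- As far as the string `χ` shows, `c` is the least stage from which on `certVal` has a constant
positive value at the string `σ`, which is longer than `l`. -/
def CertOk (p : Params) (χ σ : List ℕ) (c : ℕ) : Prop :=
  c < χ.length + 1 ∧ p.1 < σ.length ∧ certVal p (χ.take c) σ ≠ 0 ∧
    (∀ u < χ.length + 1, c ≤ u → certVal p (χ.take u) σ = certVal p (χ.take c) σ) ∧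
    ∀ d < c, d + 1 = c → certVal p (χ.take d) σ ≠ certVal p (χ.take c) σ

/-- The string that a node stands for. A node is a list, with the most recent entry first. Its
oldest entry codes a string of length at most `l`, and each further entry is a pair of a number
that is appended to the string and a certificate for the resulting string. -/
def nodeStr : List ℕ → List ℕ
  | [] => []
  | y :: q => if q = [] then ofNat (List ℕ) y else nodeStr q ++ [y.unpair.1]

/-- The certificates of the node look right as far as the string `χ` shows. -/
def Alive (p : Params) (χ : List ℕ) : List ℕ → Prop
  | [] => False
  | y :: q => if q = [] then (ofNat (List ℕ) y).length ≤ p.1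
      else Alive p χ q ∧ CertOk p χ (nodeStr (y :: q)) y.unpair.2

/-- What the construction records about a node: a phase, the value `v₀` it was given when it was
initialised, its present value `v`, and the strings `b₀` and `b₁` from which its successors for
the numbers `0` and `1` start. -/
abbrev NodeData := ℕ × List ℕ × List ℕ × List ℕ × List ℕ

/-- The phase of a node: `0` if it has not acted, `1` if its value has been moved, and `2` if it
has been given a splitting pair. -/
abbrev NodeData.phase (d : NodeData) : ℕ := d.1

/-- The value of a node at its initialisation. -/
abbrev NodeData.v₀ (d : NodeData) : List ℕ := d.2.1

/-- The present value of a node. -/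
abbrev NodeData.v (d : NodeData) : List ℕ := d.2.2.1

/-- The start of the successors of a node for the number `0`. -/
abbrev NodeData.b₀ (d : NodeData) : List ℕ := d.2.2.2.1

/-- The start of the successors of a node for the number `1`. -/
abbrev NodeData.b₁ (d : NodeData) : List ℕ := d.2.2.2.2

/-- The data of a node without a splitting pair. -/
def plain (ph : ℕ) (v₀ v : List ℕ) : NodeData := (ph, v₀, v, v ++ [0], v ++ [1])

/-- The string from which the successors of a node for the number `x` start. -/
def start (d : NodeData) (x : ℕ) : List ℕ :=
  if x = 0 then d.b₀ else if x = 1 then d.b₁ else d.v ++ [x]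

/-- The string `β` extended so that the length is not `2` modulo `4`, where niceness leaves no
choice of the next number. -/
def evade (β : List ℕ) : List ℕ := β ++ if β.length % 4 = 2 then [0] else []

/-- An extension of `β` by the number `c` whose length is `n` modulo `4`. -/
def fresh (β : List ℕ) (c n : ℕ) : List ℕ :=
  evade β ++ [c] ++ List.replicate ((n + 3 * ((evade β).length + 1)) % 4) 0

/-- The data of the node `q` when it is initialised at stage `s`, where the list `D` has the data
of the nodes with smaller codes. -/
def initData (s : ℕ) (D : List NodeData) : List ℕ → NodeData
  | [] => plain 0 [] []
  | y :: q =>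
    if q = [] then plain 0 (ofNat (List ℕ) y) (ofNat (List ℕ) y)
    else
      let v := fresh (start (D.getD (encode q) default) y.unpair.1) (Nat.pair (encode (y :: q)) s)
        (nodeStr (y :: q)).length
      plain 0 v v

/-- Initialise at stage `s` all nodes with codes below `n` that have no entry in `D`. -/
def extendTo (s : ℕ) (D : List NodeData) (n : ℕ) : List NodeData :=
  Nat.rec D (fun k P => if k < P.length then P else P ++ [initData s P (ofNat (List ℕ) k)]) n

/-- The data of a node after it has been moved at stage `s` above `β`. -/
def moved (s n : ℕ) (d : NodeData) (β : List ℕ) : NodeData := plain 1 d.v₀ (fresh β s n)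

/-- The string computed by the `i`-th functional from `τ ⊕ χ`. -/
def phiOnStr (i : ℕ) (χ τ : List ℕ) : List ℕ := phiOn i (fun n => χ.getD n 0) τ

/-- A length that exceeds those of the starts of the successors of all nodes with codes
below `k`. -/
def lengthBound (D : List NodeData) (k : ℕ) : ℕ :=
  ((D.take k).map fun d => d.b₀.length + d.b₁.length).sum + 3

/-- Whether the string `τ` above the value of the node with code `k` serves the requirement of the
node: for length `3` modulo `4`, that it be in an r.e. set, and for length `0`, that a long string
of numbers smaller than the stage be computed from it. -/
def Serves (χ : List ℕ) (D : List NodeData) (k n : ℕ) (d : NodeData) (τ : List ℕ) : Prop :=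
  d.v <+: τ ∧
    ((n % 4 = 3 ∧ (phiVal (n / 4).unpair.1 χ (encode τ)).isSome) ∨
     (n % 4 = 0 ∧ lengthBound D k ≤ (phiOnStr (n / 4).unpair.1 χ τ).length ∧
        ∀ a ∈ phiOnStr (n / 4).unpair.1 χ τ, a < χ.length))

open Classical in
/-- What the requirements for generic and for incomparable paths want a node to be changed to. -/
noncomputable def wantServe (χ : List ℕ) (T : List (List ℕ)) (D : List NodeData) (k n : ℕ)
    (d : NodeData) : Option NodeData :=
  if d.phase = 0 then
    (T.find? fun τ => decide (Serves χ D k n d τ)).map fun τ => moved χ.length n d τ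
  else none

/-- All pairs of members of a list. -/
def pairs (T : List (List ℕ)) : List (List ℕ × List ℕ) :=
  T.flatMap fun a => T.map fun b => (a, b)

/-- The strings computed from the pair are incompatible. -/
def SplitStr (i : ℕ) (χ : List ℕ) (a : List ℕ × List ℕ) : Prop :=
  Incompat (phiOnStr i χ a.1) (phiOnStr i χ a.2)

open Classical in
/-- What the splitting requirement wants a node for a string of length `4 * i + 2` to be changed
to: if possible, get a splitting pair above the two successors of the initial value. If both
members of a splitting pair are above one successor, then move above the other one, and
there repeatedly to strings that compute more. -/
noncomputable def wantSplit (χ : List ℕ) (T : List (List ℕ)) (n : ℕ) (d : NodeData) :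
    Option NodeData :=
  if d.phase = 2 then none
  else
    (((pairs T).find? fun a => decide (SplitStr (n / 4) χ a ∧ d.v₀ ++ [0] <+: a.1 ∧
      d.v₀ ++ [1] <+: a.2)).map fun a => ((2, d.v₀, d.v₀, a.1, a.2) : NodeData)).or
    (if d.phase = 0 then
      ((pairs T).find? fun a => decide (SplitStr (n / 4) χ a ∧ d.v₀ <+: a.1 ∧
        d.v₀ <+: a.2)).map fun a => moved χ.length n d (d.v₀ ++ [1 - a.1.getD d.v₀.length 0])
    else
      (T.find? fun τ => decide (d.v <+: τ ∧ (phiOnStr (n / 4) χ d.v).length <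
        (phiOnStr (n / 4) χ τ).length)).map fun τ => moved χ.length n d τ)

/-- What the requirements want the node `q` to be changed to at the stage given by the length
of `χ`. -/
noncomputable def want (p : Params) (χ : List ℕ) (T : List (List ℕ)) (D : List NodeData)
    (q : List ℕ) : Option NodeData :=
  if (nodeStr q).length < p.1 + 1 then none
  else if (nodeStr q).length % 4 = 2 then
    wantSplit χ T (nodeStr q).length (D.getD (encode q) default)
  else wantServe χ T D (encode q) (nodeStr q).length (D.getD (encode q) default)

/-- The node with the least code that wants to be changed, with its new data. -/
noncomputable def action (p : Params) (χ : List ℕ) (T : List (List ℕ)) (D : List NodeData) :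
    Option (ℕ × NodeData) :=
  (List.range D.length).findSome? fun k => (want p χ T D (ofNat (List ℕ) k)).map fun d => (k, d)

/-- Whether the string `τ` is put into the tree at the stage given by the length of `χ`. -/
def Enters (p : Params) (χ : List ℕ) (T : List (List ℕ)) (D : List NodeData) (τ : List ℕ) : Prop :=
  p.1 < τ.length ∧ (τ.length = p.1 + 1 ∨ τ.dropLast ∈ T) ∧
    ((τ.length % 4 = 3 ∧ τ.getLastD 0 ≤ 1) ∨
     (τ.length % 4 ≠ 3 ∧ (τ.length = p.1 + 1 ∨ ∃ k < D.length, Alive p χ (ofNat (List ℕ) k) ∧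
        (τ.dropLast = (D.getD k default).v ∨ τ <+: (D.getD k default).v))))

/-- The data after the action, if there is one; all nodes with larger codes are dropped. -/
def afterAction (D : List NodeData) (o : Option (ℕ × NodeData)) : List NodeData :=
  o.elim D fun a => D.take a.1 ++ [a.2]

open Classical in
/-- One stage of the construction, which decides the string whose code is the stage, lets the
least node that wants to act do so, and initialises all nodes with larger codes. -/
noncomputable def step (p : Params) (χ : List ℕ) (st : List (List ℕ) × List NodeData) :
    List (List ℕ) × List NodeData :=
  (if Enters p χ st.1 st.2 (ofNat (List ℕ) χ.length) then st.1 ++ [ofNat (List ℕ) χ.length]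
    else st.1,
   extendTo χ.length (afterAction st.2 (action p χ st.1 st.2)) (χ.length + 1))

/-- The strings in the tree with codes below `s`, and the data of the nodes with codes
below `s`. -/
noncomputable def state (p : Params) (X : ℕ → ℕ) (s : ℕ) : List (List ℕ) × List NodeData :=
  Nat.rec ([], []) (fun u st => step p (initSeg X u) st) s

/-- The strings that are in the tree by stage `s`. -/
noncomputable def treeAt (p : Params) (X : ℕ → ℕ) (s : ℕ) : List (List ℕ) := (state p X s).1

/-- The data of the node `q` at stage `s`. -/
noncomputable def dat (p : Params) (X : ℕ → ℕ) (s : ℕ) (q : List ℕ) : NodeData :=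
  (state p X s).2.getD (encode q) default

/-- What the node `q` wants to be changed to at stage `s`. -/
noncomputable def wantAt (p : Params) (X : ℕ → ℕ) (s : ℕ) (q : List ℕ) : Option NodeData :=
  want p (initSeg X s) (state p X s).1 (state p X s).2 q

/-- No node with a code below `k` wants to act at stage `s`. -/
def QuietBelow (p : Params) (X : ℕ → ℕ) (s k : ℕ) : Prop :=
  ∀ q, encode q < k → encode q < s → wantAt p X s q = none

end Pulldown

namespace Pulldown

open Encodable Denumerable

/-! ### The stages of the construction -/

theorem evade_prefix (β : List ℕ) : β <+: evade β := List.prefix_append _ _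

theorem evade_concat_prefix_fresh (β : List ℕ) (c n : ℕ) : evade β ++ [c] <+: fresh β c n :=
  List.prefix_append _ _

theorem prefix_fresh (β : List ℕ) (c n : ℕ) : β <+: fresh β c n :=
  (evade_prefix β).trans ((List.prefix_append _ _).trans (evade_concat_prefix_fresh β c n))

theorem length_lt_length_fresh (β : List ℕ) (c n : ℕ) : β.length < (fresh β c n).length := by
  have h1 := (evade_prefix β).length_le
  have h2 := (evade_concat_prefix_fresh β c n).length_le
  simp at h2; omega

theorem length_evade_mod (β : List ℕ) : (evade β).length % 4 ≠ 2 := by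
  rw [evade]; split_ifs with h
  · simp; omega
  · simpa using h

theorem length_evade_le (β : List ℕ) : (evade β).length ≤ β.length + 1 := by
  rw [evade]; split_ifs <;> simp

theorem length_fresh_mod (β : List ℕ) (c n : ℕ) : (fresh β c n).length % 4 = n % 4 := by
  simp only [fresh, List.length_append, List.length_replicate, List.length_singleton]; omega

/-- An initial segment of `fresh β c n` either does not reach the new number `c`, or contains it. -/
theorem prefix_fresh_cases {ρ β : List ℕ} {c n : ℕ} (h : ρ <+: fresh β c n) :
    ρ <+: β ∨ (β.length % 4 = 2 ∧ ρ = β ++ [0]) ∨ c ∈ ρ := by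
  by_cases hl : ρ.length ≤ (evade β).length
  · have h1 : ρ <+: evade β := List.prefix_of_prefix_length_le h
      ((List.prefix_append _ _).trans (evade_concat_prefix_fresh β c n)) hl
    rw [evade] at h1
    split_ifs at h1 with h2
    · rcases prefix_concat_iff.1 h1 with h3 | h3
      · exact Or.inr (Or.inl ⟨h2, h3⟩)
      · exact Or.inl h3
    · left; simpa using h1
  · have h1 : evade β ++ [c] <+: ρ := List.prefix_of_prefix_length_le
      (evade_concat_prefix_fresh β c n) h (by simp; omega)
    exact Or.inr (Or.inr (h1.subset (by simp)))

theorem initData_of_ne {s : ℕ} {D : List NodeData} {y : ℕ} {q : List ℕ} (hq : q ≠ []) :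
    initData s D (y :: q) =
      plain 0 (fresh (start (D.getD (encode q) default) y.unpair.1) (Nat.pair (encode (y :: q)) s)
        (nodeStr (y :: q)).length) (fresh (start (D.getD (encode q) default) y.unpair.1)
        (Nat.pair (encode (y :: q)) s) (nodeStr (y :: q)).length) := by
  rw [initData, if_neg hq]

theorem initData_congr {s : ℕ} {D D' : List NodeData} {q : List ℕ}
    (h : ∀ k < encode q, D.getD k default = D'.getD k default) :
    initData s D q = initData s D' q := by
  cases q with
  | nil => rfl
  | cons y q =>
    by_cases hq : q = []
    · simp [initData, hq]
    · rw [initData_of_ne hq, initData_of_ne hq, h _ (encode_tail_lt y q)]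

theorem extendTo_succ (s : ℕ) (D : List NodeData) (n : ℕ) :
    extendTo s D (n + 1) = if n < (extendTo s D n).length then extendTo s D n
      else extendTo s D n ++ [initData s (extendTo s D n) (ofNat (List ℕ) n)] := rfl

theorem length_extendTo (s : ℕ) (D : List NodeData) (n : ℕ) :
    (extendTo s D n).length = max D.length n := by
  induction n with
  | zero => simp [extendTo]
  | succ n ih =>
    rw [extendTo_succ]
    split_ifs with h
    · omega
    · rw [List.length_append, List.length_singleton]; omega

theorem extendTo_prefix (s : ℕ) (D : List NodeData) {m n : ℕ} (h : m ≤ n) :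
    extendTo s D m <+: extendTo s D n := by
  induction n, h using Nat.le_induction with
  | base => exact List.prefix_refl _
  | succ n _ ih =>
    refine ih.trans ?_
    rw [extendTo_succ]; split_ifs
    · exact List.prefix_refl _
    · exact List.prefix_append _ _

theorem getD_of_prefix {α : Type} [Inhabited α] {D D' : List α} (h : D <+: D') {k : ℕ}
    (hk : k < D.length) : D.getD k default = D'.getD k default := by
  obtain ⟨t, rfl⟩ := h
  simp [List.getD_eq_getElem?_getD, List.getElem?_append_left hk]

theorem extendTo_getD_of_lt {s : ℕ} {D : List NodeData} {n k : ℕ} (hk : k < D.length) :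
    (extendTo s D n).getD k default = D.getD k default :=
  (getD_of_prefix (extendTo_prefix s D (Nat.zero_le n)) (by rw [length_extendTo]; omega)).symm

theorem extendTo_getD_of_le {s : ℕ} {D : List NodeData} {n k : ℕ} (hk : D.length ≤ k)
    (hn : k < n) :
    (extendTo s D n).getD k default = initData s (extendTo s D n) (ofNat (List ℕ) k) := by
  have hlen : (extendTo s D k).length = k := by rw [length_extendTo]; omega
  have h1 : extendTo s D (k + 1) =
      extendTo s D k ++ [initData s (extendTo s D k) (ofNat (List ℕ) k)] := by
    rw [extendTo_succ, if_neg (by omega)]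
  rw [← getD_of_prefix (extendTo_prefix s D (m := k + 1) hn) (by rw [length_extendTo]; omega), h1]
  rw [List.getD_eq_getElem?_getD, List.getElem?_append_right (by omega), hlen]
  simp only [Nat.sub_self, List.getElem?_singleton, if_true, Option.getD_some]
  refine initData_congr fun j hj => ?_
  rw [encode_ofNat] at hj
  exact getD_of_prefix (extendTo_prefix s D hn.le) (by omega)

section
variable {p : Params} {X : ℕ → ℕ}

theorem state_succ (s : ℕ) : state p X (s + 1) = step p (initSeg X s) (state p X s) := rfl

theorem action_eq_some {χ : List ℕ} {T : List (List ℕ)} {D : List NodeData} {m : ℕ} {d : NodeData}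
    (h : action p χ T D = some (m, d)) :
    m < D.length ∧ want p χ T D (ofNat (List ℕ) m) = some d ∧
      ∀ j < m, want p χ T D (ofNat (List ℕ) j) = none := by
  rw [action] at h
  generalize hF : (fun k => want p χ T D (ofNat (List ℕ) k)) = F at h
  have hF' : ∀ k, want p χ T D (ofNat (List ℕ) k) = F k := fun k => by rw [← hF]
  simp only [hF'] at h ⊢
  generalize D.length = N at h ⊢
  induction N with
  | zero => simp at h
  | succ N ih =>
    rw [List.range_succ, List.findSome?_append, Option.or_eq_some_iff] at h
    rcases h with h | ⟨h1, h2⟩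
    · obtain ⟨a, b⟩ := ih h; exact ⟨by omega, b⟩
    · simp only [List.findSome?_singleton, Option.map_eq_some_iff, Prod.mk.injEq] at h2
      obtain ⟨a, h3, rfl, rfl⟩ := h2
      refine ⟨by omega, h3, fun j hj => ?_⟩
      have := List.findSome?_eq_none_iff.1 h1 j (by simpa using hj)
      simpa using this

theorem action_eq_none {χ : List ℕ} {T : List (List ℕ)} {D : List NodeData}
    (h : action p χ T D = none) : ∀ j < D.length, want p χ T D (ofNat (List ℕ) j) = none := by
  intro j hj
  have := List.findSome?_eq_none_iff.1 h j (by simpa using hj)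
  simpa using this

theorem length_state (s : ℕ) : (state p X s).2.length = s := by
  induction s with
  | zero => rfl
  | succ s ih =>
    rw [state_succ, step, length_extendTo, length_initSeg]
    rcases h : action p (initSeg X s) (state p X s).1 (state p X s).2 with _ | ⟨m, d⟩
    · simp [afterAction, ih]
    · have := (action_eq_some h).1
      simp [afterAction]; omega

/-- At each stage, a node either keeps its data, or acts, or is initialised because its code is the
stage or because a node with smaller code acts. -/
theorem stage_cases {s : ℕ} {q : List ℕ} (hq : encode q ≤ s) :
    (encode q < s ∧ QuietBelow p X s (encode q + 1) ∧ dat p X (s + 1) q = dat p X s q) ∨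
    (encode q < s ∧ QuietBelow p X s (encode q) ∧ wantAt p X s q = some (dat p X (s + 1) q)) ∨
    ((encode q = s ∨ ¬ QuietBelow p X s (encode q)) ∧
      dat p X (s + 1) q = initData s (state p X (s + 1)).2 q) := by
  have hlen := length_state (p := p) (X := X) s
  have e2 : (state p X (s + 1)).2 = extendTo s (afterAction (state p X s).2
      (action p (initSeg X s) (state p X s).1 (state p X s).2)) (s + 1) := by
    rw [state_succ, step, length_initSeg]
  rcases h : action p (initSeg X s) (state p X s).1 (state p X s).2 with _ | ⟨m, d⟩
  · rw [h, afterAction, Option.elim_none] at e2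
    have hn := action_eq_none h
    rw [hlen] at hn
    rcases hq.lt_or_eq with hlt | heq
    · refine Or.inl ⟨hlt, fun q' _ h2 => ?_, ?_⟩
      · have := hn _ h2; rwa [ofNat_encode] at this
      · rw [dat, dat, e2, extendTo_getD_of_lt (by rw [hlen]; exact hlt)]
    · refine Or.inr (Or.inr ⟨Or.inl heq, ?_⟩)
      rw [dat, e2, extendTo_getD_of_le (by rw [hlen, heq]) (by omega), ofNat_encode]
  · rw [h, afterAction, Option.elim_some] at e2
    dsimp only at e2
    obtain ⟨h1, h2, h3⟩ := action_eq_some h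
    rw [hlen] at h1
    have hlen2 : ((state p X s).2.take m).length = m := by rw [List.length_take, hlen]; omega
    have hq3 : QuietBelow p X s m := fun q' h4 h5 => by
      have := h3 _ h4; rwa [ofNat_encode] at this
    rcases lt_trichotomy (encode q) m with hlt | heq | hgt
    · refine Or.inl ⟨by omega, fun q' h4 h5 => hq3 q' (by omega) h5, ?_⟩
      rw [dat, dat, e2, extendTo_getD_of_lt (by rw [List.length_append, hlen2]; omega),
        List.getD_eq_getElem?_getD, List.getElem?_append_left (by omega), List.getElem?_take_of_lt hlt,
        ← List.getD_eq_getElem?_getD]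
    · refine Or.inr (Or.inl ⟨by omega, heq ▸ hq3, ?_⟩)
      rw [dat, e2, extendTo_getD_of_lt (by
        rw [List.length_append, hlen2, List.length_singleton]; omega),
        List.getD_eq_getElem?_getD, List.getElem?_append_right (by omega), hlen2, heq]
      simp only [Nat.sub_self, List.getElem?_singleton, if_true, Option.getD_some]
      rw [← h2, wantAt, ← heq, ofNat_encode]
    · refine Or.inr (Or.inr ⟨Or.inr fun hquiet => ?_, ?_⟩)
      · have := hquiet (ofNat (List ℕ) m) (by rwa [encode_ofNat]) (by rwa [encode_ofNat])
        rw [wantAt, h2] at this; simp at this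
      · rw [dat, e2, extendTo_getD_of_le (by
          rw [List.length_append, hlen2, List.length_singleton]; omega) (by omega), ofNat_encode]

theorem dat_of_quiet {s : ℕ} {q : List ℕ} (hq : encode q < s)
    (h : QuietBelow p X s (encode q + 1)) : dat p X (s + 1) q = dat p X s q := by
  rcases stage_cases hq.le with ⟨_, _, h3⟩ | ⟨_, _, h3⟩ | ⟨h2, _⟩
  · exact h3
  · rw [h q (by omega) hq] at h3; simp at h3
  · rcases h2 with h2 | h2
    · omega
    · exact absurd (fun q' h4 h5 => h q' (by omega) h5) h2

theorem QuietBelow.mono {s k k' : ℕ} (h : QuietBelow p X s k) (hk : k' ≤ k) :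
    QuietBelow p X s k' := fun q h1 h2 => h q (by omega) h2

theorem init_dat {s y : ℕ} {q : List ℕ} (hq : q ≠ []) :
    initData s (state p X (s + 1)).2 (y :: q) =
      plain 0 (fresh (start (dat p X (s + 1) q) y.unpair.1) (Nat.pair (encode (y :: q)) s)
        (nodeStr (y :: q)).length) (fresh (start (dat p X (s + 1) q) y.unpair.1)
        (Nat.pair (encode (y :: q)) s) (nodeStr (y :: q)).length) := initData_of_ne hq

/-! ### Enumerating the tree -/

theorem mem_treeAt_succ {s : ℕ} {τ : List ℕ} :
    τ ∈ treeAt p X (s + 1) ↔ τ ∈ treeAt p X s ∨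
      (encode τ = s ∧ Enters p (initSeg X s) (state p X s).1 (state p X s).2 τ) := by
  rw [treeAt, state_succ, step, length_initSeg]
  by_cases h : Enters p (initSeg X s) (state p X s).1 (state p X s).2 (ofNat (List ℕ) s)
  · rw [if_pos h, List.mem_append, List.mem_singleton]
    refine or_congr Iff.rfl ⟨?_, ?_⟩
    · rintro rfl; exact ⟨encode_ofNat s, h⟩
    · rintro ⟨rfl, _⟩; exact (ofNat_encode τ).symm
  · rw [if_neg h]
    refine ⟨Or.inl, ?_⟩
    rintro (h1 | ⟨rfl, h1⟩)
    · exact h1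
    · rw [ofNat_encode] at h; exact absurd h1 h

theorem treeAt_mono {s t : ℕ} (h : s ≤ t) {τ : List ℕ} (hτ : τ ∈ treeAt p X s) :
    τ ∈ treeAt p X t := by
  induction t, h using Nat.le_induction with
  | base => exact hτ
  | succ t _ ih => exact mem_treeAt_succ.2 (Or.inl ih)

theorem mem_treeAt_iff {s : ℕ} {τ : List ℕ} : τ ∈ treeAt p X s ↔ encode τ < s ∧
    Enters p (initSeg X (encode τ)) (state p X (encode τ)).1 (state p X (encode τ)).2 τ := by
  induction s with
  | zero => simp [treeAt, state]
  | succ s ih =>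
    rw [mem_treeAt_succ, ih]
    constructor
    · rintro (⟨h1, h2⟩ | ⟨rfl, h2⟩)
      · exact ⟨by omega, h2⟩
      · exact ⟨by omega, h2⟩
    · rintro ⟨h1, h2⟩
      rcases Nat.lt_succ_iff_lt_or_eq.1 h1 with h3 | rfl
      · exact Or.inl ⟨h3, h2⟩
      · exact Or.inr ⟨rfl, h2⟩

theorem encode_lt_of_mem_treeAt {s : ℕ} {τ : List ℕ} (h : τ ∈ treeAt p X s) : encode τ < s :=
  (mem_treeAt_iff.1 h).1

theorem length_lt_of_mem_treeAt {s : ℕ} {τ : List ℕ} (h : τ ∈ treeAt p X s) : p.1 < τ.length :=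
  (mem_treeAt_iff.1 h).2.1

/-- Membership of a string in the tree is settled at the stage given by its code. -/
theorem mem_treeAt_of_lt {s t : ℕ} {τ : List ℕ} (h : τ ∈ treeAt p X t) (hs : encode τ < s) :
    τ ∈ treeAt p X s := mem_treeAt_iff.2 ⟨hs, (mem_treeAt_iff.1 h).2⟩

theorem dropLast_lt_encode {τ : List ℕ} (h : τ ≠ []) : encode τ.dropLast < encode τ :=
  encode_lt_of_prefix (List.dropLast_prefix τ) fun he => by
    have := congrArg List.length he
    have := List.length_pos_iff.2 h
    simp at *; omega

theorem treeAt_of_prefix {s : ℕ} {σ τ : List ℕ} (h : τ ∈ treeAt p X s) (hσ : σ <+: τ)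
    (hl : p.1 < σ.length) : σ ∈ treeAt p X s := by
  induction hn : τ.length generalizing τ with
  | zero =>
    have := hσ.length_le
    omega
  | succ n ih =>
    by_cases he : σ = τ
    · rwa [he]
    · obtain ⟨h1, -, h2, -⟩ := mem_treeAt_iff.1 h
      have hlt : σ.length < τ.length := lt_of_le_of_ne hσ.length_le fun h => he (hσ.eq_of_length h)
      have hσ' : σ <+: τ.dropLast := List.prefix_of_prefix_length_le hσ (List.dropLast_prefix τ)
        (by simp; omega)
      have h3 := h2.resolve_left (by omega)
      exact ih (mem_treeAt_of_lt h3 ((dropLast_lt_encode (by rintro rfl; simp at hn)).trans h1)) hσ'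
        (by simp [hn])

/-- The tree is nice, as far as its members have been enumerated. -/
theorem concat_mem_treeAt {s x : ℕ} {τ : List ℕ} (hm : τ.length % 4 = 2) (hx : x ≤ 1)
    (hτ : τ.length = p.1 ∨ τ ∈ treeAt p X s) (hs : encode (τ ++ [x]) < s) :
    τ ++ [x] ∈ treeAt p X s := by
  refine mem_treeAt_iff.2 ⟨hs, ?_, ?_, Or.inl ⟨by simp; omega, by simpa⟩⟩
  · rcases hτ with h | h
    · simp [h]
    · have := length_lt_of_mem_treeAt h; simp; omega
  · rcases hτ with h | h
    · left; simp [h]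
    · right; rw [List.dropLast_concat]
      exact mem_treeAt_of_lt h (encode_lt_of_prefix (List.prefix_append _ _) (by simp))

theorem le_one_of_mem_treeAt {s x : ℕ} {τ : List ℕ} (hm : τ.length % 4 = 2)
    (h : τ ++ [x] ∈ treeAt p X s) : x ≤ 1 := by
  rcases (mem_treeAt_iff.1 h).2.2.2 with ⟨_, h2⟩ | ⟨h1, _⟩
  · simpa using h2
  · exact absurd (by simp; omega) h1

end

end Pulldown

namespace Pulldown

open Encodable Denumerable

/-! ### What the nodes want -/

section
variable {p : Params} {X : ℕ → ℕ}

theorem phiOnStr_eq {i s : ℕ} {τ : List ℕ} (h : τ.length ≤ s) :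
    phiOnStr i (initSeg X s) τ = phiOn i X τ := by
  rw [phiOnStr, phiOn, phiOn]
  congr 1
  refine joinStr_congr fun n hn => ?_
  rw [List.getD_eq_getElem?_getD, getElem?_initSeg, if_pos (by omega)]; rfl

theorem length_le_of_mem_treeAt {s : ℕ} {τ : List ℕ} (h : τ ∈ treeAt p X s) : τ.length ≤ s :=
  (length_le_encode τ).trans (encode_lt_of_mem_treeAt h).le

theorem phiOnStr_of_mem {i s : ℕ} {τ : List ℕ} (h : τ ∈ treeAt p X s) :
    phiOnStr i (initSeg X s) τ = phiOn i X τ := phiOnStr_eq (length_le_of_mem_treeAt h)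

theorem mem_pairs {T : List (List ℕ)} {a : List ℕ × List ℕ} :
    a ∈ pairs T ↔ a.1 ∈ T ∧ a.2 ∈ T := by
  obtain ⟨b, c⟩ := a
  simp [pairs]

theorem splitStr_iff {i s : ℕ} {a : List ℕ × List ℕ} (h₁ : a.1 ∈ treeAt p X s)
    (h₂ : a.2 ∈ treeAt p X s) : SplitStr i (initSeg X s) a ↔ Splitting i X a.1 a.2 := by
  rw [SplitStr, phiOnStr_of_mem h₁, phiOnStr_of_mem h₂]; rfl

theorem le_lengthBound {s k : ℕ} (hk : k ≤ s) {q : List ℕ} (hq : encode q < k) :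
    (dat p X s q).b₀.length + 3 ≤ lengthBound (state p X s).2 k ∧
      (dat p X s q).b₁.length + 3 ≤ lengthBound (state p X s).2 k := by
  have hlen := length_state (p := p) (X := X) s
  have hmem : dat p X s q ∈ (state p X s).2.take k := by
    rw [dat, List.getD_eq_getElem?_getD, List.getElem?_eq_getElem (by omega), Option.getD_some,
      List.mem_take_iff_getElem]
    exact ⟨encode q, by omega, rfl⟩
  have := List.single_le_sum (l := ((state p X s).2.take k).map fun d =>
    d.b₀.length + d.b₁.length) (fun _ _ => Nat.zero_le _) _ (List.mem_map_of_mem hmem)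
  rw [lengthBound]
  omega

/-- At stage `s` there is a splitting pair above the two successors of the initial value of the
node `q`. -/
def Cross (p : Params) (X : ℕ → ℕ) (s : ℕ) (q : List ℕ) : Prop :=
  ∃ τ₀ ∈ treeAt p X s, ∃ τ₁ ∈ treeAt p X s, Splitting ((nodeStr q).length / 4) X τ₀ τ₁ ∧
    (dat p X s q).v₀ ++ [0] <+: τ₀ ∧ (dat p X s q).v₀ ++ [1] <+: τ₁

open Classical in
theorem find_cross {s i : ℕ} {d : NodeData} :
    (pairs (treeAt p X s)).find? (fun a => decide (SplitStr i (initSeg X s) a ∧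
        d.v₀ ++ [0] <+: a.1 ∧ d.v₀ ++ [1] <+: a.2)) = none ↔
      ¬ ∃ τ₀ ∈ treeAt p X s, ∃ τ₁ ∈ treeAt p X s, Splitting i X τ₀ τ₁ ∧
        d.v₀ ++ [0] <+: τ₀ ∧ d.v₀ ++ [1] <+: τ₁ := by
  rw [List.find?_eq_none]
  constructor
  · rintro h ⟨τ₀, h0, τ₁, h1, h2⟩
    refine h (τ₀, τ₁) (mem_pairs.2 ⟨h0, h1⟩) ?_
    rw [decide_eq_true_eq]
    exact ⟨(splitStr_iff (a := (τ₀, τ₁)) h0 h1).2 h2.1, h2.2⟩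
  · intro h a ha hQa
    obtain ⟨h1, h2⟩ := mem_pairs.1 ha
    rw [decide_eq_true_eq] at hQa
    exact h ⟨a.1, h1, a.2, h2, (splitStr_iff h1 h2).1 hQa.1, hQa.2⟩

theorem wantAt_eq (s : ℕ) (q : List ℕ) : wantAt p X s q =
    if (nodeStr q).length < p.1 + 1 then none
    else if (nodeStr q).length % 4 = 2 then
      wantSplit (initSeg X s) (treeAt p X s) (nodeStr q).length (dat p X s q)
    else wantServe (initSeg X s) (treeAt p X s) (state p X s).2 (encode q) (nodeStr q).length
      (dat p X s q) := rfl

/-- A node for which the requirements of the first kind want something is moved above a string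
that serves them. -/
theorem want_serve {s : ℕ} {q : List ℕ} {d : NodeData} (h : wantAt p X s q = some d)
    (hn : (nodeStr q).length % 4 ≠ 2) :
    p.1 < (nodeStr q).length ∧ (dat p X s q).phase = 0 ∧ ∃ τ ∈ treeAt p X s,
      Serves (initSeg X s) (state p X s).2 (encode q) (nodeStr q).length (dat p X s q) τ ∧
      d = moved s (nodeStr q).length (dat p X s q) τ := by
  rw [wantAt_eq] at h
  split_ifs at h with h1
  rw [wantServe] at h
  split_ifs at h with h2
  rw [Option.map_eq_some_iff] at h
  obtain ⟨τ, h3, rfl⟩ := h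
  refine ⟨by omega, h2, τ, List.mem_of_find?_eq_some h3, by simpa using List.find?_some h3, ?_⟩
  rw [length_initSeg]

theorem want_serve_none {s : ℕ} {q : List ℕ} (h : wantAt p X s q = none)
    (hl : p.1 < (nodeStr q).length) (hn : (nodeStr q).length % 4 ≠ 2)
    (h0 : (dat p X s q).phase = 0) : ∀ τ ∈ treeAt p X s,
      ¬ Serves (initSeg X s) (state p X s).2 (encode q) (nodeStr q).length (dat p X s q) τ := by
  rw [wantAt_eq, if_neg (by omega), if_neg hn, wantServe, if_pos h0, Option.map_eq_none_iff,
    List.find?_eq_none] at h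
  exact fun τ hτ => by simpa using h τ hτ

/-- The ways in which a node for a splitting requirement may want to be changed. -/
theorem want_split {s : ℕ} {q : List ℕ} {d : NodeData} (h : wantAt p X s q = some d)
    (hn : (nodeStr q).length % 4 = 2) :
    p.1 < (nodeStr q).length ∧ (dat p X s q).phase ≠ 2 ∧
    ((∃ τ₀ ∈ treeAt p X s, ∃ τ₁ ∈ treeAt p X s, Splitting ((nodeStr q).length / 4) X τ₀ τ₁ ∧
        (dat p X s q).v₀ ++ [0] <+: τ₀ ∧ (dat p X s q).v₀ ++ [1] <+: τ₁ ∧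
        d = (2, (dat p X s q).v₀, (dat p X s q).v₀, τ₀, τ₁)) ∨
      (¬ Cross p X s q ∧ (dat p X s q).phase = 0 ∧ ∃ τ₀ ∈ treeAt p X s, ∃ τ₁ ∈ treeAt p X s,
        Splitting ((nodeStr q).length / 4) X τ₀ τ₁ ∧ (dat p X s q).v₀ <+: τ₀ ∧
        (dat p X s q).v₀ <+: τ₁ ∧ d = moved s (nodeStr q).length (dat p X s q)
          ((dat p X s q).v₀ ++ [1 - τ₀.getD (dat p X s q).v₀.length 0])) ∨
      (¬ Cross p X s q ∧ (dat p X s q).phase ≠ 0 ∧ ∃ τ ∈ treeAt p X s, (dat p X s q).v <+: τ ∧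
        (phiOn ((nodeStr q).length / 4) X (dat p X s q).v).length <
          (phiOn ((nodeStr q).length / 4) X τ).length ∧
        d = moved s (nodeStr q).length (dat p X s q) τ)) := by
  rw [wantAt_eq] at h
  split_ifs at h with h1
  rw [wantSplit] at h
  split_ifs at h with h2 h3
  all_goals
    refine ⟨by omega, h2, ?_⟩
    rw [Option.or_eq_some_iff, Option.map_eq_some_iff, Option.map_eq_none_iff,
      Option.map_eq_some_iff] at h
    rcases h with ⟨a, ha, rfl⟩ | ⟨h4, a, ha, rfl⟩
    · left
      have hm := mem_pairs.1 (List.mem_of_find?_eq_some ha)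
      have hQ := List.find?_some ha
      simp only [decide_eq_true_eq] at hQ
      exact ⟨a.1, hm.1, a.2, hm.2, (splitStr_iff hm.1 hm.2).1 hQ.1, hQ.2.1, hQ.2.2, rfl⟩
    right
    rw [find_cross] at h4
  · left
    have hm := mem_pairs.1 (List.mem_of_find?_eq_some ha)
    have hQ := List.find?_some ha
    simp only [decide_eq_true_eq] at hQ
    exact ⟨h4, h3, a.1, hm.1, a.2, hm.2, (splitStr_iff hm.1 hm.2).1 hQ.1, hQ.2.1, hQ.2.2,
      by rw [length_initSeg]⟩
  · right
    have hm := List.mem_of_find?_eq_some ha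
    have hQ := List.find?_some ha
    simp only [decide_eq_true_eq] at hQ
    refine ⟨h4, h3, a, hm, hQ.1, ?_, by rw [length_initSeg]⟩
    rw [← phiOnStr_of_mem (p := p) hm, ← phiOnStr_eq (X := X) (s := s)]
    · exact hQ.2
    · exact hQ.1.length_le.trans (length_le_of_mem_treeAt (p := p) hm)

theorem want_split_none {s : ℕ} {q : List ℕ} (h : wantAt p X s q = none)
    (hl : p.1 < (nodeStr q).length) (hn : (nodeStr q).length % 4 = 2)
    (h2 : (dat p X s q).phase ≠ 2) : ¬ Cross p X s q ∧
      ((dat p X s q).phase = 0 → ∀ τ₀ ∈ treeAt p X s, ∀ τ₁ ∈ treeAt p X s,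
        (dat p X s q).v₀ <+: τ₀ → (dat p X s q).v₀ <+: τ₁ →
        ¬ Splitting ((nodeStr q).length / 4) X τ₀ τ₁) ∧
      ((dat p X s q).phase ≠ 0 → ∀ τ ∈ treeAt p X s, (dat p X s q).v <+: τ →
        (phiOn ((nodeStr q).length / 4) X τ).length ≤
          (phiOn ((nodeStr q).length / 4) X (dat p X s q).v).length) := by
  rw [wantAt_eq, if_neg (by omega), if_pos hn, wantSplit] at h
  rw [if_neg h2, Option.or_eq_none_iff, Option.map_eq_none_iff,
    find_cross] at h
  obtain ⟨h3, h4⟩ := h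
  refine ⟨h3, fun h0 τ₀ m0 τ₁ m1 e0 e1 hs => ?_, fun h0 τ hm he => ?_⟩
  · rw [if_pos h0, Option.map_eq_none_iff, List.find?_eq_none] at h4
    have := h4 (τ₀, τ₁) (mem_pairs.2 ⟨m0, m1⟩)
    simp only [decide_eq_true_eq] at this
    exact this ⟨(splitStr_iff (a := (τ₀, τ₁)) m0 m1).2 hs, e0, e1⟩
  · rw [if_neg h0, Option.map_eq_none_iff, List.find?_eq_none] at h4
    have := h4 τ hm
    rw [decide_eq_true_eq] at this
    by_contra hc
    refine this ⟨he, ?_⟩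
    rw [phiOnStr_of_mem (p := p) hm]
    rw [phiOnStr_eq (he.length_le.trans (length_le_of_mem_treeAt (p := p) hm))]
    omega

theorem length_nodeStr_cons {y : ℕ} {q : List ℕ} (hq : q ≠ []) :
    (nodeStr (y :: q)).length = (nodeStr q).length + 1 := by simp [nodeStr, hq]

/-! ### Invariants of the nodes -/

/-- The invariant of the data of the node `q` at stage `s`. The field `init` says that the initial
value follows the start given by the predecessor, with a new number that bounds all earlier stages
at which a node with smaller code wanted to act. The fields `phase2`, `meets`, `long` and `split`
record what the node has achieved by acting: a splitting pair above its two successors; a string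
in the r.e. set; a computation that is longer than the starts of the nodes with smaller codes and
has values below the stage `u` at which the node acted; and a splitting pair on one side of the
initial value, while the node is now on the other side. -/
structure NodeInv (p : Params) (X : ℕ → ℕ) (s : ℕ) (q : List ℕ) : Prop where
  base : ∀ y, q = [y] → (dat p X s q).v₀ = ofNat (List ℕ) y
  init : ∀ y q', q = y :: q' → q' ≠ [] → ∃ c,
    (dat p X s q).v₀ = fresh (start (dat p X s q') y.unpair.1) (Nat.pair (encode q) c)
      (nodeStr q).length ∧ ∀ u < s, ¬ QuietBelow p X u (encode q) → u ≤ c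
  le : (dat p X s q).v₀ <+: (dat p X s q).v
  size : (nodeStr q).length ≤ (dat p X s q).v₀.length
  mod₀ : (dat p X s q).v₀.length % 4 = (nodeStr q).length % 4
  mod : (dat p X s q).v.length % 4 = (nodeStr q).length % 4
  b₀ : (dat p X s q).v ++ [0] <+: (dat p X s q).b₀
  b₁ : (dat p X s q).v ++ [1] <+: (dat p X s q).b₁
  phase_le : (dat p X s q).phase ≤ 2
  phase0 : (dat p X s q).phase = 0 → dat p X s q = plain 0 (dat p X s q).v₀ (dat p X s q).v₀
  phase1 : (dat p X s q).phase = 1 → dat p X s q = plain 1 (dat p X s q).v₀ (dat p X s q).v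
  phase2 : (dat p X s q).phase = 2 → (nodeStr q).length % 4 = 2 ∧
    (dat p X s q).v = (dat p X s q).v₀ ∧ (dat p X s q).b₀ ∈ treeAt p X s ∧
    (dat p X s q).b₁ ∈ treeAt p X s ∧
    Splitting ((nodeStr q).length / 4) X (dat p X s q).b₀ (dat p X s q).b₁
  active : (dat p X s q).phase ≠ 0 → p.1 < (nodeStr q).length
  meets : (dat p X s q).phase ≠ 0 → (nodeStr q).length % 4 = 3 → ∃ τ, τ <+: (dat p X s q).v ∧
    (Phi ((nodeStr q).length / 4).unpair.1 X (encode τ)).Dom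
  long : (dat p X s q).phase ≠ 0 → (nodeStr q).length % 4 = 0 → ∃ u < s,
    ¬ QuietBelow p X u (encode q + 1) ∧ ∃ τ, τ <+: (dat p X s q).v ∧
    (∀ q', encode q' < encode q →
      (dat p X s q').b₀.length + 3 ≤ (phiOn ((nodeStr q).length / 4).unpair.1 X τ).length ∧
      (dat p X s q').b₁.length + 3 ≤ (phiOn ((nodeStr q).length / 4).unpair.1 X τ).length) ∧
    ∀ a ∈ phiOn ((nodeStr q).length / 4).unpair.1 X τ, a < u
  split : (dat p X s q).phase = 1 → (nodeStr q).length % 4 = 2 → ∃ y ≤ 1,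
    ∃ τ₀ ∈ treeAt p X s, ∃ τ₁ ∈ treeAt p X s, Splitting ((nodeStr q).length / 4) X τ₀ τ₁ ∧
    (dat p X s q).v₀ ++ [y] <+: τ₀ ∧ (dat p X s q).v₀ ++ [y] <+: τ₁ ∧
    (dat p X s q).v₀ ++ [1 - y] <+: (dat p X s q).v

theorem concat_prefix_start {d : NodeData} (h₀ : d.v ++ [0] <+: d.b₀) (h₁ : d.v ++ [1] <+: d.b₁)
    (x : ℕ) : d.v ++ [x] <+: start d x := by
  rw [start]; split_ifs with h h' <;> subst_vars
  · exact h₀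
  · exact h₁
  · exact List.prefix_refl _

theorem NodeInv.prefix_start {s : ℕ} {q : List ℕ} (h : NodeInv p X s q) (x : ℕ) :
    (dat p X s q).v ++ [x] <+: start (dat p X s q) x := concat_prefix_start h.b₀ h.b₁ x

theorem start_plain (ph : ℕ) (v₀ v : List ℕ) (x : ℕ) : start (plain ph v₀ v) x = v ++ [x] := by
  rw [start]; split_ifs with h h' <;> subst_vars <;> rfl

/-- If a string of the tree properly extends a string of length `2` modulo `4`, then
it continues with `0` or `1`. -/
theorem exists_concat_prefix {s : ℕ} {τ ρ : List ℕ} (hτ : τ ∈ treeAt p X s) (hρ : ρ <+: τ)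
    (hne : ρ ≠ τ) (hm : ρ.length % 4 = 2) (hl : p.1 ≤ ρ.length) :
    ∃ y ≤ 1, ρ ++ [y] <+: τ ∧ τ.getD ρ.length 0 = y := by
  obtain ⟨t, rfl⟩ := hρ
  cases t with
  | nil => simp at hne
  | cons y t =>
    have h1 : ρ ++ [y] <+: ρ ++ y :: t := ⟨t, by simp⟩
    refine ⟨y, le_one_of_mem_treeAt hm (treeAt_of_prefix hτ h1 (by simp; omega)), h1, ?_⟩
    simp [List.getD_eq_getElem?_getD]

theorem Splitting.ne_left {i : ℕ} {ρ τ₀ τ₁ : List ℕ} (h : Splitting i X τ₀ τ₁) (h₁ : ρ <+: τ₁) :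
    ρ ≠ τ₀ := by
  rintro rfl
  exact h.1 (phiOn_mono (i := i) (X := X) h₁)

theorem Splitting.symm {i : ℕ} {τ₀ τ₁ : List ℕ} (h : Splitting i X τ₀ τ₁) :
    Splitting i X τ₁ τ₀ := ⟨h.2, h.1⟩

theorem nodeInv_keep {s : ℕ} {q : List ℕ} (h : NodeInv p X s q) (hq : encode q < s)
    (hquiet : QuietBelow p X s (encode q + 1)) : NodeInv p X (s + 1) q := by
  have e : dat p X (s + 1) q = dat p X s q := dat_of_quiet hq hquiet
  have e' : ∀ q', encode q' < encode q → dat p X (s + 1) q' = dat p X s q' := fun q' hq' =>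
    dat_of_quiet (by omega) (hquiet.mono (by omega))
  refine ⟨?_, ?_, ?_, ?_, ?_, ?_, ?_, ?_, ?_, ?_, ?_, ?_, ?_, ?_, ?_, ?_⟩ <;> rw [e]
  · exact h.base
  · intro y q' hy hne
    obtain ⟨c, hc, hc'⟩ := h.init y q' hy hne
    rw [e' q' (by rw [hy]; exact encode_tail_lt y q')]
    refine ⟨c, hc, fun u hu hu' => ?_⟩
    rcases Nat.lt_succ_iff_lt_or_eq.1 hu with h1 | rfl
    · exact hc' u h1 hu'
    · exact absurd (hquiet.mono (by omega)) hu'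
  · exact h.le
  · exact h.size
  · exact h.mod₀
  · exact h.mod
  · exact h.b₀
  · exact h.b₁
  · exact h.phase_le
  · exact h.phase0
  · exact h.phase1
  · intro h1
    obtain ⟨a, b, c, d, f⟩ := h.phase2 h1
    exact ⟨a, b, treeAt_mono (by omega) c, treeAt_mono (by omega) d, f⟩
  · exact h.active
  · exact h.meets
  · intro h1 h2
    obtain ⟨u, hu, a, τ, b, c, d⟩ := h.long h1 h2
    refine ⟨u, by omega, a, τ, b, fun q' hq' => ?_, d⟩
    rw [e' q' hq']; exact c q' hq'
  · intro h1 h2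
    obtain ⟨y, hy, τ₀, a, τ₁, b, c⟩ := h.split h1 h2
    exact ⟨y, hy, τ₀, treeAt_mono (by omega) a, τ₁, treeAt_mono (by omega) b, c⟩

theorem nodeInv_init {s : ℕ} {q : List ℕ}
    (hq : dat p X (s + 1) q = initData s (state p X (s + 1)).2 q)
    (htail : ∀ y q', q = y :: q' → q' ≠ [] → NodeInv p X (s + 1) q') :
    NodeInv p X (s + 1) q := by
  obtain ⟨v, hv, h1, h2, h3, h4⟩ : ∃ v, dat p X (s + 1) q = plain 0 v v ∧
      (∀ y, q = [y] → v = ofNat (List ℕ) y) ∧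
      (∀ y q', q = y :: q' → q' ≠ [] → ∃ c, v = fresh (start (dat p X (s + 1) q') y.unpair.1)
        (Nat.pair (encode q) c) (nodeStr q).length ∧
        ∀ u < s + 1, ¬ QuietBelow p X u (encode q) → u ≤ c) ∧
      (nodeStr q).length ≤ v.length ∧ v.length % 4 = (nodeStr q).length % 4 := by
    cases q with
    | nil => exact ⟨[], hq, by simp, by simp, by simp [nodeStr], by simp [nodeStr]⟩
    | cons y q' =>
      by_cases hne : q' = []
      · subst hne
        refine ⟨ofNat (List ℕ) y, by rw [hq, initData, if_pos rfl], ?_, ?_, by simp [nodeStr],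
          by simp [nodeStr]⟩
        · intro y' hy; rw [List.cons.injEq] at hy; rw [hy.1]
        · intro y' q' hy hne; rw [List.cons.injEq] at hy; exact absurd hy.2.symm hne
      · have hi := htail y q' rfl hne
        rw [init_dat hne] at hq
        refine ⟨_, hq, ?_, ?_, ?_, length_fresh_mod _ _ _⟩
        · intro y' hy; simp [hne] at hy
        · intro y' q'' hy _
          rw [List.cons.injEq] at hy
          obtain ⟨rfl, rfl⟩ := hy
          exact ⟨s, rfl, fun u hu _ => by omega⟩
        · have a := (hi.prefix_start y.unpair.1).length_le
          have b := length_lt_length_fresh (start (dat p X (s + 1) q') y.unpair.1)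
            (Nat.pair (encode (y :: q')) s) (nodeStr (y :: q')).length
          have c := hi.size
          have d := hi.le.length_le
          rw [length_nodeStr_cons hne] at b ⊢
          rw [List.length_append, List.length_singleton] at a
          omega
  refine ⟨?_, ?_, ?_, ?_, ?_, ?_, ?_, ?_, ?_, ?_, ?_, ?_, ?_, ?_, ?_, ?_⟩ <;> rw [hv]
  · exact h1
  · exact h2
  · exact List.prefix_refl _
  · exact h3
  · exact h4
  · exact h4
  · exact List.prefix_refl _
  · exact List.prefix_refl _
  · exact Nat.zero_le _
  · exact fun _ => rfl
  · intro h; exact absurd h (by simp [plain])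
  · intro h; exact absurd h (by simp [plain])
  · intro h; exact absurd rfl h
  · intro h; exact absurd rfl h
  · intro h; exact absurd rfl h
  · intro h; exact absurd h (by simp [plain])

theorem nodeInv_act {s : ℕ} {q : List ℕ} (h : NodeInv p X s q) (hq : encode q < s)
    (hquiet : QuietBelow p X s (encode q)) (hw : wantAt p X s q = some (dat p X (s + 1) q)) :
    NodeInv p X (s + 1) q := by
  have e' : ∀ q', encode q' < encode q → dat p X (s + 1) q' = dat p X s q' := fun q' hq' =>
    dat_of_quiet (by omega) (hquiet.mono (by omega))
  have hnq : ¬ QuietBelow p X s (encode q + 1) := fun h => by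
    rw [h q (by omega) hq] at hw; simp at hw
  -- What does not depend on how the node acts, given that the initial value is kept.
  have hinit : (dat p X (s + 1) q).v₀ = (dat p X s q).v₀ → ∀ y q', q = y :: q' → q' ≠ [] → ∃ c,
      (dat p X (s + 1) q).v₀ = fresh (start (dat p X (s + 1) q') y.unpair.1)
        (Nat.pair (encode q) c) (nodeStr q).length ∧
        ∀ u < s + 1, ¬ QuietBelow p X u (encode q) → u ≤ c := by
    intro e y q' hy hne
    obtain ⟨c, hc, hc'⟩ := h.init y q' hy hne
    rw [e' q' (by rw [hy]; exact encode_tail_lt y q'), e]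
    refine ⟨c, hc, fun u hu hu' => ?_⟩
    rcases Nat.lt_succ_iff_lt_or_eq.1 hu with h1 | rfl
    · exact hc' u h1 hu'
    · exact absurd hquiet hu'
  -- The case in which the node is moved above some string.
  have hmoved : ∀ β, dat p X (s + 1) q = moved s (nodeStr q).length (dat p X s q) β →
      (dat p X s q).v₀ <+: β → p.1 < (nodeStr q).length →
      ((nodeStr q).length % 4 = 3 → (Phi ((nodeStr q).length / 4).unpair.1 X (encode β)).Dom) →
      ((nodeStr q).length % 4 = 0 →
        (∀ q', encode q' < encode q → (dat p X s q').b₀.length + 3 ≤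
            (phiOn ((nodeStr q).length / 4).unpair.1 X β).length ∧
          (dat p X s q').b₁.length + 3 ≤
            (phiOn ((nodeStr q).length / 4).unpair.1 X β).length) ∧
        ∀ a ∈ phiOn ((nodeStr q).length / 4).unpair.1 X β, a < s) →
      ((nodeStr q).length % 4 = 2 → ∃ y ≤ 1, ∃ τ₀ ∈ treeAt p X (s + 1),
        ∃ τ₁ ∈ treeAt p X (s + 1), Splitting ((nodeStr q).length / 4) X τ₀ τ₁ ∧
        (dat p X s q).v₀ ++ [y] <+: τ₀ ∧ (dat p X s q).v₀ ++ [y] <+: τ₁ ∧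
        (dat p X s q).v₀ ++ [1 - y] <+: β) → NodeInv p X (s + 1) q := by
    intro β e hβ hl h3 h0 h2
    have hinit := hinit (by rw [e]; rfl)
    have hle := hβ.trans (prefix_fresh β s (nodeStr q).length)
    refine ⟨?_, hinit, ?_, ?_, ?_, ?_, ?_, ?_, ?_, ?_, ?_, ?_, ?_, ?_, ?_, ?_⟩ <;> rw [e]
    · exact h.base
    · exact hle
    · exact h.size
    · exact h.mod₀
    · exact length_fresh_mod _ _ _
    · exact List.prefix_refl _
    · exact List.prefix_refl _
    · exact (by norm_num : 1 ≤ 2)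
    · exact fun h => absurd (show 1 = 0 from h) (by norm_num)
    · exact fun _ => rfl
    · exact fun h => absurd (show 1 = 2 from h) (by norm_num)
    · exact fun _ => hl
    · exact fun _ hm => ⟨β, prefix_fresh _ _ _, h3 hm⟩
    · intro _ hm
      refine ⟨s, by omega, hnq, β, prefix_fresh _ _ _, fun q' hq' => ?_, (h0 hm).2⟩
      rw [e' q' hq']; exact (h0 hm).1 q' hq'
    · intro _ hm
      obtain ⟨y, hy, τ₀, a, τ₁, b, c, d, f, g⟩ := h2 hm
      exact ⟨y, hy, τ₀, a, τ₁, b, c, d, f, g.trans (prefix_fresh _ _ _)⟩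
  by_cases hm : (nodeStr q).length % 4 = 2
  · obtain ⟨hl, hp, ⟨τ₀, m0, τ₁, m1, hs, p0, p1, e⟩ | ⟨hc, h0, τ₀, m0, τ₁, m1, hs, p0, p1, e⟩ |
      ⟨hc, h0, τ, mτ, pτ, hlt, e⟩⟩ := want_split hw hm
    · have hinit := hinit (by rw [e])
      refine ⟨?_, hinit, ?_, ?_, ?_, ?_, ?_, ?_, ?_, ?_, ?_, ?_, ?_, ?_, ?_, ?_⟩ <;> rw [e]
      · exact h.base
      · exact h.size
      · exact h.mod₀
      · exact h.mod₀
      · exact p0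
      · exact p1
      · exact fun h => absurd (show 2 = 0 from h) (by norm_num)
      · exact fun h => absurd (show 2 = 1 from h) (by norm_num)
      · exact fun _ => ⟨hm, rfl, treeAt_mono (by omega) m0, treeAt_mono (by omega) m1, hs⟩
      · exact fun _ => hl
      · intro _ h; omega
      · intro _ h; omega
      · exact fun h => absurd (show 2 = 1 from h) (by norm_num)
    · have hmod := h.mod₀
      have hsz := h.size
      obtain ⟨y, hy, hp0, hy'⟩ := exists_concat_prefix m0 p0 (hs.ne_left p1) (by omega) (by omega)
      obtain ⟨z, hz, hp1, -⟩ := exists_concat_prefix m1 p1 (hs.symm.ne_left p0) (by omega)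
        (by omega)
      rw [hy'] at e
      refine hmoved _ e (List.prefix_append _ _) hl (by omega) (by omega) fun _ => ?_
      have hyz : y = z := by
        by_contra hne
        apply hc
        rcases Nat.le_one_iff_eq_zero_or_eq_one.1 hy with rfl | rfl <;>
          rcases Nat.le_one_iff_eq_zero_or_eq_one.1 hz with rfl | rfl
        · exact absurd rfl hne
        · exact ⟨τ₀, m0, τ₁, m1, hs, hp0, hp1⟩
        · exact ⟨τ₁, m1, τ₀, m0, hs.symm, hp1, hp0⟩
        · exact absurd rfl hne
      subst hyz
      exact ⟨y, hy, τ₀, treeAt_mono (by omega) m0, τ₁, treeAt_mono (by omega) m1, hs, hp0, hp1,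
        List.prefix_refl _⟩
    · refine hmoved _ e (h.le.trans pτ) hl (by omega) (by omega) fun _ => ?_
      obtain ⟨y, hy, τ₀, a, τ₁, b, c, d, f, g⟩ := h.split (by have := h.phase_le; omega) hm
      exact ⟨y, hy, τ₀, treeAt_mono (by omega) a, τ₁, treeAt_mono (by omega) b, c, d, f,
        g.trans pτ⟩
  · obtain ⟨hl, h0, τ, mτ, ⟨hp, hs⟩, e⟩ := want_serve hw hm
    refine hmoved τ e (h.le.trans hp) hl (fun hm3 => ?_) (fun hm0 => ?_) (fun hm2 => absurd hm2 hm)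
    · obtain ⟨_, h1⟩ := hs.resolve_right (by omega)
      exact Phi_dom_iff.2 ⟨s, h1⟩
    · obtain ⟨_, h1, h2⟩ := hs.resolve_left (by omega)
      rw [phiOnStr_of_mem mτ] at h1 h2
      rw [length_initSeg] at h2
      exact ⟨fun q' hq' => ⟨(le_lengthBound hq.le hq').1.trans h1,
        (le_lengthBound hq.le hq').2.trans h1⟩, h2⟩

/-- The invariant is preserved whether the node keeps its data, acts, or is initialised. -/
theorem nodeInv {s : ℕ} {q : List ℕ} (hq : encode q < s) : NodeInv p X s q := by
  induction s generalizing q with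
  | zero => omega
  | succ s ih =>
    induction q with
    | nil =>
      rcases stage_cases (p := p) (X := X) (Nat.lt_succ_iff.1 hq) with
        ⟨h1, h2, h3⟩ | ⟨h1, h2, h3⟩ | ⟨_, h3⟩
      · exact nodeInv_keep (ih h1) h1 h2
      · exact nodeInv_act (ih h1) h1 h2 h3
      · exact nodeInv_init h3 (by simp)
    | cons y q ihq =>
      rcases stage_cases (p := p) (X := X) (Nat.lt_succ_iff.1 hq) with
        ⟨h1, h2, h3⟩ | ⟨h1, h2, h3⟩ | ⟨_, h3⟩
      · exact nodeInv_keep (ih h1) h1 h2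
      · exact nodeInv_act (ih h1) h1 h2 h3
      · refine nodeInv_init h3 fun y' q' hy _ => ?_
        rw [List.cons.injEq] at hy
        obtain ⟨rfl, rfl⟩ := hy
        exact ihq ((encode_tail_lt y q).trans hq)

end
end Pulldown

namespace Pulldown

open Encodable Denumerable Filter

section
variable {p : Params} {X : ℕ → ℕ}

/-! ### Every node acts only finitely often -/

/-- A bounded sequence that increases whenever something happens has only finitely many of these
events. -/
theorem finitely_many_of_bounded {f : ℕ → ℕ} {P : ℕ → Prop} {s₁ N : ℕ}
    (hmono : ∀ s ≥ s₁, f s ≤ f (s + 1)) (hP : ∀ s ≥ s₁, P s → f s < f (s + 1) ∧ f s < N) :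
    ∃ s₀ ≥ s₁, ∀ s ≥ s₀, ¬ P s := by
  induction hk : N - f s₁ using Nat.strong_induction_on generalizing s₁ with
  | _ k ih =>
    by_cases h : ∃ s ≥ s₁, P s
    · obtain ⟨s, hs, hPs⟩ := h
      have h1 : ∀ t, s₁ ≤ t → f s₁ ≤ f t := fun t ht => by
        induction t, ht using Nat.le_induction with
        | base => exact le_rfl
        | succ t ht ih => exact ih.trans (hmono t ht)
      have h2 := h1 s hs
      have h3 := hP s hs hPs
      obtain ⟨s₀, hs₀, h4⟩ := ih (N - f (s + 1)) (by omega) (s₁ := s + 1)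
        (fun t ht => hmono t (by omega)) (fun t ht => hP t (by omega)) rfl
      exact ⟨s₀, by omega, h4⟩
    · push Not at h
      exact ⟨s₁, le_rfl, h⟩

/-- A string that is at least as long as two incompatible strings is incompatible with one of
them. -/
theorem incompat_of_length_le {a b c : List ℕ} (h : Incompat a b) (ha : a.length ≤ c.length)
    (hb : b.length ≤ c.length) : Incompat a c ∨ Incompat b c := by
  by_contra hc
  have comp : ∀ d : List ℕ, d.length ≤ c.length → ¬ Incompat d c → d <+: c := by
    intro d hd h1
    by_contra h2
    exact h1 ⟨h2, fun h3 => h2 ((h3.eq_of_length (le_antisymm h3.length_le hd)) ▸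
      List.prefix_refl _)⟩
  have h1 := comp a ha fun h => hc (Or.inl h)
  have h2 := comp b hb fun h => hc (Or.inr h)
  rcases List.prefix_or_prefix_of_prefix h1 h2 with h3 | h3
  · exact h.1 h3
  · exact h.2 h3

theorem quiet_or_act {s : ℕ} {q : List ℕ} (hq : encode q < s) (h : QuietBelow p X s (encode q)) :
    (wantAt p X s q = none ∧ dat p X (s + 1) q = dat p X s q) ∨
      wantAt p X s q = some (dat p X (s + 1) q) := by
  rcases stage_cases (p := p) (X := X) hq.le with ⟨_, h2, h3⟩ | ⟨_, _, h3⟩ | ⟨h2, _⟩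
  · exact Or.inl ⟨h2 q (by omega) hq, h3⟩
  · exact Or.inr h3
  · rcases h2 with h2 | h2
    · omega
    · exact absurd h h2

/-- A node acts finitely often once the nodes with smaller codes are quiet. Only a node for a
splitting requirement can act more than once. It has then moved away from a splitting pair
`τ₀`, `τ₁` that is on the other side of its initial value. As soon as it finds a string that
computes as much as these two, this string splits with one of them, and they form a splitting
pair above the two successors of the initial value, which ends the activity of the node. -/
theorem eventually_want_none {s₁ : ℕ} {q : List ℕ} (hq : encode q < s₁)
    (h : ∀ s ≥ s₁, QuietBelow p X s (encode q)) :
    ∃ s₀ ≥ s₁, ∀ s ≥ s₀, wantAt p X s q = none := by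
  have hstep : ∀ s ≥ s₁, (wantAt p X s q = none ∧ dat p X (s + 1) q = dat p X s q) ∨
      wantAt p X s q = some (dat p X (s + 1) q) := fun s hs => quiet_or_act (by omega) (h s hs)
  by_contra hc
  push Not at hc
  by_cases hm : (nodeStr q).length % 4 = 2
  · have hph2 : ∀ s ≥ s₁, (dat p X s q).phase ≠ 2 := by
      intro s hs h2
      have key : ∀ t, s ≤ t → (dat p X t q).phase = 2 ∧ wantAt p X t q = none := by
        intro t ht
        induction t, ht using Nat.le_induction with
        | base =>
          refine ⟨h2, ?_⟩
          rcases hw : wantAt p X s q with _ | d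
          · rfl
          · exact absurd h2 (want_split hw hm).2.1
        | succ t ht ih =>
          have h3 : (dat p X (t + 1) q).phase = 2 := by
            rcases hstep t (by omega) with ⟨_, h4⟩ | h4
            · rw [h4]; exact ih.1
            · rw [ih.2] at h4; simp at h4
          refine ⟨h3, ?_⟩
          rcases hw : wantAt p X (t + 1) q with _ | d
          · rfl
          · exact absurd h3 (want_split hw hm).2.1
      obtain ⟨t, ht, h3⟩ := hc s hs
      exact h3 (key t ht).2
    have hph1 : ∀ s ≥ s₁, wantAt p X s q ≠ none → (dat p X (s + 1) q).phase = 1 := by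
      intro s hs hw
      rcases hstep s hs with ⟨h1, _⟩ | h1
      · exact absurd h1 hw
      · obtain ⟨_, _, ⟨_, _, _, _, _, _, _, e⟩ | ⟨_, _, _, _, _, _, _, _, _, e⟩ |
          ⟨_, _, _, _, _, _, e⟩⟩ := want_split h1 hm
        · exact absurd (by rw [e]) (hph2 (s + 1) (by omega))
        · rw [e]; rfl
        · rw [e]; rfl
    obtain ⟨s₂, hs₂, hw₂⟩ := hc s₁ le_rfl
    have hone : ∀ s, s₂ + 1 ≤ s → (dat p X s q).phase = 1 := by
      intro s hs
      induction s, hs using Nat.le_induction with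
      | base => exact hph1 s₂ hs₂ hw₂
      | succ s hs ih =>
        by_cases hw : wantAt p X s q = none
        · rcases hstep s (by omega) with ⟨_, h1⟩ | h1
          · rw [h1]; exact ih
          · rw [hw] at h1; simp at h1
        · exact hph1 s (by omega) hw
    have hI := nodeInv (p := p) (X := X) (s := s₂ + 1) (q := q) (by omega)
    obtain ⟨y, hy, τ₀, m0, τ₁, m1, hs, p0, p1, pv⟩ := hI.split (hone _ le_rfl) hm
    -- What happens from now on: the node is moved to strings that compute more.
    have hact : ∀ s ≥ s₂ + 1, wantAt p X s q ≠ none → ¬ Cross p X s q ∧ ∃ τ ∈ treeAt p X s,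
        (dat p X s q).v <+: τ ∧ (phiOn ((nodeStr q).length / 4) X (dat p X s q).v).length <
          (phiOn ((nodeStr q).length / 4) X τ).length ∧
        dat p X (s + 1) q = moved s (nodeStr q).length (dat p X s q) τ := by
      intro s hs hw
      rcases hstep s (by omega) with ⟨h1, _⟩ | h1
      · exact absurd h1 hw
      · obtain ⟨_, _, ⟨_, _, _, _, _, _, _, e⟩ | ⟨_, h0, _⟩ | ⟨h2, _, h3⟩⟩ := want_split h1 hm
        · exact absurd (by rw [e]) (hph2 (s + 1) (by omega))
        · rw [hone s hs] at h0; simp at h0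
        · exact ⟨h2, h3⟩
    have hkeep : ∀ s ≥ s₂ + 1, wantAt p X s q = none → dat p X (s + 1) q = dat p X s q := by
      intro s hs hw
      rcases hstep s (by omega) with ⟨_, h1⟩ | h1
      · exact h1
      · rw [hw] at h1; simp at h1
    have hv : ∀ s ≥ s₂ + 1, (dat p X s q).v <+: (dat p X (s + 1) q).v ∧
        (dat p X (s + 1) q).v₀ = (dat p X s q).v₀ := by
      intro s hs
      by_cases hw : wantAt p X s q = none
      · rw [hkeep s hs hw]; exact ⟨List.prefix_refl _, rfl⟩
      · obtain ⟨_, τ, _, h1, _, e⟩ := hact s hs hw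
        rw [e]; exact ⟨h1.trans (prefix_fresh _ _ _), rfl⟩
    have hv0 : ∀ s, s₂ + 1 ≤ s → (dat p X (s₂ + 1) q).v <+: (dat p X s q).v ∧
        (dat p X s q).v₀ = (dat p X (s₂ + 1) q).v₀ := by
      intro s hs
      induction s, hs using Nat.le_induction with
      | base => exact ⟨List.prefix_refl _, rfl⟩
      | succ s hs ih => exact ⟨ih.1.trans (hv s hs).1, (hv s hs).2.trans ih.2⟩
    obtain ⟨s₀, h1, h2⟩ := finitely_many_of_bounded
      (f := fun s => (phiOn ((nodeStr q).length / 4) X (dat p X s q).v).length)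
      (P := fun s => wantAt p X s q ≠ none) (s₁ := s₂ + 1)
      (N := (phiOn ((nodeStr q).length / 4) X τ₀).length +
        (phiOn ((nodeStr q).length / 4) X τ₁).length)
      (fun s hs => (phiOn_mono (hv s hs).1).length_le) (fun s hs' hw => by
        obtain ⟨hcr, τ, mτ, h1, h2, e⟩ := hact s hs' hw
        constructor
        · refine h2.trans_le (phiOn_mono ?_).length_le
          rw [e]; exact prefix_fresh _ _ _
        · by_contra hN
          apply hcr
          have pτ := pv.trans ((hv0 s hs').1.trans h1)
          rw [← (hv0 s hs').2] at p0 p1 pτ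
          have m0' := treeAt_mono hs' m0
          have m1' := treeAt_mono hs' m1
          rcases incompat_of_length_le (c := phiOn ((nodeStr q).length / 4) X τ) hs
            (by change (phiOn _ X τ₀).length ≤ _; omega)
            (by change (phiOn _ X τ₁).length ≤ _; omega) with h3 | h3
          · have h3' : Splitting ((nodeStr q).length / 4) X τ₀ τ := h3
            rcases Nat.le_one_iff_eq_zero_or_eq_one.1 hy with rfl | rfl
            · exact ⟨τ₀, m0', τ, mτ, h3', p0, pτ⟩
            · exact ⟨τ, mτ, τ₀, m0', h3'.symm, pτ, p0⟩
          · have h3' : Splitting ((nodeStr q).length / 4) X τ₁ τ := h3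
            rcases Nat.le_one_iff_eq_zero_or_eq_one.1 hy with rfl | rfl
            · exact ⟨τ₁, m1', τ, mτ, h3', p1, pτ⟩
            · exact ⟨τ, mτ, τ₁, m1', h3'.symm, pτ, p1⟩)
    obtain ⟨t, ht, h3⟩ := hc s₀ (by omega)
    exact h2 t ht h3
  · obtain ⟨s, hs, hw⟩ := hc s₁ le_rfl
    have hne : ∀ t, s + 1 ≤ t → (dat p X t q).phase ≠ 0 := by
      intro t ht
      induction t, ht using Nat.le_induction with
      | base =>
        rcases hstep s hs with ⟨h1, _⟩ | h1
        · exact absurd h1 hw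
        · obtain ⟨_, _, τ, _, _, e⟩ := want_serve h1 hm
          rw [e]; exact Nat.one_ne_zero
      | succ t ht ih =>
        rcases hstep t (by omega) with ⟨_, h1⟩ | h1
        · rw [h1]; exact ih
        · exact absurd (want_serve h1 hm).2.1 ih
    obtain ⟨t, ht, hw'⟩ := hc (s + 1) (by omega)
    obtain ⟨d, hd⟩ := Option.ne_none_iff_exists'.1 hw'
    exact hne t ht (want_serve hd hm).2.1

/-- The finite injury argument: by induction on the code, each node is settled eventually. -/
theorem eventually_quiet (k : ℕ) : ∀ᶠ s in atTop, QuietBelow p X s k := by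
  induction k with
  | zero => exact Eventually.of_forall fun s q hq => absurd hq (Nat.not_lt_zero _)
  | succ k ih =>
    obtain ⟨s₁, hs₁⟩ := eventually_atTop.1 ih
    obtain ⟨s₀, h0, h1⟩ := eventually_want_none (p := p) (X := X) (s₁ := max s₁ (k + 1))
      (q := ofNat (List ℕ) k) (by rw [encode_ofNat]; omega)
      (fun s hs => by rw [encode_ofNat]; exact hs₁ s (by omega))
    refine eventually_atTop.2 ⟨s₀, fun s hs q hq hqs => ?_⟩
    rcases Nat.lt_succ_iff_lt_or_eq.1 hq with h2 | h2
    · exact hs₁ s (by omega) q h2 hqs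
    · have := h1 s hs; rwa [← h2, ofNat_encode] at this

theorem exists_limit (p : Params) (X : ℕ → ℕ) (q : List ℕ) :
    ∃ d, ∀ᶠ s in atTop, dat p X s q = d := by
  obtain ⟨s₀, hs₀⟩ := eventually_atTop.1
    ((eventually_quiet (p := p) (X := X) (encode q + 1)).and (eventually_gt_atTop (encode q)))
  refine ⟨dat p X s₀ q, eventually_atTop.2 ⟨s₀, fun s hs => ?_⟩⟩
  induction s, hs using Nat.le_induction with
  | base => rfl
  | succ s hs ih => rw [dat_of_quiet (hs₀ s hs).2 (hs₀ s hs).1, ih]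

/-- The data of a node in the limit of the construction. -/
noncomputable def limDat (p : Params) (X : ℕ → ℕ) (q : List ℕ) : NodeData :=
  Classical.choose (exists_limit p X q)

theorem eventually_dat (p : Params) (X : ℕ → ℕ) (q : List ℕ) :
    ∀ᶠ s in atTop, dat p X s q = limDat p X q := Classical.choose_spec (exists_limit p X q)

/-- All nodes with codes up to that of `q` are settled from stage `s` on. -/
theorem eventually_settled (p : Params) (X : ℕ → ℕ) (q : List ℕ) :
    ∀ᶠ s in atTop, encode q < s ∧ QuietBelow p X s (encode q + 1) ∧ NodeInv p X s q ∧
      ∀ q', encode q' ≤ encode q → dat p X s q' = limDat p X q' := by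
  have h1 : ∀ k, ∀ᶠ s in atTop, ∀ q', encode q' ≤ k → dat p X s q' = limDat p X q' := by
    intro k
    have : ∀ᶠ s in atTop, ∀ j ∈ Finset.range (k + 1),
        dat p X s (ofNat (List ℕ) j) = limDat p X (ofNat (List ℕ) j) :=
      (eventually_all_finset _).2 fun j _ => eventually_dat p X _
    filter_upwards [this] with s hs q' hq'
    have := hs (encode q') (by simp; omega)
    rwa [ofNat_encode] at this
  filter_upwards [eventually_gt_atTop (encode q), eventually_quiet (encode q + 1),
    h1 (encode q)] with s h2 h3 h4
  exact ⟨h2, h3, nodeInv h2, h4⟩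

end
end Pulldown

namespace Pulldown

open Encodable Denumerable Filter

section
variable {p : Params} {X : ℕ → ℕ}

/-! ### Certificates -/

/-- The condition for membership of `σ` in the tree `T'`, for a string longer than `l` whose proper
initial segments satisfy it. -/
def Good (p : Params) (X : ℕ → ℕ) (σ : List ℕ) : Prop :=
  1 ∈ Phi p.2.2 X (encode (σ.take p.1)) ∧ (σ.length % 4 = 3 → σ.getLastD 0 ≤ 1) ∧
    ∀ τ ∈ required σ, 1 ∈ Phi p.2.1 (jump X) (encode τ)

theorem certVal_ne_zero {χ σ : List ℕ} (h : certVal p χ σ ≠ 0) :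
    (phiVal p.2.2 χ (encode (σ.take p.1)) = some 1 ∧ (σ.length % 4 = 3 → σ.getLastD 0 ≤ 1) ∧
      ∀ τ ∈ required σ, accept p.2.1 χ (encode τ) ≠ 0) ∧
    certVal p χ σ = encode ((required σ).map fun τ => accept p.2.1 χ (encode τ)) + 1 := by
  rw [certVal] at h ⊢
  split_ifs at h ⊢ with h1
  · exact ⟨h1, rfl⟩
  · exact absurd rfl h

/-- The condition holds iff its approximations settle on one positive value, which codes all
accepting computations that it needs. -/
theorem good_iff {σ : List ℕ} :
    Good p X σ ↔ ∃ v ≠ 0, ∃ c, ∀ s ≥ c, certVal p (initSeg X s) σ = v := by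
  constructor
  · rintro ⟨h1, h2, h3⟩
    have h4 : ∀ τ, ∃ v, τ ∈ required σ → v ≠ 0 ∧
        ∀ᶠ s in atTop, accept p.2.1 (initSeg X s) (encode τ) = v := by
      intro τ
      by_cases hτ : τ ∈ required σ
      · obtain ⟨v, hv, c, hc⟩ := (one_mem_Phi_jump_iff _ _ _).1 (h3 τ hτ)
        exact ⟨v, fun _ => ⟨hv, eventually_atTop.2 ⟨c, hc⟩⟩⟩
      · exact ⟨0, fun h => absurd h hτ⟩
    choose V hV using h4
    have h5 : ∀ᶠ s in atTop, ∀ τ ∈ (required σ).toFinset,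
        accept p.2.1 (initSeg X s) (encode τ) = V τ :=
      (eventually_all_finset _).2 fun τ hτ => (hV τ (List.mem_toFinset.1 hτ)).2
    obtain ⟨c₁, hc₁⟩ := (mem_Phi_iff _ _ _ _).1 h1
    obtain ⟨c, hc⟩ := eventually_atTop.1 (h5.and (eventually_ge_atTop c₁))
    refine ⟨encode ((required σ).map V) + 1, by simp, c, fun s hs => ?_⟩
    obtain ⟨h6, h7⟩ := hc s hs
    rw [certVal, if_pos]
    · congr 2
      exact List.map_congr_left fun τ hτ => h6 τ (List.mem_toFinset.2 hτ)
    · refine ⟨phiVal_mono (initSeg_prefix X h7) hc₁, h2, fun τ hτ => ?_⟩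
      rw [h6 τ (List.mem_toFinset.2 hτ)]; exact (hV τ hτ).1
  · rintro ⟨v, hv, c, hc⟩
    obtain ⟨⟨h1, h2, h3⟩, h4⟩ := certVal_ne_zero (p := p) (χ := initSeg X c) (σ := σ)
      (by rw [hc c le_rfl]; exact hv)
    refine ⟨mem_Phi_of_phiVal h1, h2, fun τ hτ => ?_⟩
    refine (one_mem_Phi_jump_iff _ _ _).2 ⟨_, h3 τ hτ, c, fun s hs => ?_⟩
    obtain ⟨-, h5⟩ := certVal_ne_zero (p := p) (χ := initSeg X s) (σ := σ)
      (by rw [hc s hs]; exact hv)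
    rw [hc s hs, ← hc c le_rfl, h4, Nat.add_right_cancel_iff] at h5
    exact (List.map_inj_left.1 (encode_injective h5) τ hτ).symm

theorem certOk_iff {s c : ℕ} {σ : List ℕ} : CertOk p (initSeg X s) σ c ↔
    c ≤ s ∧ p.1 < σ.length ∧ certVal p (initSeg X c) σ ≠ 0 ∧
      (∀ u ≤ s, c ≤ u → certVal p (initSeg X u) σ = certVal p (initSeg X c) σ) ∧
      ∀ d, d + 1 = c → certVal p (initSeg X d) σ ≠ certVal p (initSeg X c) σ := by
  rw [CertOk, length_initSeg, Nat.lt_succ_iff]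
  refine and_congr_right fun hcs => and_congr_right fun _ => ?_
  rw [take_initSeg X hcs]
  refine and_congr_right fun _ => and_congr ?_ ?_
  · refine forall_congr' fun u => ?_
    rw [Nat.lt_succ_iff]
    refine forall_congr' fun hu => ?_
    rw [take_initSeg X hu]
  · constructor
    · intro h d hd
      have := h d (by omega) hd
      rwa [take_initSeg X (by omega)] at this
    · intro h d _ hd
      rw [take_initSeg X (by omega)]; exact h d hd

theorem CertOk.anti {s s' c : ℕ} {σ : List ℕ} (h : CertOk p (initSeg X s') σ c) (hs : s ≤ s')
    (hc : c ≤ s) : CertOk p (initSeg X s) σ c := by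
  rw [certOk_iff] at h ⊢
  exact ⟨hc, h.2.1, h.2.2.1, fun u hu => h.2.2.2.1 u (by omega), h.2.2.2.2⟩

theorem eventually_certOk_iff {σ : List ℕ} :
    (∃ c, ∀ᶠ s in atTop, CertOk p (initSeg X s) σ c) ↔ p.1 < σ.length ∧ Good p X σ := by
  constructor
  · rintro ⟨c, hc⟩
    obtain ⟨s₀, hs₀⟩ := eventually_atTop.1 hc
    have h0 := certOk_iff.1 (hs₀ s₀ le_rfl)
    refine ⟨h0.2.1, good_iff.2 ⟨_, h0.2.2.1, c, fun s hs => ?_⟩⟩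
    exact (certOk_iff.1 (hs₀ (max s s₀) (by omega))).2.2.2.1 s (by omega) hs
  · rintro ⟨hl, hg⟩
    obtain ⟨v, hv, c₀, hc₀⟩ := good_iff.1 hg
    classical
    have hex : ∃ c, ∀ s ≥ c, certVal p (initSeg X s) σ = v := ⟨c₀, hc₀⟩
    have hspec := Nat.find_spec hex
    refine ⟨Nat.find hex, eventually_atTop.2 ⟨Nat.find hex, fun s hs => certOk_iff.2
      ⟨hs, hl, ?_, fun u _ hcu => ?_, fun d hd he => ?_⟩⟩⟩
    · rw [hspec _ le_rfl]; exact hv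
    · rw [hspec u hcu, hspec _ le_rfl]
    · refine Nat.find_min hex (m := d) (by omega) fun s hs => ?_
      rcases hs.eq_or_lt with rfl | h
      · rw [he, hspec _ le_rfl]
      · exact hspec s (by omega)

theorem certOk_unique {s c c' : ℕ} {σ : List ℕ} (h : CertOk p (initSeg X s) σ c)
    (h' : CertOk p (initSeg X s) σ c') : c = c' := by
  have key : ∀ {c c'}, CertOk p (initSeg X s) σ c → CertOk p (initSeg X s) σ c' → ¬ c < c' := by
    intro c c' h h' hlt
    rw [certOk_iff] at h h'
    have h1 := h.2.2.2.1 (c' - 1) (by omega) (by omega)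
    have h2 := h.2.2.2.1 c' (by omega) (by omega)
    exact h'.2.2.2.2 (c' - 1) (by omega) (by rw [h1, h2])
  exact le_antisymm (not_lt.1 (key h' h)) (not_lt.1 (key h h'))

theorem alive_cons {χ : List ℕ} {y : ℕ} {q : List ℕ} (hq : q ≠ []) :
    Alive p χ (y :: q) ↔ Alive p χ q ∧ CertOk p χ (nodeStr (y :: q)) y.unpair.2 := by
  rw [Alive, if_neg hq]

theorem alive_singleton {χ : List ℕ} {y : ℕ} :
    Alive p χ [y] ↔ (ofNat (List ℕ) y).length ≤ p.1 := by
  rw [Alive, if_pos rfl]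

theorem nodeStr_cons {y : ℕ} {q : List ℕ} (hq : q ≠ []) :
    nodeStr (y :: q) = nodeStr q ++ [y.unpair.1] := by rw [nodeStr, if_neg hq]

theorem nodeStr_singleton (y : ℕ) : nodeStr [y] = ofNat (List ℕ) y := by rw [nodeStr, if_pos rfl]

theorem Alive.anti {s s' : ℕ} {q : List ℕ} (h : Alive p (initSeg X s') q) (hs : s ≤ s')
    (hq : encode q ≤ s) : Alive p (initSeg X s) q := by
  induction q with
  | nil => exact h
  | cons y q ih =>
    by_cases hne : q = []
    · subst hne; rw [alive_singleton] at h ⊢; exact h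
    · rw [alive_cons hne] at h ⊢
      refine ⟨ih h.1 ((encode_tail_lt y q).le.trans hq), h.2.anti hs ?_⟩
      have h1 := lt_encode_of_mem (List.mem_cons_self (a := y) (l := q))
      have h2 := Nat.unpair_right_le y
      omega

theorem Alive.ne_nil {χ q : List ℕ} (h : Alive p χ q) : q ≠ [] := by
  rintro rfl; exact h

/-- All certificates of the node are right. -/
def IsTrue (p : Params) (X : ℕ → ℕ) (q : List ℕ) : Prop :=
  ∀ᶠ s in atTop, Alive p (initSeg X s) q

theorem IsTrue.alive {q : List ℕ} (h : IsTrue p X q) {s : ℕ} (hs : encode q ≤ s) :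
    Alive p (initSeg X s) q := by
  obtain ⟨s₀, hs₀⟩ := eventually_atTop.1 h
  exact (hs₀ (max s s₀) (by omega)).anti (by omega) hs

theorem isTrue_of_frequently {q : List ℕ} (h : ∀ N, ∃ s ≥ N, Alive p (initSeg X s) q) :
    IsTrue p X q := by
  refine eventually_atTop.2 ⟨encode q, fun s hs => ?_⟩
  obtain ⟨s', h1, h2⟩ := h s
  exact h2.anti h1 hs

theorem IsTrue.ne_nil {q : List ℕ} (h : IsTrue p X q) : q ≠ [] :=
  (h.alive le_rfl).ne_nil

theorem isTrue_singleton {y : ℕ} : IsTrue p X [y] ↔ (ofNat (List ℕ) y).length ≤ p.1 := by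
  rw [IsTrue]
  simp only [alive_singleton, eventually_const]

theorem isTrue_cons {y : ℕ} {q : List ℕ} (hq : q ≠ []) : IsTrue p X (y :: q) ↔
    IsTrue p X q ∧ ∀ᶠ s in atTop, CertOk p (initSeg X s) (nodeStr (y :: q)) y.unpair.2 := by
  rw [IsTrue, IsTrue, ← eventually_and]
  simp only [alive_cons hq]

/-- There is at most one node with right certificates for a string, since a right certificate is
determined as the least modulus. -/
theorem IsTrue.unique {q q' : List ℕ} (h : IsTrue p X q) (h' : IsTrue p X q')
    (he : nodeStr q = nodeStr q') : q = q' := by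
  induction q generalizing q' with
  | nil => exact absurd rfl h.ne_nil
  | cons y q ih =>
    cases q' with
    | nil => exact absurd rfl h'.ne_nil
    | cons y' q' =>
      by_cases hq : q = [] <;> by_cases hq' : q' = []
      · subst hq hq'
        rw [nodeStr_singleton, nodeStr_singleton] at he
        rw [(Denumerable.eqv (List ℕ)).symm.injective he]
      · subst hq
        obtain ⟨-, h2⟩ := (isTrue_cons hq').1 h'
        have h3 := (eventually_certOk_iff.1 ⟨_, h2⟩).1
        rw [← he, nodeStr_singleton] at h3
        have := isTrue_singleton.1 h
        omega
      · subst hq'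
        obtain ⟨-, h2⟩ := (isTrue_cons hq).1 h
        have h3 := (eventually_certOk_iff.1 ⟨_, h2⟩).1
        rw [he, nodeStr_singleton] at h3
        have := isTrue_singleton.1 h'
        omega
      · obtain ⟨h1, h2⟩ := (isTrue_cons hq).1 h
        obtain ⟨h1', h2'⟩ := (isTrue_cons hq').1 h'
        obtain ⟨s, h3, h4⟩ := (h2.and h2').exists
        rw [← he] at h4
        have hc := certOk_unique h3 h4
        rw [nodeStr_cons hq, nodeStr_cons hq'] at he
        obtain ⟨h5, h6⟩ := List.append_inj' he rfl
        rw [ih h1 h1' h5]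
        have h7 : y.unpair.1 = y'.unpair.1 := by simpa using h6
        rw [← Nat.pair_unpair y, ← Nat.pair_unpair y', hc, h7]

theorem exists_isTrue {σ : List ℕ} (h : ∀ n, p.1 < n → n ≤ σ.length → Good p X (σ.take n)) :
    ∃ q, IsTrue p X q ∧ nodeStr q = σ := by
  induction σ using List.reverseRecOn with
  | nil => exact ⟨[encode ([] : List ℕ)], isTrue_singleton.2 (by simp), by
      rw [nodeStr_singleton, ofNat_encode]⟩
  | append_singleton σ x ih =>
    by_cases hl : (σ ++ [x]).length ≤ p.1
    · exact ⟨[encode (σ ++ [x])], isTrue_singleton.2 (by rwa [ofNat_encode]), by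
        rw [nodeStr_singleton, ofNat_encode]⟩
    · obtain ⟨q, h1, h2⟩ := ih fun n hn hn' => by
        have := h n hn (by simp; omega)
        rwa [List.take_append_of_le_length hn'] at this
      have h3 := h (σ ++ [x]).length (by omega) le_rfl
      rw [List.take_length] at h3
      obtain ⟨c, hc⟩ := eventually_certOk_iff.2 ⟨not_le.1 hl, h3⟩
      have he : nodeStr (Nat.pair x c :: q) = σ ++ [x] := by
        rw [nodeStr_cons h1.ne_nil, h2, Nat.unpair_pair]
      refine ⟨Nat.pair x c :: q, (isTrue_cons h1.ne_nil).2 ⟨h1, ?_⟩, he⟩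
      rw [he, Nat.unpair_pair]; exact hc

theorem IsTrue.good {q : List ℕ} (h : IsTrue p X q) {n : ℕ} (hn : p.1 < n)
    (hn' : n ≤ (nodeStr q).length) : Good p X ((nodeStr q).take n) := by
  induction q with
  | nil => exact absurd rfl h.ne_nil
  | cons y q ih =>
    by_cases hq : q = []
    · subst hq
      have := isTrue_singleton.1 h
      rw [nodeStr_singleton] at hn'; omega
    · obtain ⟨h1, h2⟩ := (isTrue_cons hq).1 h
      rw [length_nodeStr_cons hq] at hn'
      rcases Nat.lt_succ_iff_lt_or_eq.1 (Nat.lt_succ_of_le hn') with h3 | h3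
      · rw [nodeStr_cons hq, List.take_append_of_le_length (by omega)]
        exact ih h1 (by omega)
      · rw [h3, ← length_nodeStr_cons (y := y) hq, List.take_length]
        exact (eventually_certOk_iff.1 ⟨_, h2⟩).2

/-! ### The values of living nodes are in the tree -/

/-- All initial segments of `β` that have been decided by stage `s` are in the tree, and
the string `β` obeys niceness. -/
def Supported (p : Params) (X : ℕ → ℕ) (s : ℕ) (β : List ℕ) : Prop :=
  (∀ ρ, ρ <+: β → p.1 < ρ.length → encode ρ < s → ρ ∈ treeAt p X s) ∧
    ∀ ρ z, ρ ++ [z] <+: β → ρ.length % 4 = 2 → p.1 ≤ ρ.length → z ≤ 1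

theorem supported_of_mem {s : ℕ} {β : List ℕ} (h : β ∈ treeAt p X s) : Supported p X s β :=
  ⟨fun _ hρ hl _ => treeAt_of_prefix h hρ hl, fun ρ z hρ hm hl =>
    le_one_of_mem_treeAt hm (treeAt_of_prefix h hρ (by simp; omega))⟩

theorem Supported.mem_of_le {s : ℕ} {β ρ : List ℕ} (h : Supported p X s β) (hρ : ρ <+: β)
    (hl : p.1 ≤ ρ.length) (hs : encode ρ < s) : ρ.length = p.1 ∨ ρ ∈ treeAt p X s := by
  rcases hl.eq_or_lt with h1 | h1
  · exact Or.inl h1.symm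
  · exact Or.inr (h.1 ρ hρ h1 hs)

theorem Supported.concat {s x : ℕ} {β : List ℕ} (h : Supported p X s β)
    (hx : β.length % 4 = 2 → x ≤ 1)
    (hmem : β.length % 4 ≠ 2 → p.1 ≤ β.length → encode (β ++ [x]) < s → β ++ [x] ∈ treeAt p X s) :
    Supported p X s (β ++ [x]) := by
  constructor
  · intro ρ hρ hl hs
    rcases prefix_concat_iff.1 hρ with rfl | h1
    · rw [List.length_append, List.length_singleton] at hl
      by_cases hm : β.length % 4 = 2
      · exact concat_mem_treeAt hm (hx hm) (h.mem_of_le (List.prefix_refl _) (by omega)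
          ((encode_le_of_prefix (List.prefix_append _ _)).trans_lt hs)) hs
      · exact hmem hm (by omega) hs
    · exact h.1 ρ h1 hl hs
  · intro ρ z hρ hm hl
    rcases prefix_concat_iff.1 hρ with h1 | h1
    · obtain ⟨rfl, h2⟩ := List.append_inj' h1 rfl
      have : z = x := by simpa using h2
      rw [this]; exact hx hm
    · exact h.2 ρ z h1 hm hl

theorem concat_prefix_fresh {β ρ : List ℕ} {c n z : ℕ} (h : ρ ++ [z] <+: fresh β c n) :
    ρ ++ [z] <+: β ∨ ρ.length % 4 ≠ 2 ∨ z = 0 := by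
  have hz : (fresh β c n)[ρ.length]? = some z := by
    obtain ⟨t, ht⟩ := h
    rw [← ht]; simp
  by_cases h1 : ρ.length < β.length
  · exact Or.inl (List.prefix_of_prefix_length_le h (prefix_fresh β c n) (by simp; omega))
  · right
    by_contra hc
    push Not at hc
    rw [fresh, List.append_assoc] at hz
    have hev := length_evade_mod β
    rcases lt_trichotomy ρ.length (evade β).length with h2 | h2 | h2
    · rw [List.getElem?_append_left h2] at hz
      rw [evade] at hz h2
      split_ifs at hz h2 with h3
      · rw [List.getElem?_append_right (not_lt.1 h1)] at hz
        have := List.mem_of_getElem? hz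
        simp at this; exact hc.2 this
      · simp at h2; omega
    · omega
    · rw [List.getElem?_append_right h2.le, List.getElem?_append_right (by simp; omega)] at hz
      exact hc.2 (List.eq_of_mem_replicate (List.mem_of_getElem? hz))

/-- The new number in `fresh β c n` makes the codes of the strings beyond it too large to have been
decided. -/
theorem Supported.fresh {s c n : ℕ} {β : List ℕ} (h : Supported p X s β) (hs : s ≤ c + 1) :
    Supported p X s (fresh β c n) := by
  constructor
  · intro ρ hρ hl hsρ
    rcases prefix_fresh_cases hρ with h1 | ⟨hm, rfl⟩ | h1
    · exact h.1 ρ h1 hl hsρ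
    · refine concat_mem_treeAt hm (Nat.zero_le 1) (h.mem_of_le (List.prefix_refl _) ?_
          ((encode_le_of_prefix (List.prefix_append _ _)).trans_lt hsρ)) hsρ
      simp at hl; omega
    · have := lt_encode_of_mem h1; omega
  · intro ρ z hρ hm hl
    rcases concat_prefix_fresh hρ with h1 | h1 | h1
    · exact h.2 ρ z h1 hm hl
    · exact absurd hm h1
    · omega

theorem Supported.fresh_concat {s c n x : ℕ} {β : List ℕ} (h : Supported p X s β)
    (hs : s ≤ c + 1) (hx : n % 4 = 2 → x ≤ 1) :
    Supported p X s (Pulldown.fresh β c n ++ [x]) := by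
  refine (h.fresh hs).concat (by rwa [length_fresh_mod]) fun _ _ he => ?_
  have hm : c ∈ Pulldown.fresh β c n ++ [x] :=
    List.mem_append_left _ ((evade_concat_prefix_fresh β c n).subset (by simp))
  have := lt_encode_of_mem hm
  omega

theorem NodeInv.start_cases {s : ℕ} {q : List ℕ} (h : NodeInv p X s q) (x : ℕ) :
    start (dat p X s q) x = (dat p X s q).v ++ [x] ∨
      ((dat p X s q).phase = 2 ∧ start (dat p X s q) x ∈ treeAt p X s) := by
  have h3 := h.phase_le
  by_cases h2 : (dat p X s q).phase = 2
  · obtain ⟨-, -, m0, m1, -⟩ := h.phase2 h2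
    rw [start]
    split_ifs
    · exact Or.inr ⟨h2, m0⟩
    · exact Or.inr ⟨h2, m1⟩
    · exact Or.inl rfl
  · left
    by_cases h0 : (dat p X s q).phase = 0
    · rw [h.phase0 h0, start_plain]; rfl
    · rw [h.phase1 (by omega), start_plain]; rfl

theorem supported_keep {s x : ℕ} {q : List ℕ} (hq : encode q < s)
    (ha : Alive p (initSeg X s) q) (h : Supported p X s (start (dat p X s q) x)) :
    Supported p X (s + 1) (start (dat p X s q) x) := by
  refine ⟨fun ρ hρ hl hs => ?_, h.2⟩
  rcases Nat.lt_succ_iff_lt_or_eq.1 hs with h1 | h1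
  · exact treeAt_mono (by omega) (h.1 ρ hρ hl h1)
  · refine mem_treeAt_succ.2 (Or.inr ⟨h1, ?_⟩)
    have hne : ρ ≠ [] := by rintro rfl; simp at hl
    obtain ⟨ρ', z, rfl⟩ : ∃ ρ' z, ρ = ρ' ++ [z] := ⟨_, _, (List.dropLast_append_getLast hne).symm⟩
    have hρ' : ρ' <+: start (dat p X s q) x := (List.prefix_append _ _).trans hρ
    have henc : encode ρ' < s := h1 ▸ encode_lt_of_prefix (List.prefix_append _ _) (by simp)
    rw [List.length_append, List.length_singleton] at hl
    refine ⟨by simp; omega, ?_, ?_⟩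
    · rw [List.dropLast_concat, List.length_append, List.length_singleton]
      exact (h.mem_of_le hρ' (by omega) henc).imp (by omega) id
    · by_cases hm : (ρ' ++ [z]).length % 4 = 3
      · refine Or.inl ⟨hm, ?_⟩
        rw [List.length_append, List.length_singleton] at hm
        simpa using h.2 ρ' z hρ (by omega) (by omega)
      · refine Or.inr ⟨hm, Or.inr ⟨encode q, by rwa [length_state], by rwa [ofNat_encode], ?_⟩⟩
        change (ρ' ++ [z]).dropLast = (dat p X s q).v ∨ ρ' ++ [z] <+: (dat p X s q).v
        rcases (nodeInv (p := p) (X := X) hq).start_cases x with h2 | ⟨-, h2⟩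
        · rw [h2] at hρ
          rcases prefix_concat_iff.1 hρ with h3 | h3
          · left; rw [h3, List.dropLast_concat]
          · exact Or.inr h3
        · have := encode_lt_of_mem_treeAt (treeAt_of_prefix h2 hρ (by simp; omega))
          omega

theorem supported_act {s x : ℕ} {q : List ℕ} (hq : encode q < s)
    (hw : wantAt p X s q = some (dat p X (s + 1) q)) (hx : (nodeStr q).length % 4 = 2 → x ≤ 1) :
    Supported p X (s + 1) (start (dat p X (s + 1) q) x) := by
  have hI := nodeInv (p := p) (X := X) hq
  have hmoved : ∀ β, dat p X (s + 1) q = moved s (nodeStr q).length (dat p X s q) β →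
      Supported p X (s + 1) β → Supported p X (s + 1) (start (dat p X (s + 1) q) x) := by
    intro β e hβ
    rw [e, moved, start_plain]
    exact hβ.fresh_concat le_rfl hx
  by_cases hm : (nodeStr q).length % 4 = 2
  · obtain ⟨hl, hp, ⟨τ₀, m0, τ₁, m1, hs, p0, p1, e⟩ | ⟨hc, h0, τ₀, m0, τ₁, m1, hs, p0, p1, e⟩ |
      ⟨hc, h0, τ, mτ, pτ, hlt, e⟩⟩ := want_split hw hm
    · rw [e]
      rcases Nat.le_one_iff_eq_zero_or_eq_one.1 (hx hm) with rfl | rfl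
      · exact supported_of_mem (treeAt_mono (by omega) m0)
      · exact supported_of_mem (treeAt_mono (by omega) m1)
    · refine hmoved _ e ?_
      have hsz := hI.size
      have hmod := hI.mod₀
      have hv₀ := treeAt_of_prefix m0 p0 (by omega)
      refine (supported_of_mem (treeAt_mono (by omega) hv₀)).concat (fun _ => by omega)
        fun h => absurd ?_ h
      omega
    · exact hmoved _ e (supported_of_mem (treeAt_mono (by omega) mτ))
  · obtain ⟨hl, h0, τ, mτ, -, e⟩ := want_serve hw hm
    exact hmoved _ e (supported_of_mem (treeAt_mono (by omega) mτ))

/-- As long as a node is alive, the initial segments of its value and of the starts of its successors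
are in the tree when they have been decided. -/
theorem supported_start {s x : ℕ} {q : List ℕ} (hq : encode q < s)
    (ha : Alive p (initSeg X s) q) (hx : (nodeStr q).length % 4 = 2 → x ≤ 1) :
    Supported p X s (start (dat p X s q) x) := by
  induction s generalizing q x with
  | zero => omega
  | succ s ih =>
    induction q generalizing x with
    | nil => exact absurd rfl ha.ne_nil
    | cons y q ihq =>
      rcases stage_cases (p := p) (X := X) (Nat.lt_succ_iff.1 hq) with
        ⟨h1, h2, h3⟩ | ⟨h1, h2, h3⟩ | ⟨_, h3⟩
      · rw [h3]
        have ha' := ha.anti (Nat.le_succ s) h1.le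
        exact supported_keep h1 ha' (ih h1 ha' hx)
      · exact supported_act h1 h3 hx
      · by_cases hne : q = []
        · subst hne
          rw [alive_singleton] at ha
          rw [h3, initData, if_pos rfl, start_plain]
          rw [nodeStr_singleton] at hx
          refine Supported.concat ⟨fun ρ hρ hl => ?_, fun ρ z hρ _ hl => ?_⟩ hx fun hm hl hs => ?_
          · have := hρ.length_le; omega
          · have := hρ.length_le
            rw [List.length_append, List.length_singleton] at this; omega
          · refine mem_treeAt_iff.2 ⟨hs, by simp; omega, Or.inl (by simp; omega),
              Or.inr ⟨by simp; omega, Or.inl (by simp; omega)⟩⟩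
        · rw [h3, init_dat hne, start_plain]
          obtain ⟨ha1, ha2⟩ := (alive_cons hne).1 ha
          refine (ihq ((encode_tail_lt y q).trans hq) ha1 fun hm => ?_).fresh_concat ?_ hx
          · have h4 := (certVal_ne_zero (certOk_iff.1 ha2).2.2.1).1.2.1
            rw [length_nodeStr_cons hne, nodeStr_cons hne] at h4
            simpa using h4 (by omega)
          · have := Nat.right_le_pair (encode (y :: q)) s; omega

/-! ### The nodes whose values are comparable -/

theorem Alive.of_suffix {χ q j : List ℕ} (h : Alive p χ j) (hq : q <:+ j) (hne : q ≠ []) :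
    Alive p χ q := by
  induction j with
  | nil => exact absurd rfl h.ne_nil
  | cons y j ih =>
    rcases List.suffix_cons_iff.1 hq with rfl | h1
    · exact h
    · have hj : j ≠ [] := by rintro rfl; exact hne (List.suffix_nil.1 h1)
      exact ih ((alive_cons hj).1 h).1 h1

theorem encode_le_of_suffix {q j : List ℕ} (h : q <:+ j) : encode q ≤ encode j := by
  induction j with
  | nil => rw [List.suffix_nil.1 h]
  | cons y j ih =>
    rcases List.suffix_cons_iff.1 h with rfl | h1
    · exact le_rfl
    · exact (ih h1).trans (encode_tail_lt y j).le

theorem v_concat_prefix_v₀ {s y : ℕ} {q : List ℕ} (hq : encode (y :: q) < s) (hne : q ≠ []) :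
    ∃ c, evade (start (dat p X s q) y.unpair.1) ++ [Nat.pair (encode (y :: q)) c] <+:
        (dat p X s (y :: q)).v₀ ∧
      ∀ u < s, ¬ QuietBelow p X u (encode (y :: q)) → u ≤ c := by
  obtain ⟨c, h1, h2⟩ := (nodeInv (p := p) (X := X) hq).init y q rfl hne
  exact ⟨c, h1 ▸ evade_concat_prefix_fresh _ _ _, h2⟩

theorem v_concat_prefix_child {s y : ℕ} {q : List ℕ} (hq : encode (y :: q) < s) (hne : q ≠ []) :
    (dat p X s q).v ++ [y.unpair.1] <+: (dat p X s (y :: q)).v₀ := by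
  obtain ⟨c, h1, -⟩ := v_concat_prefix_v₀ (p := p) (X := X) hq hne
  exact (((nodeInv ((encode_tail_lt y q).trans hq)).prefix_start _).trans
    ((evade_prefix _).trans (List.prefix_append _ _))).trans h1

theorem v_prefix_of_suffix {s : ℕ} {q j : List ℕ} (h : q <:+ j) (hne : q ≠ [])
    (hj : encode j < s) : (dat p X s q).v <+: (dat p X s j).v := by
  induction j with
  | nil => exact absurd (List.suffix_nil.1 h) hne
  | cons y j ih =>
    rcases List.suffix_cons_iff.1 h with rfl | h1
    · exact List.prefix_refl _
    · have hj' : j ≠ [] := by rintro rfl; exact hne (List.suffix_nil.1 h1)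
      exact ((ih h1 ((encode_tail_lt y j).trans hj)).trans (List.prefix_append _ _)).trans
        ((v_concat_prefix_child hj hj').trans (nodeInv hj).le)

theorem v_of_alive_singleton {s y : ℕ} (hq : encode [y] < s) (ha : Alive p (initSeg X s) [y]) :
    (dat p X s [y]).v = ofNat (List ℕ) y := by
  have hI := nodeInv (p := p) (X := X) hq
  have h0 : (dat p X s [y]).phase = 0 := by
    by_contra h
    have h1 := hI.active h
    have h2 := alive_singleton.1 ha
    rw [nodeStr_singleton] at h1
    omega
  have h2 := congrArg NodeData.v (hI.phase0 h0)
  rw [h2]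
  exact hI.base y rfl

theorem CertOk.length {χ σ : List ℕ} {c : ℕ} (h : CertOk p χ σ c) : p.1 < σ.length := h.2.1

theorem exists_singleton_suffix {j : List ℕ} (h : j ≠ []) : ∃ y, [y] <:+ j :=
  ⟨j.getLast h, j.dropLast, List.dropLast_append_getLast h⟩

theorem exists_cons_suffix {q j : List ℕ} (h : q <:+ j) (hne : q ≠ j) : ∃ y, y :: q <:+ j := by
  obtain ⟨t, rfl⟩ := h
  have ht : t ≠ [] := by rintro rfl; simp at hne
  exact ⟨t.getLast ht, t.dropLast, by
    conv_rhs => rw [← List.dropLast_append_getLast ht]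
    simp⟩

/-- Of two living nodes, the second extends the first if its value does. -/
theorem suffix_of_v_prefix {s : ℕ} {q j : List ℕ} (hq : encode q < s) (hj : encode j < s)
    (haq : Alive p (initSeg X s) q) (haj : Alive p (initSeg X s) j)
    (hlq : p.1 ≤ (nodeStr q).length) (hlj : p.1 < (dat p X s j).v.length)
    (h : (dat p X s q).v <+: (dat p X s j).v) : q <:+ j := by
  induction q with
  | nil => exact absurd rfl haq.ne_nil
  | cons y q ih =>
    by_cases hne : q = []
    · subst hne
      obtain ⟨y', hy'⟩ := exists_singleton_suffix haj.ne_nil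
      have hal := haj.of_suffix hy' (by simp)
      have hen := (encode_le_of_suffix hy').trans_lt hj
      have h1 := v_prefix_of_suffix (p := p) (X := X) hy' (by simp) hj
      rw [v_of_alive_singleton hen hal] at h1
      rw [v_of_alive_singleton hq haq] at h
      have h2 := alive_singleton.1 haq
      have h3 := alive_singleton.1 hal
      rw [nodeStr_singleton] at hlq
      have h4 : p.1 ≤ (ofNat (List ℕ) y').length := by
        have hne : [y'] ≠ j := by
          rintro rfl
          rw [v_of_alive_singleton hj haj] at hlj; omega
        obtain ⟨z, hz⟩ := exists_cons_suffix hy' hne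
        have := ((alive_cons (by simp)).1 (haj.of_suffix hz (by simp))).2.length
        rw [length_nodeStr_cons (by simp), nodeStr_singleton] at this
        omega
      have h5 : ofNat (List ℕ) y = ofNat (List ℕ) y' :=
        (List.prefix_of_prefix_length_le h h1 (by omega)).eq_of_length (by omega)
      rwa [(Denumerable.eqv (List ℕ)).symm.injective h5]
    · obtain ⟨ha1, ha2⟩ := (alive_cons hne).1 haq
      have hq' := (encode_tail_lt y q).trans hq
      have hl := ha2.length
      rw [length_nodeStr_cons hne] at hl
      have hv := v_concat_prefix_child (p := p) (X := X) hq hne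
      have hv₀ := (nodeInv (p := p) (X := X) hq).le.trans h
      have h1 := ih hq' ha1 (by omega) (((List.prefix_append _ _).trans hv).trans hv₀)
      have hqj : q ≠ j := by
        rintro rfl
        have := (hv.trans hv₀).length_le
        simp at this
      obtain ⟨y', hy'⟩ := exists_cons_suffix h1 hqj
      have hen := (encode_le_of_suffix hy').trans_lt hj
      have hv' := v_concat_prefix_child (p := p) (X := X) hen hne
      have hv₀' := (nodeInv (p := p) (X := X) hen).le.trans
        (v_prefix_of_suffix (p := p) (X := X) hy' (by simp) hj)
      have hx := concat_prefix_inj (hv.trans hv₀) (hv'.trans hv₀')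
      obtain ⟨c, hc, -⟩ := v_concat_prefix_v₀ (p := p) (X := X) hq hne
      obtain ⟨c', hc', -⟩ := v_concat_prefix_v₀ (p := p) (X := X) hen hne
      rw [← hx] at hc'
      have := concat_prefix_inj (hc.trans hv₀) (hc'.trans hv₀')
      have := (Nat.pair_eq_pair.1 this).1
      rwa [encode_injective this]

end
end Pulldown

namespace Pulldown

open Encodable Denumerable Filter

/-! ### Expansionary functions -/

/-- Of two strings, one extends the other, or they differ at some place. -/
theorem prefix_or_differ (σ τ : List ℕ) : σ <+: τ ∨ τ <+: σ ∨
    ∃ μ x y, x ≠ y ∧ μ ++ [x] <+: σ ∧ μ ++ [y] <+: τ := by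
  induction σ generalizing τ with
  | nil => exact Or.inl List.nil_prefix
  | cons a σ ih =>
    cases τ with
    | nil => exact Or.inr (Or.inl List.nil_prefix)
    | cons b τ =>
      by_cases hab : a = b
      · subst hab
        rcases ih τ with h | h | ⟨μ, x, y, h1, h2, h3⟩
        · exact Or.inl (by simpa using h)
        · exact Or.inr (Or.inl (by simpa using h))
        · exact Or.inr (Or.inr ⟨a :: μ, x, y, h1, by simpa using h2, by simpa using h3⟩)
      · exact Or.inr (Or.inr ⟨[], a, b, hab, by simp, by simp⟩)

theorem incompat_of_differ {σ τ μ : List ℕ} {x y : ℕ} (h : x ≠ y) (h₁ : μ ++ [x] <+: σ)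
    (h₂ : μ ++ [y] <+: τ) : Incompat σ τ :=
  ⟨fun h' => h (concat_prefix_inj (h₁.trans h') h₂), fun h' => h (concat_prefix_inj h₁ (h₂.trans h'))⟩

theorem leftOf_iff_of_differ {σ τ μ : List ℕ} {x y : ℕ} (h : x ≠ y) (h₁ : μ ++ [x] <+: σ)
    (h₂ : μ ++ [y] <+: τ) : LeftOf σ τ ↔ x < y := by
  rw [LeftOf, and_iff_left (incompat_of_differ h h₁ h₂)]
  obtain ⟨a, rfl⟩ := h₁
  obtain ⟨b, rfl⟩ := h₂
  induction μ with
  | nil =>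
    rw [← not_lt, List.nil_append, List.nil_append, List.cons_append, List.cons_append,
      List.cons_lt_cons_iff]
    omega
  | cons c μ ih =>
    rw [← not_lt, List.cons_append, List.cons_append, List.cons_append, List.cons_append,
      List.cons_lt_cons_iff, ← ih]
    simp

theorem meet_of_differ {σ τ μ : List ℕ} {x y : ℕ} (h : x ≠ y) (h₁ : μ ++ [x] <+: σ)
    (h₂ : μ ++ [y] <+: τ) : meet σ τ = μ := by
  obtain ⟨a, rfl⟩ := h₁
  obtain ⟨b, rfl⟩ := h₂
  induction μ with
  | nil => simp [meet, h]
  | cons c μ ih => simpa [meet] using ih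

theorem meet_of_prefix {σ τ : List ℕ} (h : σ <+: τ) : meet σ τ = σ ∧ meet τ σ = σ := by
  obtain ⟨a, rfl⟩ := h
  induction σ with
  | nil => cases a <;> simp [meet]
  | cons c μ ih => simpa [meet] using ih

/-- The values of `Γ` on the immediate successors of `σ` branch off at the end of `Γ(σ)`, the way
the successors do. -/
def Branches (Γ : List ℕ →. List ℕ) : Prop :=
  ∀ σ x τ', τ' ∈ Γ (σ ++ [x]) → ∃ σ' ∈ Γ σ, σ' ++ [x] <+: τ'

namespace Branches

variable {Γ : List ℕ →. List ℕ}

theorem exists_prefix (hΓ : Branches Γ) {σ τ τ' : List ℕ} (h : σ <+: τ) (hτ : τ' ∈ Γ τ) :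
    ∃ σ' ∈ Γ σ, σ' <+: τ' := by
  obtain ⟨a, rfl⟩ := h
  induction a using List.reverseRecOn generalizing τ' with
  | nil => exact ⟨τ', by simpa using hτ, List.prefix_refl _⟩
  | append_singleton a x ih =>
    rw [← List.append_assoc] at hτ
    obtain ⟨ρ, h1, h2⟩ := hΓ _ _ _ hτ
    obtain ⟨σ', h3, h4⟩ := ih h1
    exact ⟨σ', h3, (h4.trans (List.prefix_append _ _)).trans h2⟩

theorem concat_prefix (hΓ : Branches Γ) {σ τ τ' : List ℕ} {x : ℕ} (h : σ ++ [x] <+: τ)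
    (hτ : τ' ∈ Γ τ) : ∃ σ' ∈ Γ σ, σ' ++ [x] <+: τ' := by
  obtain ⟨ρ, h1, h2⟩ := hΓ.exists_prefix h hτ
  obtain ⟨σ', h3, h4⟩ := hΓ _ _ _ h1
  exact ⟨σ', h3, h4.trans h2⟩

theorem differ (hΓ : Branches Γ) {σ τ μ σ' τ' : List ℕ} {x y : ℕ} (h₁ : μ ++ [x] <+: σ)
    (h₂ : μ ++ [y] <+: τ) (hσ : σ' ∈ Γ σ) (hτ : τ' ∈ Γ τ) :
    ∃ μ' ∈ Γ μ, μ' ++ [x] <+: σ' ∧ μ' ++ [y] <+: τ' := by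
  obtain ⟨μ₁, h3, h4⟩ := hΓ.concat_prefix h₁ hσ
  obtain ⟨μ₂, h5, h6⟩ := hΓ.concat_prefix h₂ hτ
  rw [Part.mem_unique h5 h3] at h6
  exact ⟨μ₁, h3, h4, h6⟩

theorem mono (hΓ : Branches Γ) {σ τ σ' τ' : List ℕ} (h : σ <+: τ) (hσ : σ' ∈ Γ σ)
    (hτ : τ' ∈ Γ τ) : σ' <+: τ' := by
  obtain ⟨ρ, h1, h2⟩ := hΓ.exists_prefix h hτ
  rwa [Part.mem_unique hσ h1]

theorem ssubset (hΓ : Branches Γ) {σ τ σ' τ' : List ℕ} (h : σ <+: τ) (hne : σ ≠ τ)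
    (hσ : σ' ∈ Γ σ) (hτ : τ' ∈ Γ τ) : σ'.length < τ'.length := by
  obtain ⟨a, rfl⟩ := h
  cases a with
  | nil => simp at hne
  | cons x a =>
    obtain ⟨ρ, h1, h2⟩ := hΓ.concat_prefix (σ := σ) (x := x) (τ := σ ++ x :: a) ⟨a, by simp⟩ hτ
    rw [Part.mem_unique hσ h1]
    simpa using h2.length_le

theorem prefix_or_prefix (hΓ : Branches Γ) {σ τ σ' τ' : List ℕ} (hσ : σ' ∈ Γ σ) (hτ : τ' ∈ Γ τ)
    (h : σ' <+: τ' ∨ τ' <+: σ') : σ <+: τ ∨ τ <+: σ := by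
  rcases prefix_or_differ σ τ with h1 | h1 | ⟨μ, x, y, h1, h2, h3⟩
  · exact Or.inl h1
  · exact Or.inr h1
  · obtain ⟨μ', -, h4, h5⟩ := hΓ.differ h2 h3 hσ hτ
    have := incompat_of_differ h1 h4 h5
    exact absurd h (not_or.2 this)

theorem isExpansionary (hΓ : Branches Γ) : IsExpansionary Γ where
  monotone τ τ' hτ σ := by
    constructor
    · rintro ⟨h1, h2⟩
      obtain ⟨σ', h3, h4⟩ := hΓ.exists_prefix h1 hτ
      refine ⟨σ', h3, h4, ?_⟩
      rintro rfl
      exact lt_irrefl _ (hΓ.ssubset h1 h2 h3 hτ)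
    · rintro ⟨σ', h1, h2, h3⟩
      have hne : σ ≠ τ := by
        rintro rfl
        exact h3 (Part.mem_unique h1 hτ)
      rcases hΓ.prefix_or_prefix h1 hτ (Or.inl h2) with h4 | h4
      · exact ⟨h4, hne⟩
      · have h5 := hΓ.ssubset h4 (Ne.symm hne) hτ h1
        exact absurd h2.length_le (by omega)
  leftOf σ τ σ' τ' hσ hτ := by
    rcases prefix_or_differ σ τ with h1 | h1 | ⟨μ, x, y, h1, h2, h3⟩
    · exact iff_of_false (fun h => h.2.1 h1) fun h => h.2.1 (hΓ.mono h1 hσ hτ)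
    · exact iff_of_false (fun h => h.2.2 h1) fun h => h.2.2 (hΓ.mono h1 hτ hσ)
    · obtain ⟨μ', -, h4, h5⟩ := hΓ.differ h2 h3 hσ hτ
      rw [leftOf_iff_of_differ h1 h2 h3, leftOf_iff_of_differ h1 h4 h5]
  meet σ τ σ' τ' hσ hτ := by
    rcases prefix_or_differ σ τ with h1 | h1 | ⟨μ, x, y, h1, h2, h3⟩
    · rwa [(meet_of_prefix h1).1, (meet_of_prefix (hΓ.mono h1 hσ hτ)).1]
    · rwa [(meet_of_prefix h1).2, (meet_of_prefix (hΓ.mono h1 hτ hσ)).2]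
    · obtain ⟨μ', h6, h4, h5⟩ := hΓ.differ h2 h3 hσ hτ
      rwa [meet_of_differ h1 h2 h3, meet_of_differ h1 h4 h5]

theorem length_le (hΓ : Branches Γ) {σ σ' : List ℕ} (h : σ' ∈ Γ σ) : σ.length ≤ σ'.length := by
  induction σ using List.reverseRecOn generalizing σ' with
  | nil => simp
  | append_singleton σ x ih =>
    obtain ⟨ρ, h1, h2⟩ := hΓ _ _ _ h
    have := h2.length_le
    have := ih h1
    simp at *; omega

theorem mapsReal_iff (hΓ : Branches Γ) {f g : ℕ → ℕ} :
    MapsReal Γ f g ↔ ∀ n, ∃ τ ∈ Γ (initSeg f n), IsInit τ g := by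
  constructor
  · rintro ⟨h1, h2⟩
    have h3 : ∀ n, ∃ k ≥ n, ∃ τ, τ ∈ Γ (initSeg f k) := by
      intro n
      induction n with
      | zero =>
        obtain ⟨k, τ, h3, -⟩ := h2 0
        exact ⟨k, Nat.zero_le _, τ, h3⟩
      | succ n ih =>
        obtain ⟨k, hk, τ, h3⟩ := ih
        obtain ⟨k', τ', h4, h5⟩ := h2 (τ.length + 1)
        refine ⟨k', ?_, τ', h4⟩
        by_contra hc
        have := (hΓ.mono (initSeg_prefix f (show k' ≤ k by omega)) h4 h3).length_le
        omega
    intro n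
    obtain ⟨k, hk, τ, h4⟩ := h3 n
    obtain ⟨σ', h5, -⟩ := hΓ.exists_prefix (initSeg_prefix f hk) h4
    exact ⟨σ', h5, h1 n σ' h5⟩
  · intro h
    refine ⟨fun n τ hτ => ?_, fun k => ?_⟩
    · obtain ⟨τ', h1, h2⟩ := h n
      rwa [Part.mem_unique hτ h1]
    · obtain ⟨τ, h1, -⟩ := h k
      exact ⟨k, τ, h1, by simpa [length_initSeg] using hΓ.length_le h1⟩

/-- The path that `Γ` maps to `g`, if `g` extends values of `Γ` at strings of all lengths. -/
theorem exists_mapsReal (hΓ : Branches Γ) {g : ℕ → ℕ}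
    (h : ∀ n, ∃ σ : List ℕ, σ.length = n ∧ ∃ τ ∈ Γ σ, IsInit τ g) : ∃ f, MapsReal Γ f g := by
  choose σ hl τ hτ hg using h
  have h1 : ∀ m n, m ≤ n → σ m <+: σ n := by
    intro m n hmn
    have h2 : σ m <+: σ n ∨ σ n <+: σ m := hΓ.prefix_or_prefix (hτ m) (hτ n) (by
      rcases le_total (τ m).length (τ n).length with h | h
      · exact Or.inl ((hg m).prefix_of_le (hg n) h)
      · exact Or.inr ((hg n).prefix_of_le (hg m) h))
    rcases h2 with h2 | h2
    · exact h2
    · rw [h2.eq_of_length (by rw [hl, hl]; exact le_antisymm (by simpa [hl] using h2.length_le) hmn)]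
  refine ⟨fun n => (σ (n + 1)).getD n 0, hΓ.mapsReal_iff.2 fun n => ⟨τ n, ?_, hg n⟩⟩
  have h3 : initSeg (fun n => (σ (n + 1)).getD n 0) n = σ n := by
    refine List.ext_getElem? fun i => ?_
    rw [getElem?_initSeg]
    split_ifs with hi
    · obtain ⟨a, ha⟩ := h1 (i + 1) n hi
      have h4 : i < (σ (i + 1)).length := by rw [hl]; omega
      rw [← ha, List.getElem?_append_left h4, List.getElem?_eq_getElem h4,
        List.getD_eq_getElem _ _ h4]
    · exact (List.getElem?_eq_none (by rw [hl]; omega)).symm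
  rw [h3]; exact hτ n

theorem mapsReal_unique (hΓ : Branches Γ) {f f' g : ℕ → ℕ} (h : MapsReal Γ f g)
    (h' : MapsReal Γ f' g) : f = f' := by
  refine eq_of_initSeg fun n => ?_
  obtain ⟨τ, h1, h2⟩ := hΓ.mapsReal_iff.1 h n
  obtain ⟨τ', h3, h4⟩ := hΓ.mapsReal_iff.1 h' n
  rcases hΓ.prefix_or_prefix h1 h3 (by
      rcases le_total τ.length τ'.length with h | h
      · exact Or.inl (h2.prefix_of_le h4 h)
      · exact Or.inr (h4.prefix_of_le h2 h)) with h | h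
  · exact h.eq_of_length (by simp [length_initSeg])
  · exact (h.eq_of_length (by simp [length_initSeg])).symm

theorem mapsReal_apply (hΓ : Branches Γ) {f g : ℕ → ℕ} (h : MapsReal Γ f g) {n : ℕ} {τ : List ℕ}
    (hτ : τ ∈ Γ (initSeg f n)) : f n = g τ.length := by
  obtain ⟨τ', h1, h2⟩ := hΓ.mapsReal_iff.1 h (n + 1)
  rw [initSeg_succ] at h1
  obtain ⟨σ', h3, h4⟩ := hΓ _ _ _ h1
  rw [Part.mem_unique h3 hτ] at h4
  exact ((h2.of_prefix h4).eq_concat).symm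

theorem exists_real (hΓ : Branches Γ) {f : ℕ → ℕ} (h : ∀ n, (Γ (initSeg f n)).Dom) :
    ∃ g, MapsReal Γ f g := by
  have hm : ∀ n, (Γ (initSeg f n)).get (h n) ∈ Γ (initSeg f n) := fun n => Part.get_mem _
  generalize hV : (fun n => (Γ (initSeg f n)).get (h n)) = V
  have hm : ∀ n, V n ∈ Γ (initSeg f n) := fun n => by rw [← hV]; exact hm n
  refine ⟨fun n => (V (n + 1)).getD n 0, hΓ.mapsReal_iff.2 fun n => ⟨V n, hm n, ?_⟩⟩
  refine isInit_iff.2 fun i x hx => ?_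
  have h1 : i < (V (i + 1)).length := by
    have := hΓ.length_le (hm (i + 1)); rw [length_initSeg] at this; omega
  have h2 : (V (i + 1))[i]? = some x := by
    rcases le_total n (i + 1) with h3 | h3
    · obtain ⟨a, ha⟩ := hΓ.mono (initSeg_prefix f h3) (hm n) (hm (i + 1))
      rw [← ha, List.getElem?_append_left ?_, hx]
      exact (List.getElem?_eq_some_iff.1 hx).1
    · obtain ⟨a, ha⟩ := hΓ.mono (initSeg_prefix f h3) (hm (i + 1)) (hm n)
      rwa [← ha, List.getElem?_append_left h1] at hx
  rw [List.getD_eq_getElem?_getD, h2, Option.getD_some]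

open Topology in
/-- If each path through `T` is the image of a path through `T'`, then `Γ` induces a
homeomorphism: the image up to length `n` depends on the first `n` numbers of `f`, and `f(n)` is
the entry of the image at the length of the value of `Γ` at `f ↾ n`. -/
theorem exists_homeomorph (hΓ : Branches Γ) {T' T : Set (List ℕ)}
    (hdom : ∀ f ∈ paths T', ∀ n, (Γ (initSeg f n)).Dom)
    (hmem : ∀ f ∈ paths T', ∀ g, MapsReal Γ f g → g ∈ paths T)
    (hsurj : ∀ g ∈ paths T, ∃ f ∈ paths T', MapsReal Γ f g) :
    ∃ h : paths T' ≃ₜ paths T, ∀ f : paths T', MapsReal Γ (f : ℕ → ℕ) (h f : ℕ → ℕ) := by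
  choose F hF using fun f : paths T' => hΓ.exists_real (hdom f f.2)
  choose G hG hGm using fun g : paths T => hsurj g g.2
  have hval : ∀ (f : paths T') (n : ℕ), ∃ τ ∈ Γ (initSeg f n), IsInit τ (F f) :=
    fun f => hΓ.mapsReal_iff.1 (hF f)
  have hloc : ∀ (f : paths T') (n : ℕ), F f n = ((Γ (initSeg f (n + 1))).get
      (hdom f f.2 (n + 1))).getD n 0 := by
    intro f n
    have h1 : n < ((Γ (initSeg f (n + 1))).get (hdom f f.2 (n + 1))).length := by
      have := hΓ.length_le (Part.get_mem (hdom f f.2 (n + 1)))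
      rw [length_initSeg] at this; omega
    obtain ⟨τ, h2, h3⟩ := hval f (n + 1)
    rw [← Part.mem_unique (Part.get_mem (hdom f f.2 (n + 1))) h2] at h3
    rw [List.getD_eq_getElem _ _ h1]
    exact isInit_iff.1 h3 n _ (List.getElem?_eq_getElem h1)
  have huniq : ∀ f g g', MapsReal Γ f g → MapsReal Γ f g' → g = g' := by
    intro f g g' h h'
    refine eq_of_initSeg fun n => ?_
    obtain ⟨τ, h1, h2⟩ := hΓ.mapsReal_iff.1 h n
    obtain ⟨τ', h3, h4⟩ := hΓ.mapsReal_iff.1 h' n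
    rw [Part.mem_unique h3 h1] at h4
    have h5 := hΓ.length_le h1
    have h6 : initSeg g n <+: τ := (isInit_initSeg g n).prefix_of_le h2 (by simpa [length_initSeg] using h5)
    have h7 : initSeg g' n <+: τ := (isInit_initSeg g' n).prefix_of_le h4 (by simpa [length_initSeg] using h5)
    exact (List.prefix_of_prefix_length_le h6 h7 (by simp [length_initSeg])).eq_of_length
      (by simp [length_initSeg])
  have hnhds : ∀ (T : Set (List ℕ)) (f : paths T) (n : ℕ),
      ∀ᶠ f' : paths T in 𝓝 f, initSeg f' n = initSeg f n := by
    intro T f n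
    have h1 : ∀ᶠ f' : paths T in 𝓝 f, ∀ i ∈ Finset.range n, (f' : ℕ → ℕ) i = (f : ℕ → ℕ) i :=
      (eventually_all_finset _).2 fun i _ => by
        have hc : Continuous fun f' : paths T => (f' : ℕ → ℕ) i :=
          (continuous_apply i).comp continuous_subtype_val
        exact hc.continuousAt.eventually_mem (IsOpen.mem_nhds (isOpen_discrete {(f : ℕ → ℕ) i}) rfl)
    filter_upwards [h1] with f' hf'
    exact List.map_congr_left fun i hi => hf' i (by simpa using hi)
  have hcont : ∀ (T₁ T₂ : Set (List ℕ)) (H : paths T₁ → paths T₂),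
      (∀ (f : paths T₁) (n : ℕ), ∃ m, ∀ f' : paths T₁, initSeg f' m = initSeg f m →
        (H f' : ℕ → ℕ) n = (H f : ℕ → ℕ) n) → Continuous H := by
    intro T₁ T₂ H h
    refine Continuous.subtype_mk (f := fun f => (H f : ℕ → ℕ)) (continuous_pi fun n =>
      continuous_iff_continuousAt.2 fun f => ?_) fun f => (H f).2
    obtain ⟨m, hm⟩ := h f n
    refine tendsto_nhds_of_eventually_eq ?_
    filter_upwards [hnhds T₁ f m] with f' hf' using hm f' hf'
  refine ⟨⟨⟨fun f => ⟨F f, hmem f f.2 _ (hF f)⟩, fun g => ⟨G g, hG g⟩, fun f => ?_, fun g => ?_⟩,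
    hcont _ _ _ fun f n => ⟨n + 1, fun f' hf' => ?_⟩, hcont _ _ _ fun g n => ?_⟩, hF⟩
  · exact Subtype.ext (hΓ.mapsReal_unique (hGm _) (hF f))
  · exact Subtype.ext (huniq _ _ _ (hF _) (hGm g))
  · change F f' n = F f n
    rw [hloc, hloc]
    simp only [hf']
  · obtain ⟨τ, h1, h2⟩ := hΓ.mapsReal_iff.1 (hGm g) (n + 1)
    refine ⟨τ.length, fun g' hg' => ?_⟩
    have h3 : IsInit τ g' := by rw [IsInit, hg']; exact h2
    have h4 : ∀ k ≤ n + 1, initSeg (G g') k = initSeg (G g) k := by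
      intro k
      induction k with
      | zero => intro _; rfl
      | succ k ih =>
        intro hk
        have h5 := ih (by omega)
        obtain ⟨ρ, h6, h7⟩ := hΓ.mapsReal_iff.1 (hGm g) k
        have h8 := hΓ.mapsReal_apply (hGm g) h6
        have h9 := hΓ.mapsReal_apply (hGm g') (h5 ▸ h6)
        have h10 : ρ.length < τ.length := hΓ.ssubset (initSeg_prefix (G g) (show k ≤ n + 1 by omega))
          (fun h => by have := congrArg List.length h; simp [length_initSeg] at this; omega) h6 h1
        rw [initSeg_succ, initSeg_succ, h5, h8, h9,
          isInit_iff.1 h3 _ _ (List.getElem?_eq_getElem h10),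
          isInit_iff.1 h2 _ _ (List.getElem?_eq_getElem h10)]
    have h5 := h4 (n + 1) le_rfl
    rw [initSeg_succ, initSeg_succ] at h5
    simpa using (List.append_inj' h5 rfl).2

end Branches

end Pulldown

namespace Pulldown

open Encodable Denumerable Filter

section
variable {p : Params} {X : ℕ → ℕ}

/-! ### The tree and the map -/

/-- The strings accepted by the program that decides `T' ↾ l`. -/
def base (p : Params) (X : ℕ → ℕ) : Set (List ℕ) := {σ | 1 ∈ Phi p.2.2 X (encode σ)}

/-- The accepted strings are a tree of height at most `l` that is nice below `l`. -/
structure BaseOk (p : Params) (X : ℕ → ℕ) : Prop where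
  tree : IsTree (base p X)
  length_le : ∀ σ ∈ base p X, σ.length ≤ p.1
  nice : ∀ σ x, (σ ++ [x]).length % 4 = 3 → (σ ++ [x]).length ≤ p.1 →
    (σ ++ [x] ∈ base p X ↔ σ ∈ base p X ∧ (x = 0 ∨ x = 1))

/-- The largest nice tree above the accepted strings all of whose longer strings are accepted by
the functional with index `e` and oracle `X'`. -/
def upperTree (p : Params) (X : ℕ → ℕ) : Set (List ℕ) :=
  {σ | σ.take p.1 ∈ base p X ∧ ∀ n, p.1 < n → n ≤ σ.length → Good p X (σ.take n)}

/-- The tree that the construction enumerates. -/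
def lowerTree (p : Params) (X : ℕ → ℕ) : Set (List ℕ) :=
  {τ | τ.take p.1 ∈ base p X ∧ (p.1 < τ.length → ∃ s, τ ∈ treeAt p X s)}

/-- The final value of a node. -/
noncomputable def limVal (p : Params) (X : ℕ → ℕ) (q : List ℕ) : List ℕ := (limDat p X q).v

open Classical in
/-- The map that takes a string in the upper tree to the final value of the node that stands for
it and has only right certificates. -/
noncomputable def nodeMap (p : Params) (X : ℕ → ℕ) : List ℕ →. List ℕ := fun σ =>
  ⟨σ ∈ upperTree p X ∧ ∃ q, IsTrue p X q ∧ nodeStr q = σ, fun h => limVal p X h.2.choose⟩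

theorem mem_nodeMap {σ τ : List ℕ} : τ ∈ nodeMap p X σ ↔
    σ ∈ upperTree p X ∧ ∃ q, IsTrue p X q ∧ nodeStr q = σ ∧ limVal p X q = τ := by
  constructor
  · rintro ⟨h, h1⟩
    exact ⟨h.1, _, h.2.choose_spec.1, h.2.choose_spec.2, h1⟩
  · rintro ⟨h, q, h1, h2, h3⟩
    refine ⟨⟨h, q, h1, h2⟩, ?_⟩
    rw [← h3]
    have h4 : ∃ q, IsTrue p X q ∧ nodeStr q = σ := ⟨q, h1, h2⟩
    change limVal p X h4.choose = _
    rw [h4.choose_spec.1.unique h1 (h4.choose_spec.2.trans h2.symm)]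

theorem nodeMap_dom {σ : List ℕ} : (nodeMap p X σ).Dom ↔ σ ∈ upperTree p X :=
  ⟨fun h => h.1, fun h => ⟨h, exists_isTrue h.2⟩⟩

theorem BaseOk.isTree_upperTree (h : BaseOk p X) : IsTree (upperTree p X) := by
  intro σ τ hσ hτ
  refine ⟨h.tree _ _ (hσ.take _) hτ.1, fun n hn hn' => ?_⟩
  have h1 := hτ.2 n hn (hn'.trans hσ.length_le)
  obtain ⟨a, rfl⟩ := hσ
  rwa [List.take_append_of_le_length hn'] at h1

theorem mem_upperTree_of_le {σ : List ℕ} (h : σ.length ≤ p.1) :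
    σ ∈ upperTree p X ↔ σ ∈ base p X := by
  rw [upperTree, Set.mem_ofPred_eq, List.take_of_length_le h]
  exact and_iff_left fun n hn hn' => by omega

theorem mem_lowerTree_of_le {σ : List ℕ} (h : σ.length ≤ p.1) :
    σ ∈ lowerTree p X ↔ σ ∈ base p X := by
  rw [lowerTree, Set.mem_ofPred_eq, List.take_of_length_le h]
  exact and_iff_left fun hn => by omega

theorem mem_lowerTree_of_lt {σ : List ℕ} (h : p.1 < σ.length) :
    σ ∈ lowerTree p X ↔ σ.take p.1 ∈ base p X ∧ ∃ s, σ ∈ treeAt p X s := by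
  rw [lowerTree, Set.mem_ofPred_eq]
  exact and_congr_right fun _ => ⟨fun h' => h' h, fun h' _ => h'⟩

theorem mem_upperTree_of_lt {σ : List ℕ} {x : ℕ} (h : p.1 ≤ σ.length) :
    σ ++ [x] ∈ upperTree p X ↔ σ ∈ upperTree p X ∧ Good p X (σ ++ [x]) := by
  rw [upperTree, Set.mem_ofPred_eq, Set.mem_ofPred_eq, List.take_append_of_le_length h, and_assoc]
  refine and_congr_right fun _ => ⟨fun h1 => ⟨fun n hn hn' => ?_, ?_⟩, fun h1 n hn hn' => ?_⟩
  · have := h1 n hn (by simp; omega)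
    rwa [List.take_append_of_le_length hn'] at this
  · have := h1 (σ ++ [x]).length (by simp; omega) le_rfl
    rwa [List.take_length] at this
  · by_cases hl : n ≤ σ.length
    · rw [List.take_append_of_le_length hl]; exact h1.1 n hn hl
    · rw [List.take_of_length_le (by simp; omega)]; exact h1.2

theorem BaseOk.isNice_upperTree (h : BaseOk p X) (hn : IsNice (base p X)) :
    IsNice (upperTree p X) := by
  intro σ x hm
  have hm2 : σ.length % 4 = 2 := by simp at hm; omega
  by_cases hl : (σ ++ [x]).length ≤ p.1
  · have hl' : σ.length ≤ p.1 := by simp at hl; omega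
    rw [mem_upperTree_of_le hl, mem_upperTree_of_le hl']
    exact h.nice σ x hm hl
  · have hl' : p.1 ≤ σ.length := by simp at hl; omega
    rw [mem_upperTree_of_lt hl']
    refine and_congr_right fun hσ => ?_
    constructor
    · intro h1
      have := h1.2.1 hm
      simp at this; omega
    · intro hx
      -- a string of length `l` would have successors among the accepted strings
      have hlt : p.1 < σ.length := by
        refine lt_of_le_of_ne hl' fun he => ?_
        have h1 := (hn σ 0 (by simp; omega)).2 ⟨(mem_upperTree_of_le he.ge).1 hσ, Or.inl rfl⟩
        have := h.length_le _ h1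
        simp at this; omega
      have h1 := hσ.2 σ.length hlt le_rfl
      rw [List.take_length] at h1
      have h2 := h1.2.2
      rw [required, if_pos hm2] at h2
      refine ⟨by rw [List.take_append_of_le_length hl']; exact h1.1, fun _ => by simp; omega, ?_⟩
      rw [required, if_neg (by omega)]
      intro τ hτ
      rw [List.mem_singleton.1 hτ]
      rcases hx with rfl | rfl
      · exact h2 _ (by simp)
      · exact h2 _ (by simp)

theorem BaseOk.isTree_lowerTree (h : BaseOk p X) : IsTree (lowerTree p X) := by
  intro σ τ hσ hτ
  refine ⟨h.tree _ _ (hσ.take _) hτ.1, fun hn => ?_⟩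
  obtain ⟨s, hs⟩ := hτ.2 (hn.trans_le hσ.length_le)
  exact ⟨s, treeAt_of_prefix hs hσ hn⟩

theorem BaseOk.isNice_lowerTree (h : BaseOk p X) : IsNice (lowerTree p X) := by
  intro σ x hm
  have hm2 : σ.length % 4 = 2 := by simp at hm; omega
  by_cases hl : (σ ++ [x]).length ≤ p.1
  · have hl' : σ.length ≤ p.1 := by simp at hl; omega
    rw [mem_lowerTree_of_le hl, mem_lowerTree_of_le hl']
    exact h.nice σ x hm hl
  · have hl' : p.1 ≤ σ.length := by simp at hl; omega
    rw [mem_lowerTree_of_lt (by omega), List.take_append_of_le_length hl']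
    constructor
    · rintro ⟨h1, s, hs⟩
      have := le_one_of_mem_treeAt hm2 hs
      exact ⟨⟨h1, fun hl => ⟨s, treeAt_of_prefix hs (List.prefix_append _ _) hl⟩⟩, by omega⟩
    · rintro ⟨⟨h1, h2⟩, hx⟩
      refine ⟨h1, encode (σ ++ [x]) + 1, concat_mem_treeAt hm2 (by omega) ?_ (by omega)⟩
      rcases hl'.eq_or_lt with h3 | h3
      · exact Or.inl h3.symm
      · obtain ⟨s, hs⟩ := h2 h3
        exact Or.inr (mem_treeAt_of_lt hs (Nat.lt_succ_of_le
          (encode_le_of_prefix (List.prefix_append _ _))))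

theorem restr_lowerTree : restr (lowerTree p X) p.1 = restr (upperTree p X) p.1 := by
  ext σ
  refine and_congr_left fun hl => ?_
  rw [mem_upperTree_of_le hl, mem_lowerTree_of_le hl]

/-! ### Final values -/

theorem limVal_concat_prefix {y : ℕ} {q : List ℕ} (hne : q ≠ []) :
    limVal p X q ++ [y.unpair.1] <+: limVal p X (y :: q) := by
  obtain ⟨s, h1, -, h2, h3⟩ := (eventually_settled p X (y :: q)).exists
  have h4 := (v_concat_prefix_child h1 hne).trans h2.le
  rwa [h3 _ le_rfl, h3 _ (encode_tail_lt y q).le] at h4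

theorem limVal_singleton {y : ℕ} (h : IsTrue p X [y]) : limVal p X [y] = ofNat (List ℕ) y := by
  obtain ⟨s, h1, -, -, h3⟩ := (eventually_settled p X [y]).exists
  have := v_of_alive_singleton h1 (h.alive h1.le)
  rwa [h3 _ le_rfl] at this

theorem length_le_limVal (q : List ℕ) : (nodeStr q).length ≤ (limVal p X q).length := by
  obtain ⟨s, -, -, h2, h3⟩ := (eventually_settled p X q).exists
  have := h2.size.trans h2.le.length_le
  rwa [h3 _ le_rfl] at this

theorem take_limVal {q : List ℕ} (h : IsTrue p X q) :
    (limVal p X q).take p.1 = (nodeStr q).take p.1 := by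
  induction q with
  | nil => exact absurd rfl h.ne_nil
  | cons y q ih =>
    by_cases hne : q = []
    · subst hne
      rw [limVal_singleton h, nodeStr_singleton]
    · obtain ⟨h1, h2⟩ := (isTrue_cons hne).1 h
      have h3 := (eventually_certOk_iff.1 ⟨_, h2⟩).1
      rw [length_nodeStr_cons hne] at h3
      obtain ⟨a, ha⟩ := limVal_concat_prefix (p := p) (X := X) (y := y) hne
      have := length_le_limVal (p := p) (X := X) q
      rw [← ha, List.append_assoc, List.take_append_of_le_length (by omega), ih h1,
        nodeStr_cons hne, List.take_append_of_le_length (by omega)]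

/-- The final value of a node with right certificates, and the start of its successors, is in
the tree. -/
theorem start_mem_treeAt {q ρ : List ℕ} {x : ℕ} (h : IsTrue p X q)
    (hx : (nodeStr q).length % 4 = 2 → x ≤ 1) (hρ : ρ <+: start (limDat p X q) x)
    (hl : p.1 < ρ.length) : ∃ s, ρ ∈ treeAt p X s := by
  obtain ⟨s, ⟨h1, -, -, h3⟩, h4⟩ :=
    ((eventually_settled p X q).and (eventually_gt_atTop (encode ρ))).exists
  have h5 := supported_start h1 (h.alive h1.le) hx
  rw [h3 _ le_rfl] at h5
  exact ⟨s, h5.1 ρ hρ hl h4⟩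

theorem limVal_prefix_start (q : List ℕ) (x : ℕ) :
    limVal p X q ++ [x] <+: start (limDat p X q) x := by
  obtain ⟨s, -, -, h2, h3⟩ := (eventually_settled p X q).exists
  have := h2.prefix_start x
  rwa [h3 _ le_rfl] at this

theorem limVal_mem {q : List ℕ} (h : IsTrue p X q) (hb : (nodeStr q).take p.1 ∈ base p X) :
    limVal p X q ∈ lowerTree p X :=
  ⟨by rwa [take_limVal h], fun hl => start_mem_treeAt h (fun _ => Nat.zero_le 1)
    ((List.prefix_append _ _).trans (limVal_prefix_start q 0)) hl⟩

theorem nodeMap_mem_lowerTree {σ τ : List ℕ} (h : τ ∈ nodeMap p X σ) : τ ∈ lowerTree p X := by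
  obtain ⟨h1, q, h2, rfl, rfl⟩ := mem_nodeMap.1 h
  exact limVal_mem h2 h1.1

theorem mem_nodeMap_of_le {σ : List ℕ} (h : σ ∈ base p X) (hl : σ.length ≤ p.1) :
    σ ∈ nodeMap p X σ := by
  have h1 : IsTrue p X [encode σ] := isTrue_singleton.2 (by rwa [ofNat_encode])
  exact mem_nodeMap.2 ⟨(mem_upperTree_of_le hl).2 h, [encode σ], h1,
    by rw [nodeStr_singleton, ofNat_encode], by rw [limVal_singleton h1, ofNat_encode]⟩

theorem BaseOk.branches (h : BaseOk p X) : Branches (nodeMap p X) := by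
  intro σ x τ' hτ
  obtain ⟨h1, q, h2, h3, h4⟩ := mem_nodeMap.1 hτ
  have hσ := h.isTree_upperTree _ _ (List.prefix_append _ _) h1
  cases q with
  | nil => exact absurd rfl h2.ne_nil
  | cons y q =>
    by_cases hne : q = []
    · subst hne
      have hl := isTrue_singleton.1 h2
      rw [nodeStr_singleton] at h3
      rw [limVal_singleton h2, h3] at h4
      rw [h3] at hl
      have hl' : σ.length ≤ p.1 := by simp at hl; omega
      exact ⟨σ, mem_nodeMap_of_le ((mem_upperTree_of_le hl').1 hσ) hl', h4 ▸ List.prefix_refl _⟩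
    · rw [nodeStr_cons hne] at h3
      obtain ⟨h5, h6⟩ := List.append_inj' h3 rfl
      have h6 : y.unpair.1 = x := by simpa using h6
      exact ⟨limVal p X q, mem_nodeMap.2 ⟨hσ, q, ((isTrue_cons hne).1 h2).1, h5, rfl⟩,
        h6 ▸ h4 ▸ limVal_concat_prefix hne⟩

/-! ### Paths -/

/-- Initial segments of paths through the tree are extended by values of living nodes at
arbitrarily late stages. -/
theorem exists_alive_of_path {f : ℕ → ℕ} (hf : f ∈ paths (lowerTree p X)) (N : ℕ) :
    ∃ s ≥ N, ∃ j, encode j < s ∧ Alive p (initSeg X s) j ∧ initSeg f N <+: (dat p X s j).v := by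
  obtain ⟨n, hn, hm⟩ : ∃ n, N + p.1 + 1 < n ∧ n % 4 ≠ 3 :=
    ⟨4 * (N + p.1 + 1), by omega, by omega⟩
  obtain ⟨s, hs⟩ := (hf n).2 (by rw [length_initSeg]; omega)
  obtain ⟨-, -, -, h1⟩ := mem_treeAt_iff.1 hs
  have hle := length_le_encode (initSeg f n)
  rw [length_initSeg] at h1 hle
  rcases h1 with ⟨h1, -⟩ | ⟨-, h1 | ⟨k, hk, ha, h1⟩⟩
  · exact absurd h1 hm
  · omega
  · rw [length_state] at hk
    refine ⟨encode (initSeg f n), by omega, ofNat (List ℕ) k, by rwa [encode_ofNat], ha, ?_⟩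
    rw [dat, encode_ofNat]
    rcases h1 with h1 | h1
    · rw [← h1]
      refine (isInit_initSeg f N).prefix_of_le ((isInit_initSeg f n).of_prefix
        (List.dropLast_prefix _)) ?_
      rw [List.length_dropLast, length_initSeg, length_initSeg]; omega
    · exact (initSeg_prefix f (by omega)).trans h1

/-- If the final value of a node with right certificates is an initial segment of a path through
the tree, then this is so for one of its successors. The reason is that the number that a
successor puts after its start determines the successor. -/
theorem exists_child_of_path {f : ℕ → ℕ} (hf : f ∈ paths (lowerTree p X)) {q : List ℕ}
    (hq : IsTrue p X q) (hl : p.1 ≤ (nodeStr q).length) (hqf : IsInit (limVal p X q) f) :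
    ∃ y, IsTrue p X (y :: q) ∧ IsInit (limVal p X (y :: q)) f := by
  have hne := hq.ne_nil
  obtain ⟨s₀, hs₀⟩ := eventually_atTop.1 (eventually_settled p X q)
  set P := (evade (start (limDat p X q) (f (limVal p X q).length))).length with hP
  have hvP : (limVal p X q).length < P := by
    have h1 := (limVal_prefix_start (p := p) (X := X) q (f (limVal p X q).length)).length_le
    have h2 := (evade_prefix (start (limDat p X q) (f (limVal p X q).length))).length_le
    rw [List.length_append, List.length_singleton] at h1
    omega
  -- the successor below a value that extends `f` up to `P`
  have key : ∀ N, P < N → s₀ ≤ N → ∃ s ≥ N, ∃ y, encode (y :: q) < s ∧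
      encode (y :: q) = (f P).unpair.1 ∧ Alive p (initSeg X s) (y :: q) ∧
      ∃ τ, initSeg f N <+: τ ∧ (dat p X s (y :: q)).v <+: τ := by
    intro N hPN hN
    obtain ⟨s, hs, j, hj, ha, hfj⟩ := exists_alive_of_path hf N
    obtain ⟨hqs, -, -, hlim⟩ := hs₀ s (by omega)
    have hlv := length_le_limVal (p := p) (X := X) q
    have hjl : N ≤ (dat p X s j).v.length := by simpa [length_initSeg] using hfj.length_le
    have hqj : q <:+ j := by
      refine suffix_of_v_prefix hqs hj (hq.alive hqs.le) ha hl (by omega) ?_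
      rw [hlim q le_rfl]
      exact (hqf.prefix_initSeg (by omega)).trans hfj
    have hne' : q ≠ j := by
      rintro rfl
      rw [hlim q le_rfl] at hjl
      change N ≤ (limVal p X q).length at hjl
      omega
    obtain ⟨y, hy⟩ := exists_cons_suffix hqj hne'
    have hys := (encode_le_of_suffix hy).trans_lt hj
    have hvj := v_prefix_of_suffix (p := p) (X := X) hy (by simp) hj
    have hv₀ := (nodeInv (p := p) (X := X) hys).le.trans hvj
    refine ⟨s, hs, y, hys, ?_, ha.of_suffix hy (by simp), _, hfj, hvj⟩
    have hx : f (limVal p X q).length = y.unpair.1 := by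
      have h1 := (v_concat_prefix_child (p := p) (X := X) hys hne).trans hv₀
      rw [hlim q le_rfl] at h1
      have h2 := (hqf.concat.prefix_initSeg (n := N) (by
        rw [List.length_append, List.length_singleton]; omega)).trans hfj
      exact concat_prefix_inj h2 h1
    obtain ⟨c, hc, -⟩ := v_concat_prefix_v₀ (p := p) (X := X) hys hne
    rw [hlim q le_rfl, ← hx] at hc
    have h3 := hc.trans hv₀
    have h4 : evade (start (limDat p X q) (f (limVal p X q).length)) ++
        [Nat.pair (encode (y :: q)) c] <+: initSeg f N :=
      List.prefix_of_prefix_length_le h3 hfj (by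
        rw [List.length_append, List.length_singleton, length_initSeg]; omega)
    have h5 := ((isInit_initSeg f N).of_prefix h4).eq_concat
    rw [← hP] at h5
    rw [h5, Nat.unpair_pair]
  obtain ⟨s₁, hs₁, y, -, hy, -, -⟩ := key (max (P + 1) s₀) (by omega) (by omega)
  have hyt : IsTrue p X (y :: q) := isTrue_of_frequently fun N => by
    obtain ⟨s, hs, y', -, hy', ha, -⟩ := key (max N (max (P + 1) s₀)) (by omega) (by omega)
    rw [encode_injective (hy'.trans hy.symm)] at ha
    exact ⟨s, by omega, ha⟩
  refine ⟨y, hyt, ?_⟩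
  obtain ⟨s₂, hs₂⟩ := eventually_atTop.1 (eventually_settled p X (y :: q))
  obtain ⟨s, hs, y', -, hy', -, τ, h1, h2⟩ :=
    key (max (max s₂ (limVal p X (y :: q)).length) (max (P + 1) s₀)) (by omega) (by omega)
  rw [encode_injective (hy'.trans hy.symm), (hs₂ s (by omega)).2.2.2 _ le_rfl] at h2
  exact (isInit_initSeg f _).of_prefix (List.prefix_of_prefix_length_le h2 h1 (by
    rw [length_initSeg]; exact (le_max_right _ _).trans (le_max_left _ _)))

/-- A path through the tree extends the final values of nodes with right certificates for strings of
all lengths. -/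
theorem exists_node_of_path {f : ℕ → ℕ} (hf : f ∈ paths (lowerTree p X)) (n : ℕ) :
    ∃ q, IsTrue p X q ∧ (nodeStr q).length = n ∧ IsInit (limVal p X q) f := by
  have h0 : ∀ n ≤ p.1, ∃ q, IsTrue p X q ∧ (nodeStr q).length = n ∧ IsInit (limVal p X q) f := by
    intro n hn
    have h : IsTrue p X [encode (initSeg f n)] :=
      isTrue_singleton.2 (by rwa [ofNat_encode, length_initSeg])
    refine ⟨_, h, by rw [nodeStr_singleton, ofNat_encode, length_initSeg], ?_⟩
    rw [limVal_singleton h, ofNat_encode]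
    exact isInit_initSeg f n
  rcases le_total n p.1 with hn | hn
  · exact h0 n hn
  · induction n, hn using Nat.le_induction with
    | base => exact h0 _ le_rfl
    | succ n hn ih =>
      obtain ⟨q, h1, h2, h3⟩ := ih
      obtain ⟨y, h4, h5⟩ := exists_child_of_path hf h1 (by omega) h3
      exact ⟨y :: q, h4, by rw [length_nodeStr_cons h1.ne_nil, h2], h5⟩

theorem mem_upperTree_of_path {f : ℕ → ℕ} (hf : f ∈ paths (lowerTree p X)) {q : List ℕ}
    (hq : IsTrue p X q) (hqf : IsInit (limVal p X q) f) : nodeStr q ∈ upperTree p X := by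
  refine ⟨?_, fun n hn hn' => hq.good hn hn'⟩
  have h1 := hf (limVal p X q).length
  have h2 : limVal p X q ∈ lowerTree p X := hqf ▸ h1
  rw [← take_limVal hq]
  exact h2.1

theorem BaseOk.exists_homeo (h : BaseOk p X) :
    ∃ H : paths (upperTree p X) ≃ₜ paths (lowerTree p X),
      ∀ f : paths (upperTree p X), MapsReal (nodeMap p X) (f : ℕ → ℕ) (H f : ℕ → ℕ) := by
  refine h.branches.exists_homeomorph (fun f hf n => nodeMap_dom.2 (hf n)) (fun f hf g hg n => ?_)
    fun g hg => ?_
  · obtain ⟨τ, h1, h2⟩ := h.branches.mapsReal_iff.1 hg n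
    have h3 := h.branches.length_le h1
    rw [length_initSeg] at h3
    exact h.isTree_lowerTree _ _ ((isInit_initSeg g n).prefix_of_le h2 (by rwa [length_initSeg]))
      (nodeMap_mem_lowerTree h1)
  · obtain ⟨f, hf⟩ := h.branches.exists_mapsReal (g := g) fun n => by
      obtain ⟨q, h1, h2, h3⟩ := exists_node_of_path hg n
      exact ⟨nodeStr q, h2, _, mem_nodeMap.2 ⟨mem_upperTree_of_path hg h1 h3, q, h1, rfl, rfl⟩, h3⟩
    refine ⟨f, fun n => ?_, hf⟩
    obtain ⟨τ, h1, -⟩ := h.branches.mapsReal_iff.1 hf n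
    exact (mem_nodeMap.1 h1).1

/-! ### Generic paths -/

theorem mem_lowerTree_above {q τ : List ℕ} (hl : p.1 < (nodeStr q).length)
    (h : limVal p X q <+: τ) (hτ : τ ∈ lowerTree p X) : ∃ s, τ ∈ treeAt p X s :=
  hτ.2 (hl.trans_le ((length_le_limVal q).trans h.length_le))

theorem eventually_mem_treeAt {τ : List ℕ} (h : ∃ s, τ ∈ treeAt p X s) :
    ∀ᶠ s in atTop, τ ∈ treeAt p X s := by
  obtain ⟨s, hs⟩ := h
  exact eventually_atTop.2 ⟨s, fun t ht => treeAt_mono ht hs⟩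

theorem eventually_phiVal_isSome {i n : ℕ} (h : (Phi i X n).Dom) :
    ∀ᶠ s in atTop, (phiVal i (initSeg X s) n).isSome := by
  obtain ⟨s, hs⟩ := Phi_dom_iff.1 h
  exact eventually_atTop.2 ⟨s, fun t ht => phiVal_isSome_mono (initSeg_prefix X ht) hs⟩

/-- A node for a string of length `3` modulo `4` settles whether the r.e. set with the index of
the node is met. -/
theorem meets_or_avoids {q : List ℕ} (hl : p.1 < (nodeStr q).length)
    (hm : (nodeStr q).length % 4 = 3) :
    (∃ τ, τ <+: limVal p X q ∧ (Phi ((nodeStr q).length / 4).unpair.1 X (encode τ)).Dom) ∨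
    ∀ τ ∈ lowerTree p X, limVal p X q <+: τ →
      ¬ (Phi ((nodeStr q).length / 4).unpair.1 X (encode τ)).Dom := by
  obtain ⟨s₀, hs₀⟩ := eventually_atTop.1 (eventually_settled p X q)
  by_cases h0 : (limDat p X q).phase = 0
  · right
    intro τ hτ hq hd
    obtain ⟨s, hs, h1, h2⟩ := ((eventually_ge_atTop s₀).and
      ((eventually_mem_treeAt (mem_lowerTree_above hl hq hτ)).and
        (eventually_phiVal_isSome hd))).exists
    obtain ⟨h3, h4, -, h5⟩ := hs₀ s hs
    have h6 := want_serve_none (h4 q (Nat.lt_succ_self _) h3) hl (by omega)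
      (by rwa [h5 _ le_rfl]) τ h1
    rw [h5 _ le_rfl] at h6
    exact h6 ⟨hq, Or.inl ⟨hm, h2⟩⟩
  · left
    obtain ⟨-, -, h1, h2⟩ := hs₀ s₀ le_rfl
    have := h1.meets (by rwa [h2 _ le_rfl]) hm
    rwa [h2 _ le_rfl] at this

/-- The second component of the code `⟨i, l⟩` only serves to find a requirement for the `i`-th r.e.
set at a length above `l`. -/
theorem meets_or_stronglyAvoids {g : ℕ → ℕ} (hg : g ∈ paths (lowerTree p X)) {W : Set (List ℕ)}
    (hW : REIn X W) : Meets g W ∨ StronglyAvoids g W (lowerTree p X) := by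
  obtain ⟨i, hi⟩ := hW
  have hn : (4 * Nat.pair i p.1 + 3) / 4 = Nat.pair i p.1 := by omega
  have hle := Nat.right_le_pair i p.1
  obtain ⟨q, h1, h2, h3⟩ := exists_node_of_path hg (4 * Nat.pair i p.1 + 3)
  have h4 := meets_or_avoids (p := p) (X := X) (q := q) (by omega) (by omega)
  rw [h2, hn, Nat.unpair_pair] at h4
  rcases h4 with ⟨τ, h5, h6⟩ | h5
  · exact Or.inl ⟨τ, (hi τ).2 h6, h3.of_prefix h5⟩
  · exact Or.inr ⟨_, h3, fun τ h6 h7 => h5 τ h7.1 h6 ((hi τ).1 h7.2)⟩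

/-- The tree branches above each initial segment of a path, because it is nice. Hence a path does
not strongly avoid the set of the strings that are not on the path. -/
theorem BaseOk.not_stronglyAvoids (h : BaseOk p X) {g : ℕ → ℕ} (hg : g ∈ paths (lowerTree p X)) :
    ¬ StronglyAvoids g {σ | ¬ IsInit σ g} (lowerTree p X) := by
  rintro ⟨σ, hσ, h1⟩
  set n := 4 * σ.length + 2 with hn
  have h2 : ∀ x ≤ 1, initSeg g n ++ [x] ∈ lowerTree p X := fun x hx =>
    (h.isNice_lowerTree _ x (by rw [List.length_append, length_initSeg, List.length_singleton]; omega)).2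
      ⟨hg n, by omega⟩
  have h3 : ∀ x ≤ 1, g n = x := fun x hx => by
    have h4 : IsInit (initSeg g n ++ [x]) g := by
      by_contra hc
      exact h1 _ ((hσ.prefix_initSeg (by omega)).trans (List.prefix_append _ _)) ⟨h2 x hx, hc⟩
    simpa [length_initSeg] using h4.eq_concat
  have h4 := h3 0 (by omega)
  have h5 := h3 1 (by omega)
  omega

/-! ### Splitting -/

theorem start_prefix_limVal {y : ℕ} {q : List ℕ} (hne : q ≠ []) :
    start (limDat p X q) y.unpair.1 <+: limVal p X (y :: q) := by
  obtain ⟨s, h1, -, h2, h3⟩ := (eventually_settled p X (y :: q)).exists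
  obtain ⟨c, h4, -⟩ := v_concat_prefix_v₀ (p := p) (X := X) h1 hne
  have h5 := ((evade_prefix _).trans (List.prefix_append _ _)).trans (h4.trans h2.le)
  rwa [h3 _ le_rfl, h3 _ (encode_tail_lt y q).le] at h5

theorem exists_mem_nodeMap_concat {q : List ℕ} {x : ℕ} (hq : IsTrue p X q)
    (hl : p.1 ≤ (nodeStr q).length) (h : nodeStr q ++ [x] ∈ upperTree p X) :
    ∃ τ ∈ nodeMap p X (nodeStr q ++ [x]), start (limDat p X q) x <+: τ := by
  obtain ⟨q', h1, h2⟩ := exists_isTrue h.2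
  cases q' with
  | nil => exact absurd rfl h1.ne_nil
  | cons y q' =>
    have hne : q' ≠ [] := by
      rintro rfl
      have := isTrue_singleton.1 h1
      rw [← nodeStr_singleton, h2] at this
      simp at this; omega
    have h3 := h2
    rw [nodeStr_cons hne] at h3
    obtain ⟨h4, h5⟩ := List.append_inj' h3 rfl
    have h5 : y.unpair.1 = x := by simpa using h5
    have h6 := ((isTrue_cons hne).1 h1).1.unique hq h4
    subst h6
    exact ⟨_, mem_nodeMap.2 ⟨h, _, h1, h2, rfl⟩, h5 ▸ start_prefix_limVal hne⟩

/-- If the node has no splitting pair in the end, then either no pair splits above its value, or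
the node has moved to where all extensions compute the same string. -/
theorem nodeMap_splitting {i : ℕ} (hn : IsNice (upperTree p X)) (hi : p.1 < 4 * i + 2)
    {σ : List ℕ} (hσ : σ ∈ upperTree p X) (hl : σ.length = 4 * i + 2) :
    (∃ τ₀ ∈ nodeMap p X (σ ++ [0]), ∃ τ₁ ∈ nodeMap p X (σ ++ [1]), Splitting i X τ₀ τ₁) ∨
    ∃ ρ ∈ nodeMap p X σ, ∀ τ₀ ∈ lowerTree p X, ∀ τ₁ ∈ lowerTree p X, ρ <+: τ₀ → ρ <+: τ₁ →
      ¬ Splitting i X τ₀ τ₁ := by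
  obtain ⟨q, hq, rfl⟩ := exists_isTrue hσ.2
  have hi4 : (nodeStr q).length / 4 = i := by omega
  obtain ⟨s₀, hs₀⟩ := eventually_atTop.1 (eventually_settled p X q)
  obtain ⟨-, -, hI, hlim⟩ := hs₀ s₀ le_rfl
  have hph := hI.phase_le
  by_cases h2 : (limDat p X q).phase = 2
  · left
    obtain ⟨-, -, -, -, hs⟩ := hI.phase2 (by rwa [hlim _ le_rfl])
    rw [hlim _ le_rfl, hi4] at hs
    obtain ⟨τ₀, h3, h4⟩ := exists_mem_nodeMap_concat hq (by omega)
      ((hn (nodeStr q) 0 (by simp; omega)).2 ⟨hσ, Or.inl rfl⟩)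
    obtain ⟨τ₁, h5, h6⟩ := exists_mem_nodeMap_concat hq (by omega)
      ((hn (nodeStr q) 1 (by simp; omega)).2 ⟨hσ, Or.inr rfl⟩)
    exact ⟨τ₀, h3, τ₁, h5, hs.mono h4 h6⟩
  · right
    refine ⟨_, mem_nodeMap.2 ⟨hσ, q, hq, rfl, rfl⟩, fun τ₀ m0 τ₁ m1 p0 p1 hs => ?_⟩
    obtain ⟨s, hs', h3, h4⟩ := ((eventually_ge_atTop s₀).and
      ((eventually_mem_treeAt (mem_lowerTree_above (by omega) p0 m0)).and
        (eventually_mem_treeAt (mem_lowerTree_above (by omega) p1 m1)))).exists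
    obtain ⟨h5, h6, h7, h8⟩ := hs₀ s hs'
    obtain ⟨-, hA, hB⟩ := want_split_none (h6 q (Nat.lt_succ_self _) h5) (by omega) (by omega)
      (by rwa [h8 _ le_rfl])
    rw [h8 _ le_rfl, hi4] at hA hB
    by_cases h0 : (limDat p X q).phase = 0
    · have h9 := congrArg NodeData.v (h7.phase0 (by rwa [h8 _ le_rfl]))
      rw [h8 _ le_rfl] at h9
      change limVal p X q = (limDat p X q).v₀ at h9
      exact hA h0 τ₀ h3 τ₁ h4 (h9 ▸ p0) (h9 ▸ p1) hs
    · have hc : ∀ τ, limVal p X q <+: τ → τ ∈ treeAt p X s → phiOn i X τ = phiOn i X (limVal p X q) :=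
        fun τ hτ hm => ((phiOn_mono hτ).eq_of_length_le (hB h0 τ hm hτ)).symm
      have : Incompat (phiOn i X τ₀) (phiOn i X τ₁) := hs
      rw [hc τ₀ p0 h3, hc τ₁ p1 h4] at this
      exact this.1 (List.prefix_refl _)

/-! ### Incomparable paths -/

/-- Among the nodes with final values on the path `f`, there are two consecutive ones such that the
first has a code below `N` and the second one does not. -/
theorem exists_crossing {f : ℕ → ℕ} (hf : f ∈ paths (lowerTree p X)) {N : ℕ}
    (hN : encode [encode (initSeg f p.1)] < N) :
    ∃ y q, q ≠ [] ∧ encode q < N ∧ N ≤ encode (y :: q) ∧ IsInit (limVal p X (y :: q)) f := by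
  by_contra hc
  push Not at hc
  have key : ∀ n, ∃ q, n ≤ encode q ∧ encode q < N ∧ IsTrue p X q ∧ p.1 ≤ (nodeStr q).length ∧
      IsInit (limVal p X q) f := by
    intro n
    induction n with
    | zero =>
      have h : IsTrue p X [encode (initSeg f p.1)] :=
        isTrue_singleton.2 (by rw [ofNat_encode, length_initSeg])
      refine ⟨_, Nat.zero_le _, hN, h, by rw [nodeStr_singleton, ofNat_encode, length_initSeg], ?_⟩
      rw [limVal_singleton h, ofNat_encode]
      exact isInit_initSeg f _
    | succ n ih =>
      obtain ⟨q, h1, h2, h3, h4, h5⟩ := ih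
      obtain ⟨y, h6, h7⟩ := exists_child_of_path hf h3 h4 h5
      have h8 := encode_tail_lt y q
      refine ⟨y :: q, by omega, ?_, h6, by rw [length_nodeStr_cons h3.ne_nil]; omega, h7⟩
      by_contra hle
      exact hc y q h3.ne_nil h2 (not_lt.1 hle) h7
  obtain ⟨q, h1, h2, -⟩ := key N
  omega

theorem length_nodeStr_le {q : List ℕ} (h : IsTrue p X q) :
    (nodeStr q).length ≤ p.1 + q.length := by
  induction q with
  | nil => exact absurd rfl h.ne_nil
  | cons y q ih =>
    by_cases hne : q = []
    · subst hne
      have := isTrue_singleton.1 h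
      rw [nodeStr_singleton]; omega
    · have := ih ((isTrue_cons hne).1 h).1
      rw [length_nodeStr_cons hne, List.length_cons]; omega

/-- No path `g` is computable from another path `h` and `X`. Let `q` be the node for this requirement
on the path `h`. The path `g` passes from a node `j` with smaller code to a successor with larger
code, whose initial value has a new number just after the start given by `j`. If `q` has acted,
then its computation reaches this place with a value that is below the stage of the action, while
the new number is at least that stage. If `q` has not acted, then it could do so, as `h` computes
arbitrarily long initial segments of `g`. -/
theorem not_reducible {g h : ℕ → ℕ} (hg : g ∈ paths (lowerTree p X))
    (hh : h ∈ paths (lowerTree p X)) (hne : g ≠ h) (i : ℕ) :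
    ¬ ∀ n, g n ∈ Phi i (join h X) n := by
  intro hred
  obtain ⟨d, hd⟩ := Function.ne_iff.1 hne
  set n := 4 * Nat.pair i (d + p.1 + encode [encode (initSeg g p.1)] + 1) with hn
  have hle := Nat.right_le_pair i (d + p.1 + encode [encode (initSeg g p.1)] + 1)
  obtain ⟨q, hq, hql, hqh⟩ := exists_node_of_path hh n
  have hn4 : ((nodeStr q).length / 4).unpair.1 = i := by
    rw [hql, hn, Nat.mul_div_cancel_left _ (by omega), Nat.unpair_pair]
  have hcode : encode [encode (initSeg g p.1)] < encode q := by
    have h1 := length_le_encode q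
    have h2 := length_nodeStr_le hq
    omega
  obtain ⟨y, j, hj, hjq, hqj, hyg⟩ := exists_crossing hg hcode
  have hlt : encode q < encode (y :: j) := by
    refine lt_of_le_of_ne hqj fun he => hd ?_
    rw [← encode_injective he] at hyg
    have h1 : d < (limVal p X q).length := by
      have := length_le_limVal (p := p) (X := X) q; omega
    rw [isInit_iff.1 hyg d _ (List.getElem?_eq_getElem h1),
      isInit_iff.1 hqh d _ (List.getElem?_eq_getElem h1)]
  obtain ⟨s₀, hs₀⟩ := eventually_atTop.1 (eventually_settled p X (y :: j))
  obtain ⟨hjs, hquiet, hI, hlim⟩ := hs₀ s₀ le_rfl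
  by_cases h0 : (limDat p X q).phase = 0
  · -- the path `h` computes long initial segments of `g`
    set B := lengthBound (state p X s₀).2 (encode q) with hB
    obtain ⟨M, hM⟩ := exists_prefix_phiOn hred B
    set τ := initSeg h (max M (limVal p X q).length) with hτ
    have hτq : limVal p X q <+: τ := hqh.prefix_initSeg (le_max_right _ _)
    have hmem := eventually_mem_treeAt
      (mem_lowerTree_above (by omega) hτq (hh (max M (limVal p X q).length)))
    obtain ⟨s, hs, h1, h2⟩ := ((eventually_ge_atTop s₀).and (hmem.and
      (eventually_gt_atTop (encode (phiOn i X τ))))).exists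
    obtain ⟨h3, h4, -, h5⟩ := hs₀ s hs
    refine want_serve_none (h4 q (by omega) (by omega)) (by omega) (by omega)
      (by rwa [h5 _ hlt.le]) τ h1 ?_
    rw [h5 _ hlt.le]
    refine ⟨hτq, Or.inr ⟨by omega, ?_, ?_⟩⟩
    · rw [hn4, phiOnStr_of_mem h1]
      have h6 := (hM _ (le_max_left M (limVal p X q).length)).length_le
      rw [length_initSeg] at h6
      have h7 : lengthBound (state p X s).2 (encode q) = B := by
        rw [hB, lengthBound, lengthBound]
        congr 2
        refine congrArg _ (List.ext_getElem ?_ fun k hk hk' => ?_)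
        · rw [List.length_take, List.length_take, length_state, length_state]; omega
        · rw [List.length_take] at hk hk'
          rw [List.getElem_take, List.getElem_take]
          have h8 := h5 (ofNat (List ℕ) k) (by rw [encode_ofNat]; omega)
          rw [← hlim (ofNat (List ℕ) k) (by rw [encode_ofNat]; omega), dat, dat, encode_ofNat,
            List.getD_eq_getElem _ _ (by omega), List.getD_eq_getElem _ _ (by omega)] at h8
          exact h8
      rw [h7]; exact h6
    · rw [hn4, phiOnStr_of_mem h1, length_initSeg]
      intro a ha
      have := lt_encode_of_mem ha
      omega
  · obtain ⟨u, hu, hnq, τ, hτ, hlen, hent⟩ :=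
      (nodeInv (p := p) (X := X) (hlt.trans hjs)).long (by rwa [hlim _ hlt.le]) (by omega)
    rw [hlim _ hlt.le] at hτ
    rw [hn4] at hlen hent
    obtain ⟨c, hc, hcu⟩ := v_concat_prefix_v₀ (p := p) (X := X) hjs hj
    have huc := hcu u hu fun hq' => hnq (hq'.mono hlt)
    have hg1 := (hI.le.trans (hlim _ le_rfl ▸ List.prefix_refl _ :
      (dat p X s₀ (y :: j)).v <+: limVal p X (y :: j)))
    have hg2 := (hyg.of_prefix (hc.trans hg1)).eq_concat
    have hΦ := isInit_phiOn hred (hqh.of_prefix hτ)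
    obtain ⟨hb0, hb1⟩ := hlen j hjq
    have hP : (evade (start (dat p X s₀ j) y.unpair.1)).length < (phiOn i X τ).length := by
      have h1 := length_evade_le (start (dat p X s₀ j) y.unpair.1)
      have h2 : (start (dat p X s₀ j) y.unpair.1).length ≤ (dat p X s₀ j).b₀.length ∨
          (start (dat p X s₀ j) y.unpair.1).length ≤ (dat p X s₀ j).b₁.length := by
        rw [start]
        split_ifs
        · exact Or.inl le_rfl
        · exact Or.inr le_rfl
        · left
          have := (nodeInv (p := p) (X := X) ((encode_tail_lt y j).trans hjs)).b₀.length_le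
          simpa using this
      omega
    have h1 := isInit_iff.1 hΦ _ _ (List.getElem?_eq_getElem hP)
    have h2 := hent _ (List.getElem_mem hP)
    rw [← h1, hg2] at h2
    have h3 := Nat.right_le_pair (encode (y :: j)) c
    omega

end
end Pulldown

namespace Pulldown

open Encodable Denumerable

/-! ### Primitive recursive functions in compositional form

The closure properties of primitive recursive functions and predicates, stated for functions of
one variable, so that `fun_prop` can combine them. -/

attribute [fun_prop] Primrec PrimrecPred Primrec.id Primrec.const

section
variable {α β γ : Type*} [Primcodable α] [Primcodable β] [Primcodable γ]

@[fun_prop] theorem primrec_comp {f : β → γ} {g : α → β} (hf : Primrec f) (hg : Primrec g) :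
    Primrec fun a => f (g a) := hf.comp hg

@[fun_prop] theorem primrec_fst {f : α → β × γ} (hf : Primrec f) : Primrec fun a => (f a).1 :=
  Primrec.fst.comp hf

@[fun_prop] theorem primrec_snd {f : α → β × γ} (hf : Primrec f) : Primrec fun a => (f a).2 :=
  Primrec.snd.comp hf

@[fun_prop] theorem primrec_mk {f : α → β} {g : α → γ} (hf : Primrec f) (hg : Primrec g) :
    Primrec fun a => (f a, g a) := hf.pair hg

@[fun_prop] theorem primrec_add {f g : α → ℕ} (hf : Primrec f) (hg : Primrec g) :
    Primrec fun a => f a + g a := Primrec.nat_add.comp hf hg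

@[fun_prop] theorem primrec_sub {f g : α → ℕ} (hf : Primrec f) (hg : Primrec g) :
    Primrec fun a => f a - g a := Primrec.nat_sub.comp hf hg

@[fun_prop] theorem primrec_mul {f g : α → ℕ} (hf : Primrec f) (hg : Primrec g) :
    Primrec fun a => f a * g a := Primrec.nat_mul.comp hf hg

@[fun_prop] theorem primrec_div {f g : α → ℕ} (hf : Primrec f) (hg : Primrec g) :
    Primrec fun a => f a / g a := Primrec.nat_div.comp hf hg

@[fun_prop] theorem primrec_mod {f g : α → ℕ} (hf : Primrec f) (hg : Primrec g) :
    Primrec fun a => f a % g a := Primrec.nat_mod.comp hf hg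

@[fun_prop] theorem primrec_pair {f g : α → ℕ} (hf : Primrec f) (hg : Primrec g) :
    Primrec fun a => Nat.pair (f a) (g a) := Primrec₂.natPair.comp hf hg

@[fun_prop] theorem primrec_unpair {f : α → ℕ} (hf : Primrec f) :
    Primrec fun a => (f a).unpair := Primrec.unpair.comp hf

@[fun_prop] theorem primrec_encode {f : α → β} (hf : Primrec f) :
    Primrec fun a => encode (f a) := Primrec.encode.comp hf

@[fun_prop] theorem primrec_ofNat {δ : Type*} [Denumerable δ] {f : α → ℕ} (hf : Primrec f) :
    Primrec fun a => ofNat δ (f a) := (Primrec.ofNat δ).comp hf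

/-! #### Predicates -/

@[fun_prop] theorem primrecPred_le {f g : α → ℕ} (hf : Primrec f) (hg : Primrec g) :
    PrimrecPred fun a => f a ≤ g a := Primrec.nat_le.comp hf hg

@[fun_prop] theorem primrecPred_lt {f g : α → ℕ} (hf : Primrec f) (hg : Primrec g) :
    PrimrecPred fun a => f a < g a := Primrec.nat_lt.comp hf hg

@[fun_prop] theorem primrecPred_eq {f g : α → β} (hf : Primrec f) (hg : Primrec g) :
    PrimrecPred fun a => f a = g a := Primrec.eq.comp hf hg

@[fun_prop] theorem primrecPred_and {p q : α → Prop} (hp : PrimrecPred p) (hq : PrimrecPred q) :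
    PrimrecPred fun a => p a ∧ q a := hp.and hq

@[fun_prop] theorem primrecPred_or {p q : α → Prop} (hp : PrimrecPred p) (hq : PrimrecPred q) :
    PrimrecPred fun a => p a ∨ q a := hp.or hq

@[fun_prop] theorem primrecPred_not {p : α → Prop} (hp : PrimrecPred p) :
    PrimrecPred fun a => ¬ p a := hp.not

theorem primrecPred_imp {p q : α → Prop} (hp : PrimrecPred p) (hq : PrimrecPred q) :
    PrimrecPred fun a => p a → q a := (hp.not.or hq).of_eq fun _ => imp_iff_not_or.symm

@[fun_prop] theorem primrecPred_coe {f : α → Bool} (hf : Primrec f) :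
    PrimrecPred fun a => f a = true := Primrec.eq.comp hf (Primrec.const true)

@[fun_prop] theorem primrec_decide {p : α → Prop} [∀ a, Decidable (p a)] (hp : PrimrecPred p) :
    Primrec fun a => decide (p a) := hp.decide

@[fun_prop] theorem primrec_ite {c : α → Prop} [∀ a, Decidable (c a)] {f g : α → β}
    (hc : PrimrecPred c) (hf : Primrec f) (hg : Primrec g) :
    Primrec fun a => if c a then f a else g a := Primrec.ite hc hf hg

theorem primrecPred_forall_mem {L : α → List β} {P : α → β → Prop} (hL : Primrec L)
    (hP : PrimrecPred fun a : α × β => P a.1 a.2) : PrimrecPred fun a => ∀ b ∈ L a, P a b :=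
  (PrimrecRel.forall_mem_list (R := fun b a => P a b)
    (hP.comp (Primrec.snd.pair Primrec.fst))).comp hL Primrec.id

theorem primrecPred_exists_mem {L : α → List β} {P : α → β → Prop} (hL : Primrec L)
    (hP : PrimrecPred fun a : α × β => P a.1 a.2) : PrimrecPred fun a => ∃ b ∈ L a, P a b :=
  (PrimrecRel.exists_mem_list (R := fun b a => P a b)
    (hP.comp (Primrec.snd.pair Primrec.fst))).comp hL Primrec.id

theorem primrecPred_forall_lt {f : α → ℕ} {P : α → ℕ → Prop} (hf : Primrec f)
    (hP : PrimrecPred fun a : α × ℕ => P a.1 a.2) : PrimrecPred fun a => ∀ b < f a, P a b :=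
  (primrecPred_forall_mem (Primrec.list_range.comp hf) hP).of_eq fun a => by simp

theorem primrecPred_exists_lt {f : α → ℕ} {P : α → ℕ → Prop} (hf : Primrec f)
    (hP : PrimrecPred fun a : α × ℕ => P a.1 a.2) : PrimrecPred fun a => ∃ b < f a, P a b :=
  (primrecPred_exists_mem (Primrec.list_range.comp hf) hP).of_eq fun a => by simp

/-! #### Options -/

@[fun_prop] theorem primrec_isSome {f : α → Option β} (hf : Primrec f) :
    Primrec fun a => (f a).isSome := Primrec.option_isSome.comp hf

@[fun_prop] theorem primrec_some {f : α → β} (hf : Primrec f) : Primrec fun a => some (f a) :=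
  Primrec.option_some.comp hf

@[fun_prop] theorem primrec_getD {f : α → Option β} {g : α → β} (hf : Primrec f)
    (hg : Primrec g) : Primrec fun a => (f a).getD (g a) := Primrec.option_getD.comp hf hg

@[fun_prop] theorem primrec_option_map {f : α → Option β} {g : α → β → γ} (hf : Primrec f)
    (hg : Primrec fun a : α × β => g a.1 a.2) : Primrec fun a => (f a).map (g a) :=
  Primrec.option_map hf hg.to₂

@[fun_prop] theorem primrec_option_bind {f : α → Option β} {g : α → β → Option γ}
    (hf : Primrec f) (hg : Primrec fun a : α × β => g a.1 a.2) :
    Primrec fun a => (f a).bind (g a) := Primrec.option_bind hf hg.to₂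

@[fun_prop] theorem primrec_option_or {f g : α → Option β} (hf : Primrec f) (hg : Primrec g) :
    Primrec fun a => (f a).or (g a) :=
  (Primrec.option_orElse.comp hf hg).of_eq fun a => by cases f a <;> rfl

/-! #### Lists -/

@[fun_prop] theorem primrec_cons {f : α → β} {g : α → List β} (hf : Primrec f)
    (hg : Primrec g) : Primrec fun a => f a :: g a := Primrec.list_cons.comp hf hg

@[fun_prop] theorem primrec_append {f g : α → List β} (hf : Primrec f) (hg : Primrec g) :
    Primrec fun a => f a ++ g a := Primrec.list_append.comp hf hg

@[fun_prop] theorem primrec_length {f : α → List β} (hf : Primrec f) :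
    Primrec fun a => (f a).length := Primrec.list_length.comp hf

@[fun_prop] theorem primrec_take {f : α → List β} {g : α → ℕ} (hf : Primrec f)
    (hg : Primrec g) : Primrec fun a => (f a).take (g a) := Primrec.list_take.comp hg hf

@[fun_prop] theorem primrec_getElem? {f : α → List β} {g : α → ℕ} (hf : Primrec f)
    (hg : Primrec g) : Primrec fun a => (f a)[g a]? := Primrec.list_getElem?.comp hf hg

@[fun_prop] theorem primrec_list_getD {f : α → List β} {g : α → ℕ} {d : β} (hf : Primrec f)
    (hg : Primrec g) : Primrec fun a => (f a).getD (g a) d := (Primrec.list_getD d).comp hf hg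

@[fun_prop] theorem primrec_range {f : α → ℕ} (hf : Primrec f) :
    Primrec fun a => List.range (f a) := Primrec.list_range.comp hf

@[fun_prop] theorem primrec_map {f : α → List β} {g : α → β → γ} (hf : Primrec f)
    (hg : Primrec fun a : α × β => g a.1 a.2) : Primrec fun a => (f a).map (g a) :=
  Primrec.list_map hf hg.to₂

@[fun_prop] theorem primrec_filterMap {f : α → List β} {g : α → β → Option γ} (hf : Primrec f)
    (hg : Primrec fun a : α × β => g a.1 a.2) : Primrec fun a => (f a).filterMap (g a) :=
  Primrec.listFilterMap hf hg.to₂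

@[fun_prop] theorem primrec_flatMap {f : α → List β} {g : α → β → List γ} (hf : Primrec f)
    (hg : Primrec fun a : α × β => g a.1 a.2) : Primrec fun a => (f a).flatMap (g a) :=
  Primrec.list_flatMap hf hg.to₂

@[fun_prop] theorem primrec_findSome? {f : α → List β} {g : α → β → Option γ} (hf : Primrec f)
    (hg : Primrec fun a : α × β => g a.1 a.2) : Primrec fun a => (f a).findSome? (g a) :=
  (Primrec.list_head?.comp (primrec_filterMap hf hg)).of_eq fun _ => List.head?_filterMap

@[fun_prop] theorem primrec_find? {f : α → List β} {g : α → β → Bool} (hf : Primrec f)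
    (hg : Primrec fun a : α × β => g a.1 a.2) : Primrec fun a => (f a).find? (g a) := by
  refine (primrec_findSome? (g := fun a b => if g a b = true then some b else none) hf
    (by fun_prop)).of_eq fun a => ?_
  rw [List.find?_eq_findSome?_guard]
  rfl

@[fun_prop] theorem primrec_dropLast {f : α → List β} (hf : Primrec f) :
    Primrec fun a => (f a).dropLast :=
  (show Primrec fun a => (f a).take ((f a).length - 1) by fun_prop).of_eq fun _ =>
    List.dropLast_eq_take.symm

@[fun_prop] theorem primrec_getLastD {f : α → List β} {d : β} (hf : Primrec f) :
    Primrec fun a => (f a).getLastD d :=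
  (show Primrec fun a => (f a).getD ((f a).length - 1) d by fun_prop).of_eq fun a => by
    rw [List.getD_eq_getElem?_getD, ← List.getLast?_eq_getElem?, ← List.getLastD_eq_getLast?]

@[fun_prop] theorem primrec_sum {f : α → List ℕ} (hf : Primrec f) :
    Primrec fun a => (f a).sum :=
  (Primrec.list_foldr hf (Primrec.const 0)
    (show Primrec fun a : α × ℕ × ℕ => a.2.1 + a.2.2 by fun_prop).to₂).of_eq fun a => by
      rw [List.sum]

@[fun_prop] theorem primrec_replicate {f : α → ℕ} {g : α → β} (hf : Primrec f)
    (hg : Primrec g) : Primrec fun a => List.replicate (f a) (g a) :=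
  (show Primrec fun a => (List.range (f a)).map fun _ => g a by fun_prop).of_eq fun a => by simp

@[fun_prop] theorem primrecPred_mem {f : α → List β} {g : α → β} (hf : Primrec f)
    (hg : Primrec g) : PrimrecPred fun a => g a ∈ f a :=
  (primrecPred_exists_mem (P := fun a b => b = g a) hf (by fun_prop)).of_eq fun a => by simp

@[fun_prop] theorem primrecPred_prefix {f g : α → List β} (hf : Primrec f) (hg : Primrec g) :
    PrimrecPred fun a => f a <+: g a :=
  (show PrimrecPred fun a => f a = (g a).take (f a).length by fun_prop).of_eq fun _ =>
    List.prefix_iff_eq_take.symm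

theorem primrec_list_rec {f : α → List β} {g : α → γ} {h : α → β → List β → γ → γ}
    (hf : Primrec f) (hg : Primrec g)
    (hh : Primrec fun a : α × β × List β × γ => h a.1 a.2.1 a.2.2.1 a.2.2.2) :
    Primrec fun a => List.recOn (motive := fun _ => γ) (f a) (g a) fun b L c => h a b L c :=
  Primrec.list_rec hf hg hh.to₂

/-! ### The construction is primitive recursive -/

@[fun_prop] theorem primrec_probe {e k n : α → ℕ} {ρ : α → List ℕ} (he : Primrec e)
    (hρ : Primrec ρ) (hk : Primrec k) (hn : Primrec n) :
    Primrec fun a => probe (e a) (ρ a) (k a) (n a) :=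
  Nat.Partrec.Code.primrec_evaln.comp (show Primrec fun a =>
    (((k a).unpair.2, ofNat Nat.Partrec.Code (e a)),
      Nat.pair (encode ((ρ a).take (k a).unpair.1)) (n a)) by fun_prop)

@[fun_prop] theorem primrec_phiVal {e n : α → ℕ} {ρ : α → List ℕ} (he : Primrec e)
    (hρ : Primrec ρ) (hn : Primrec n) : Primrec fun a => phiVal (e a) (ρ a) (n a) := by
  unfold phiVal; fun_prop

@[fun_prop] theorem primrec_phiStr {e : α → ℕ} {ρ : α → List ℕ} (he : Primrec e)
    (hρ : Primrec ρ) : Primrec fun a => phiStr (e a) (ρ a) := by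
  have h1 : Primrec fun L : List (Option ℕ) => L.takeWhile Option.isSome :=
    Primrec.list_takeWhile Primrec.option_isSome
  unfold phiStr List.reduceOption
  fun_prop

theorem joinStr_getD (τ χ : List ℕ) : joinStr τ (fun n => χ.getD n 0) =
    (List.range (2 * τ.length)).map fun n =>
      if n % 2 = 0 then τ.getD (n / 2) 0 else χ.getD (n / 2) 0 := rfl

@[fun_prop] theorem primrec_phiOnStr {i : α → ℕ} {χ τ : α → List ℕ} (hi : Primrec i)
    (hχ : Primrec χ) (hτ : Primrec τ) : Primrec fun a => phiOnStr (i a) (χ a) (τ a) := by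
  unfold phiOnStr phiOn
  simp only [joinStr_getD]
  fun_prop

@[fun_prop] theorem primrec_jumpApprox {χ : α → List ℕ} (hχ : Primrec χ) :
    Primrec fun a => jumpApprox (χ a) := by
  unfold jumpApprox; fun_prop

@[fun_prop] theorem primrec_accept {e n : α → ℕ} {χ : α → List ℕ} (he : Primrec e)
    (hχ : Primrec χ) (hn : Primrec n) : Primrec fun a => accept (e a) (χ a) (n a) := by
  unfold accept firstProbe; fun_prop

@[fun_prop] theorem primrec_required {σ : α → List ℕ} (hσ : Primrec σ) :
    Primrec fun a => required (σ a) := by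
  unfold required; fun_prop

@[fun_prop] theorem primrec_certVal {p : α → Params} {χ σ : α → List ℕ} (hp : Primrec p)
    (hχ : Primrec χ) (hσ : Primrec σ) : Primrec fun a => certVal (p a) (χ a) (σ a) := by
  unfold certVal
  have h1 : PrimrecPred fun a => (σ a).length % 4 = 3 → (σ a).getLastD 0 ≤ 1 :=
    primrecPred_imp (by fun_prop) (by fun_prop)
  have h2 : PrimrecPred fun a => ∀ τ ∈ required (σ a), accept (p a).2.1 (χ a) (encode τ) ≠ 0 :=
    primrecPred_forall_mem (by fun_prop) (by fun_prop)
  fun_prop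

@[fun_prop] theorem primrecPred_certOk {p : α → Params} {χ σ : α → List ℕ} {c : α → ℕ}
    (hp : Primrec p) (hχ : Primrec χ) (hσ : Primrec σ) (hc : Primrec c) :
    PrimrecPred fun a => CertOk (p a) (χ a) (σ a) (c a) := by
  unfold CertOk
  have h1 : PrimrecPred fun a => ∀ u < (χ a).length + 1, c a ≤ u →
      certVal (p a) ((χ a).take u) (σ a) = certVal (p a) ((χ a).take (c a)) (σ a) :=
    primrecPred_forall_lt (by fun_prop) (primrecPred_imp (by fun_prop) (by fun_prop))
  have h2 : PrimrecPred fun a => ∀ d < c a, d + 1 = c a →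
      certVal (p a) ((χ a).take d) (σ a) ≠ certVal (p a) ((χ a).take (c a)) (σ a) :=
    primrecPred_forall_lt (by fun_prop) (primrecPred_imp (by fun_prop) (by fun_prop))
  fun_prop

@[fun_prop] theorem primrec_nodeStr {q : α → List ℕ} (hq : Primrec q) :
    Primrec fun a => nodeStr (q a) := by
  refine (primrec_list_rec (g := fun _ => []) (h := fun _ y L c => if L = [] then ofNat (List ℕ) y
    else c ++ [y.unpair.1]) hq (by fun_prop) (by fun_prop)).of_eq fun a => ?_
  induction q a with
  | nil => rfl
  | cons y L ih => rw [nodeStr]; simp only [ih]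

@[fun_prop] theorem primrecPred_alive {p : α → Params} {χ q : α → List ℕ} (hp : Primrec p)
    (hχ : Primrec χ) (hq : Primrec q) : PrimrecPred fun a => Alive (p a) (χ a) (q a) := by
  classical
  have h := primrec_list_rec (g := fun _ => false) (h := fun a y L c => if L = [] then
      decide ((ofNat (List ℕ) y).length ≤ (p a).1)
    else decide (c = true ∧ CertOk (p a) (χ a) (nodeStr (y :: L)) y.unpair.2)) hq (by fun_prop)
      (by fun_prop)
  refine (primrecPred_coe h).of_eq fun a => ?_
  induction q a with
  | nil => simp [Alive]
  | cons y L ih =>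
    rw [Alive]
    by_cases hL : L = []
    · simp only [hL, if_pos, decide_eq_true_eq]
    · simp only [if_neg hL, decide_eq_true_eq, ih]

@[fun_prop] theorem primrec_evade {β : α → List ℕ} (hβ : Primrec β) :
    Primrec fun a => evade (β a) := by
  unfold evade; fun_prop

@[fun_prop] theorem primrec_fresh {β : α → List ℕ} {c n : α → ℕ} (hβ : Primrec β)
    (hc : Primrec c) (hn : Primrec n) : Primrec fun a => fresh (β a) (c a) (n a) := by
  unfold fresh; fun_prop

@[fun_prop] theorem primrec_plain {c : α → ℕ} {v₀ v : α → List ℕ} (hc : Primrec c)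
    (h₀ : Primrec v₀) (h : Primrec v) : Primrec fun a => plain (c a) (v₀ a) (v a) := by
  unfold plain; fun_prop

@[fun_prop] theorem primrec_start {d : α → NodeData} {x : α → ℕ} (hd : Primrec d)
    (hx : Primrec x) : Primrec fun a => start (d a) (x a) := by
  unfold start NodeData.v NodeData.b₀ NodeData.b₁; fun_prop

@[fun_prop] theorem primrec_initData {s : α → ℕ} {D : α → List NodeData} {q : α → List ℕ}
    (hs : Primrec s) (hD : Primrec D) (hq : Primrec q) :
    Primrec fun a => initData (s a) (D a) (q a) := by
  refine (primrec_list_rec (g := fun _ => plain 0 [] []) (h := fun a y L _ =>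
    if L = [] then plain 0 (ofNat (List ℕ) y) (ofNat (List ℕ) y) else
      plain 0 (fresh (start ((D a).getD (encode L) default) y.unpair.1)
        (Nat.pair (encode (y :: L)) (s a)) (nodeStr (y :: L)).length)
        (fresh (start ((D a).getD (encode L) default) y.unpair.1)
        (Nat.pair (encode (y :: L)) (s a)) (nodeStr (y :: L)).length)) hq (by fun_prop)
      (by fun_prop)).of_eq fun a => ?_
  cases q a <;> rfl

@[fun_prop] theorem primrec_extendTo {s n : α → ℕ} {D : α → List NodeData}
    (hs : Primrec s) (hD : Primrec D) (hn : Primrec n) :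
    Primrec fun a => extendTo (s a) (D a) (n a) :=
  Primrec.nat_rec' (h := fun a kP => if kP.1 < kP.2.length then kP.2 else
    kP.2 ++ [initData (s a) kP.2 (ofNat (List ℕ) kP.1)]) hn hD (by
      have : Primrec fun b : α × ℕ × List NodeData => if b.2.1 < b.2.2.length then b.2.2 else
        b.2.2 ++ [initData (s b.1) b.2.2 (ofNat (List ℕ) b.2.1)] := by fun_prop
      exact this.to₂)

@[fun_prop] theorem primrec_moved {s n : α → ℕ} {d : α → NodeData} {β : α → List ℕ}
    (hs : Primrec s) (hn : Primrec n) (hd : Primrec d) (hβ : Primrec β) :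
    Primrec fun a => moved (s a) (n a) (d a) (β a) := by
  unfold moved NodeData.v₀; fun_prop

@[fun_prop] theorem primrec_lengthBound {D : α → List NodeData} {k : α → ℕ} (hD : Primrec D)
    (hk : Primrec k) : Primrec fun a => lengthBound (D a) (k a) := by
  unfold lengthBound NodeData.b₀ NodeData.b₁; fun_prop

@[fun_prop] theorem primrecPred_serves {χ τ : α → List ℕ} {D : α → List NodeData} {k n : α → ℕ}
    {d : α → NodeData} (hχ : Primrec χ) (hD : Primrec D) (hk : Primrec k) (hn : Primrec n)
    (hd : Primrec d) (hτ : Primrec τ) :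
    PrimrecPred fun a => Serves (χ a) (D a) (k a) (n a) (d a) (τ a) := by
  unfold Serves NodeData.v
  have h : PrimrecPred fun a => ∀ b ∈ phiOnStr ((n a) / 4).unpair.1 (χ a) (τ a),
      b < (χ a).length := primrecPred_forall_mem (by fun_prop) (by fun_prop)
  fun_prop

@[fun_prop] theorem primrec_wantServe {χ : α → List ℕ} {T : α → List (List ℕ)}
    {D : α → List NodeData} {k n : α → ℕ} {d : α → NodeData} (hχ : Primrec χ) (hT : Primrec T)
    (hD : Primrec D) (hk : Primrec k) (hn : Primrec n) (hd : Primrec d) :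
    Primrec fun a => wantServe (χ a) (T a) (D a) (k a) (n a) (d a) := by
  unfold wantServe NodeData.phase; fun_prop

@[fun_prop] theorem primrec_pairs {T : α → List (List ℕ)} (hT : Primrec T) :
    Primrec fun a => pairs (T a) := by
  unfold pairs; fun_prop

@[fun_prop] theorem primrecPred_splitStr {i : α → ℕ} {χ : α → List ℕ}
    {b : α → List ℕ × List ℕ} (hi : Primrec i) (hχ : Primrec χ) (hb : Primrec b) :
    PrimrecPred fun a => SplitStr (i a) (χ a) (b a) := by
  unfold SplitStr Incompat; fun_prop

@[fun_prop] theorem primrec_wantSplit {χ : α → List ℕ} {T : α → List (List ℕ)} {n : α → ℕ}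
    {d : α → NodeData} (hχ : Primrec χ) (hT : Primrec T) (hn : Primrec n) (hd : Primrec d) :
    Primrec fun a => wantSplit (χ a) (T a) (n a) (d a) := by
  unfold wantSplit NodeData.phase NodeData.v₀ NodeData.v; fun_prop

@[fun_prop] theorem primrec_want {p : α → Params} {χ : α → List ℕ} {T : α → List (List ℕ)}
    {D : α → List NodeData} {q : α → List ℕ} (hp : Primrec p) (hχ : Primrec χ) (hT : Primrec T)
    (hD : Primrec D) (hq : Primrec q) :
    Primrec fun a => want (p a) (χ a) (T a) (D a) (q a) := by
  unfold want; fun_prop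

@[fun_prop] theorem primrec_action {p : α → Params} {χ : α → List ℕ} {T : α → List (List ℕ)}
    {D : α → List NodeData} (hp : Primrec p) (hχ : Primrec χ) (hT : Primrec T)
    (hD : Primrec D) : Primrec fun a => action (p a) (χ a) (T a) (D a) := by
  unfold action; fun_prop

@[fun_prop] theorem primrecPred_enters {p : α → Params} {χ τ : α → List ℕ}
    {T : α → List (List ℕ)} {D : α → List NodeData} (hp : Primrec p) (hχ : Primrec χ)
    (hT : Primrec T) (hD : Primrec D) (hτ : Primrec τ) :
    PrimrecPred fun a => Enters (p a) (χ a) (T a) (D a) (τ a) := by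
  unfold Enters NodeData.v
  have h : PrimrecPred fun a => ∃ k < (D a).length, Alive (p a) (χ a) (ofNat (List ℕ) k) ∧
      ((τ a).dropLast = ((D a).getD k default).2.2.1 ∨
        (τ a) <+: ((D a).getD k default).2.2.1) :=
    primrecPred_exists_lt (by fun_prop) (by fun_prop)
  fun_prop

@[fun_prop] theorem primrec_afterAction {D : α → List NodeData}
    {o : α → Option (ℕ × NodeData)} (hD : Primrec D) (ho : Primrec o) :
    Primrec fun a => afterAction (D a) (o a) :=
  (show Primrec fun a => ((o a).map fun b => (D a).take b.1 ++ [b.2]).getD (D a) by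
    fun_prop).of_eq fun a => by cases o a <;> rfl

@[fun_prop] theorem primrec_step {p : α → Params} {χ : α → List ℕ}
    {st : α → List (List ℕ) × List NodeData} (hp : Primrec p) (hχ : Primrec χ)
    (hst : Primrec st) : Primrec fun a => step (p a) (χ a) (st a) := by
  unfold step; fun_prop

/-- The state of the construction at the stage given by the length of `χ`. -/
noncomputable def stateStr (p : Params) (χ : List ℕ) : List (List ℕ) × List NodeData :=
  Nat.rec ([], []) (fun u st => step p (χ.take u) st) χ.length

theorem stateStr_initSeg (p : Params) (X : ℕ → ℕ) (s : ℕ) :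
    stateStr p (initSeg X s) = state p X s := by
  have : ∀ u ≤ s, (Nat.rec ([], []) (fun u st => step p ((initSeg X s).take u) st) u :
      List (List ℕ) × List NodeData) = state p X u := by
    intro u
    induction u with
    | zero => intro _; rfl
    | succ u ih =>
      intro hu
      rw [state_succ, ← ih (by omega), ← take_initSeg X (show u ≤ s by omega)]
  rw [stateStr, length_initSeg, this s le_rfl]

@[fun_prop] theorem primrec_stateStr {p : α → Params} {χ : α → List ℕ} (hp : Primrec p)
    (hχ : Primrec χ) : Primrec fun a => stateStr (p a) (χ a) :=
  Primrec.nat_rec' (h := fun a us => step (p a) ((χ a).take us.1) us.2) (by fun_prop)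
    (Primrec.const ([], [])) (by
      have : Primrec fun b : α × ℕ × (List (List ℕ) × List NodeData) =>
        step (p b.1) ((χ b.1).take b.2.1) b.2.2 := by fun_prop
      exact this.to₂)

end
end Pulldown

namespace Pulldown

open Encodable Denumerable Filter

/-! ### Indices -/

/-- A search through the initial segments of the oracle and through witnesses is carried out by a
functional whose index is a primitive recursive function of the parameters. -/
theorem exists_index {P : Type} [Primcodable P] {F : P → List ℕ → ℕ → ℕ → Option ℕ}
    (hF : Primrec fun a : P × List ℕ × ℕ × ℕ => F a.1 a.2.1 a.2.2.1 a.2.2.2) :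
    ∃ t : P → ℕ, Primrec t ∧ ∀ x A n (V : Part ℕ),
      (∀ j c, ∀ m ∈ F x (initSeg A j) c n, m ∈ V) →
      (V.Dom → ∃ j c, (F x (initSeg A j) c n).isSome) → Phi (t x) A n = V := by
  have h1 : Primrec fun a : ℕ × ℕ => (decode (α := P) a.1.unpair.1).bind fun x =>
      F x (ofNat (List ℕ) a.1.unpair.2.unpair.1) a.2 a.1.unpair.2.unpair.2 := by
    refine Primrec.option_bind (Primrec.decode.comp (by fun_prop)) ?_
    exact (hF.comp (show Primrec fun b : (ℕ × ℕ) × P => (b.2,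
      ofNat (List ℕ) b.1.1.unpair.2.unpair.1, b.1.2, b.1.1.unpair.2.unpair.2) by fun_prop)).to₂
  have h2 : Partrec fun z : ℕ => Nat.rfindOpt fun c => (decode (α := P) z.unpair.1).bind fun x =>
      F x (ofNat (List ℕ) z.unpair.2.unpair.1) c z.unpair.2.unpair.2 :=
    Partrec.rfindOpt h1.to_comp
  obtain ⟨cd, hcd⟩ := Nat.Partrec.Code.exists_code.1 (Partrec.nat_iff.1 h2)
  refine ⟨fun x => encode (cd.curry (encode x)), Primrec.encode.comp
    (Nat.Partrec.Code.primrec₂_curry.comp (Primrec.const cd) Primrec.encode), ?_⟩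
  intro x A n V hs hc
  have h3 : ∀ j, (cd.curry (encode x)).eval (Nat.pair (encode (initSeg A j)) n) =
      Nat.rfindOpt fun c => F x (initSeg A j) c n := by
    intro j
    rw [Nat.Partrec.Code.eval_curry, hcd]
    simp only [Nat.unpair_pair, encodek, ofNat_encode, Option.bind_some]
  have h4 : ∀ m ∈ Phi (encode (cd.curry (encode x))) A n, m ∈ V := by
    intro m hm
    obtain ⟨k, hk⟩ := Nat.rfindOpt_spec hm
    rw [probe_initSeg, ofNat_encode] at hk
    have h5 := Nat.Partrec.Code.evaln_sound hk
    rw [h3] at h5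
    obtain ⟨c, hc⟩ := Nat.rfindOpt_spec h5
    exact hs _ _ _ hc
  refine Part.ext fun m => ⟨h4 m, fun hm => ?_⟩
  obtain ⟨j, c, hjc⟩ := hc (Part.dom_iff_mem.2 ⟨m, hm⟩)
  obtain ⟨m', hm'⟩ := Option.isSome_iff_exists.1 hjc
  have h5 : ((cd.curry (encode x)).eval (Nat.pair (encode (initSeg A j)) n)).Dom := by
    rw [h3]; exact Nat.rfindOpt_dom.2 ⟨c, m', hm'⟩
  obtain ⟨s, hs'⟩ := Nat.Partrec.Code.evaln_complete.1 (Part.get_mem h5)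
  have h6 : (Phi (encode (cd.curry (encode x))) A n).Dom := Nat.rfindOpt_dom.2
    ⟨Nat.pair j s, _, by rw [probe_initSeg, ofNat_encode, Nat.unpair_pair]; exact hs'⟩
  rw [Part.mem_unique hm (h4 _ (Part.get_mem h6))]
  exact Part.get_mem h6

/-- One query to the jump decides whether an initial segment of the oracle has a primitive
recursive property. -/
theorem exists_query {P : Type} [Primcodable P] {Q : P → List ℕ → Prop}
    (hQ : PrimrecPred fun a : P × List ℕ => Q a.1 a.2) :
    ∃ h : P → ℕ, Primrec h ∧ ∀ X x, jump X (h x) = 1 ↔ ∃ s, Q x (initSeg X s) := by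
  classical
  obtain ⟨t, ht, h⟩ := exists_index (F := fun x χ _ _ => if Q x χ then some 0 else none)
    (Primrec.ite (hQ.comp (show Primrec fun a : P × List ℕ × ℕ × ℕ => (a.1, a.2.1) by fun_prop))
      (by fun_prop) (by fun_prop))
  refine ⟨t, ht, fun X x => ?_⟩
  rw [jump_eq_one_iff, h x X (t x) ⟨∃ s, Q x (initSeg X s), fun _ => 0⟩]
  · intro j c m hm
    split_ifs at hm with hq
    · exact ⟨⟨j, hq⟩, by simpa using hm⟩
    · simp at hm
  · rintro ⟨s, hs⟩
    exact ⟨s, 0, by simp [hs]⟩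

theorem jump_eq_zero_of {X : ℕ → ℕ} {n : ℕ} (h : ¬ jump X n = 1) : jump X n = 0 := by
  rw [jump_eq_zero_iff]; rwa [jump_eq_one_iff] at h

theorem reIn_of_primrec {Q : List ℕ → List ℕ → Prop}
    (hQ : PrimrecPred fun a : List ℕ × List ℕ => Q a.1 a.2) (X : ℕ → ℕ) :
    REIn X {σ | ∃ s, Q σ (initSeg X s)} := by
  classical
  obtain ⟨t, -, h⟩ := exists_index (P := Unit)
    (F := fun _ χ _ n => if Q (ofNat (List ℕ) n) χ then some 0 else none)
    (Primrec.ite (hQ.comp (show Primrec fun a : Unit × List ℕ × ℕ × ℕ =>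
      (ofNat (List ℕ) a.2.2.2, a.2.1) by fun_prop)) (by fun_prop) (by fun_prop))
  refine ⟨t (), fun σ => ?_⟩
  rw [h () X (encode σ) ⟨∃ s, Q σ (initSeg X s), fun _ => 0⟩]
  · rfl
  · intro j c m hm
    rw [ofNat_encode] at hm
    split_ifs at hm with hq
    · exact ⟨⟨j, hq⟩, by simpa using hm⟩
    · simp at hm
  · rintro ⟨s, hs⟩
    exact ⟨s, 0, by simp [hs]⟩

theorem getElem?_initSeg_eq_some {A : ℕ → ℕ} {k i a : ℕ} :
    (initSeg A k)[i]? = some a ↔ i < k ∧ A i = a := by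
  rw [getElem?_initSeg]
  split_ifs with h <;> simp [h]

/-! #### Oracles that are joins -/

/-- The first `k` values of `f`, read off from an initial segment of `f ⊕ g`. -/
def evens (χ : List ℕ) (k : ℕ) : List ℕ := (List.range k).map fun i => χ.getD (2 * i) 0

/-- The first `k` values of `g`, read off from an initial segment of `f ⊕ g`. -/
def odds (χ : List ℕ) (k : ℕ) : List ℕ := (List.range k).map fun i => χ.getD (2 * i + 1) 0

theorem getD_initSeg {A : ℕ → ℕ} {k i : ℕ} (h : i < k) : (initSeg A k).getD i 0 = A i := by
  rw [List.getD_eq_getElem?_getD, getElem?_initSeg, if_pos h, Option.getD_some]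

theorem join_even (f g : ℕ → ℕ) (n : ℕ) : join f g (2 * n) = f n := by
  simp [join]

theorem join_odd (f g : ℕ → ℕ) (n : ℕ) : join f g (2 * n + 1) = g n := by
  rw [join, if_neg (by omega)]
  congr 1
  omega

theorem evens_initSeg {f g : ℕ → ℕ} {j k : ℕ} (h : 2 * k ≤ j) :
    evens (initSeg (join f g) j) k = initSeg f k := by
  refine List.map_congr_left fun i hi => ?_
  have := List.mem_range.1 hi
  rw [getD_initSeg (by omega), join_even]

theorem odds_initSeg {f g : ℕ → ℕ} {j k : ℕ} (h : 2 * k ≤ j) :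
    odds (initSeg (join f g) j) k = initSeg g k := by
  refine List.map_congr_left fun i hi => ?_
  have := List.mem_range.1 hi
  rw [getD_initSeg (by omega), join_odd]

section
variable {α : Type*} [Primcodable α]

@[fun_prop] theorem primrec_evens {χ : α → List ℕ} {k : α → ℕ} (hχ : Primrec χ)
    (hk : Primrec k) : Primrec fun a => evens (χ a) (k a) := by
  unfold evens; fun_prop

@[fun_prop] theorem primrec_odds {χ : α → List ℕ} {k : α → ℕ} (hχ : Primrec χ)
    (hk : Primrec k) : Primrec fun a => odds (χ a) (k a) := by
  unfold odds; fun_prop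

/-- Whether the `n`-th functional has been found to halt at `n` with oracle `τ ⊕ χ`. -/
def HaltsOn (n : ℕ) (τ χ : List ℕ) : Prop :=
  τ.length ≤ χ.length ∧ (phiVal n (joinStr τ fun i => χ.getD i 0) n).isSome

@[fun_prop] theorem primrecPred_haltsOn {n : α → ℕ} {τ χ : α → List ℕ} (hn : Primrec n)
    (hτ : Primrec τ) (hχ : Primrec χ) : PrimrecPred fun a => HaltsOn (n a) (τ a) (χ a) := by
  unfold HaltsOn
  simp only [joinStr_getD]
  fun_prop

end

theorem haltsOn_initSeg {n s : ℕ} {τ : List ℕ} {X : ℕ → ℕ} : HaltsOn n τ (initSeg X s) ↔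
    τ.length ≤ s ∧ (phiVal n (joinStr τ X) n).isSome := by
  rw [HaltsOn, length_initSeg]
  refine and_congr_right fun h => ?_
  rw [joinStr_congr fun i hi => getD_initSeg (by omega)]

theorem exists_haltsOn {n : ℕ} {τ : List ℕ} {X : ℕ → ℕ} : (∃ s, HaltsOn n τ (initSeg X s)) ↔
    (phiVal n (joinStr τ X) n).isSome := by
  simp only [haltsOn_initSeg]
  exact ⟨fun ⟨_, h⟩ => h.2, fun h => ⟨_, le_rfl, h⟩⟩

theorem phi_join_dom_iff {n : ℕ} {f X : ℕ → ℕ} : (Phi n (join f X) n).Dom ↔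
    ∃ k, (phiVal n (joinStr (initSeg f k) X) n).isSome := by
  rw [Phi_dom_iff]
  simp only [joinStr_initSeg]
  constructor
  · rintro ⟨s, hs⟩
    exact ⟨s, phiVal_isSome_mono (initSeg_prefix _ (by omega)) hs⟩
  · rintro ⟨s, hs⟩
    exact ⟨_, hs⟩

/-! #### The tree and the map -/

section
variable {p : Params} {X : ℕ → ℕ}

open Classical in
/-- The search that decides the tree. -/
noncomputable def treeSearch (p : Params) (χ : List ℕ) (_c n : ℕ) : Option ℕ :=
  if phiVal p.2.2 χ (encode ((ofNat (List ℕ) n).take p.1)) = some 1 then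
    if (ofNat (List ℕ) n).length ≤ p.1 then some 1
    else if n < χ.length then some (if ofNat (List ℕ) n ∈ (stateStr p χ).1 then 1 else 0)
    else none
  else if phiVal p.2.2 χ (encode ((ofNat (List ℕ) n).take p.1)) = some 0 then some 0
  else none

theorem base_iff {σ : List ℕ} : σ ∈ base p X ↔ ∃ s, phiVal p.2.2 (initSeg X s) (encode σ) = some 1 :=
  mem_Phi_iff _ _ _ _

theorem decides_of_phi_eq {α : Type} [Encodable α] {e : ℕ} {A : ℕ → ℕ} {S : Set α}
    [DecidablePred (· ∈ S)] (h : ∀ a, Phi e A (encode a) = Part.some (if a ∈ S then 1 else 0)) :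
    Decides e A S := by
  intro a
  rw [h]
  exact ⟨fun ha => by simp [ha], fun ha => by simp [ha]⟩

/-- The tree is computable in `X`, since a string is decided at the stage given by its code. -/
theorem exists_tree_index : ∃ t : Params → ℕ, Primrec t ∧ ∀ p X,
    Decides p.2.2 X (base p X) → Decides (t p) X (lowerTree p X) := by
  classical
  obtain ⟨t, ht, h⟩ := exists_index (F := treeSearch) (by unfold treeSearch; fun_prop)
  refine ⟨t, ht, fun p X hd => decides_of_phi_eq fun σ => h p X _ _ ?_ ?_⟩
  · intro j c m hm
    rw [treeSearch, ofNat_encode] at hm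
    split_ifs at hm with h1 h2 h3 h4 h5
    · rw [if_pos ((mem_lowerTree_of_le h2).2 ?_)]
      · simpa [eq_comm] using hm
      · rw [List.take_of_length_le h2] at h1; exact base_iff.2 ⟨j, h1⟩
    · rw [stateStr_initSeg] at h4
      rw [if_pos ⟨base_iff.2 ⟨j, h1⟩, fun _ => ⟨j, h4⟩⟩]
      simpa [eq_comm] using hm
    · rw [stateStr_initSeg] at h4
      rw [length_initSeg] at h3
      rw [if_neg fun hc => ?_]
      · simpa [eq_comm] using hm
      · obtain ⟨s, hs⟩ := hc.2 (not_le.1 h2)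
        exact h4 (mem_treeAt_of_lt hs h3)
    · simp at hm
    · rw [if_neg fun hc => ?_]
      · simpa [eq_comm] using hm
      · have := Part.mem_unique hc.1 (mem_Phi_of_phiVal h5)
        omega
    · simp at hm
  · intro _
    have hmax : ∀ s, encode σ < max s (encode σ + 1) := fun s => by omega
    by_cases hb : σ.take p.1 ∈ base p X
    · obtain ⟨s, hs⟩ := base_iff.1 hb
      refine ⟨max s (encode σ + 1), 0, ?_⟩
      rw [treeSearch, ofNat_encode, if_pos (phiVal_mono (initSeg_prefix X (le_max_left _ _)) hs),
        length_initSeg, if_pos (hmax s)]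
      split_ifs <;> rfl
    · obtain ⟨s, hs⟩ := (mem_Phi_iff _ _ _ _).1 ((hd _).2 hb)
      refine ⟨s, 0, ?_⟩
      rw [treeSearch, ofNat_encode, if_neg (by rw [hs]; simp), if_pos hs]
      rfl

/-- The value `v` of the node `q` is refuted at the stage given by the length of `χ`, which is at
least `s`. -/
def Refuted (p : Params) (a : List ℕ × ℕ × List ℕ) (χ : List ℕ) : Prop :=
  a.2.1 ≤ χ.length ∧ ¬ (encode a.1 < χ.length ∧ Alive p χ a.1 ∧
    phiVal p.2.2 χ (encode ((nodeStr a.1).take p.1)) = some 1 ∧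
    ((stateStr p χ).2.getD (encode a.1) default).v = a.2.2)

theorem mem_nodeMap_of_not_refuted {q v : List ℕ} {s : ℕ}
    (h : ∀ u, ¬ Refuted p (q, s, v) (initSeg X u)) : v ∈ nodeMap p X (nodeStr q) := by
  have h1 : ∀ u ≥ s, encode q < u ∧ Alive p (initSeg X u) q ∧
      phiVal p.2.2 (initSeg X u) (encode ((nodeStr q).take p.1)) = some 1 ∧
      (dat p X u q).v = v := by
    intro u hu
    have := h u
    rw [Refuted, not_and_not_right, length_initSeg, stateStr_initSeg] at this
    exact this hu
  have hq : IsTrue p X q := eventually_atTop.2 ⟨s, fun u hu => (h1 u hu).2.1⟩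
  obtain ⟨u, hu, hd⟩ := ((eventually_ge_atTop s).and (eventually_dat p X q)).exists
  refine mem_nodeMap.2 ⟨⟨base_iff.2 ⟨s, (h1 s le_rfl).2.2.1⟩, fun n hn hn' => hq.good hn hn'⟩,
    q, hq, rfl, ?_⟩
  rw [← (h1 u hu).2.2.2, hd]
  rfl

theorem exists_not_refuted {σ v : List ℕ} (h : v ∈ nodeMap p X σ) :
    ∃ q s, nodeStr q = σ ∧ ∀ u, ¬ Refuted p (q, s, v) (initSeg X u) := by
  obtain ⟨h1, q, hq, rfl, rfl⟩ := mem_nodeMap.1 h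
  obtain ⟨s₁, hs₁⟩ := base_iff.1 h1.1
  obtain ⟨s, hs⟩ := eventually_atTop.1 ((eventually_dat p X q).and
    ((eventually_gt_atTop (encode q)).and (eventually_ge_atTop s₁)))
  refine ⟨q, s, rfl, fun u => ?_⟩
  rw [Refuted, not_and_not_right, length_initSeg, stateStr_initSeg]
  intro hu
  obtain ⟨h2, h3, h4⟩ := hs u hu
  refine ⟨h3, hq.alive h3.le, phiVal_mono (initSeg_prefix X h4) hs₁, ?_⟩
  change (dat p X u q).v = _
  rw [h2]
  rfl

/-- The jump has the value `0` at the number given by `h` for a node, a stage and a string only if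
the string is the value of the map at the string of the node, and each value arises so. -/
def NodeQuery (h : Params × List ℕ × ℕ × List ℕ → ℕ) : Prop :=
  ∀ p X,
    (∀ a : List ℕ × ℕ × List ℕ, jump X (h (p, a)) = 0 → a.2.2 ∈ nodeMap p X (nodeStr a.1)) ∧
    ∀ σ v, v ∈ nodeMap p X σ → ∃ q s, nodeStr q = σ ∧ jump X (h (p, q, s, v)) = 0

theorem exists_nodeQuery : ∃ h, Primrec h ∧ NodeQuery h := by
  obtain ⟨h, h1, h2⟩ := exists_query
    (Q := fun (a : Params × List ℕ × ℕ × List ℕ) χ => Refuted a.1 a.2 χ) (by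
      unfold Refuted NodeData.v; fun_prop)
  refine ⟨h, h1, fun p X => ⟨fun a h3 => ?_, fun σ v hv => ?_⟩⟩
  · refine mem_nodeMap_of_not_refuted (s := a.2.1) fun u hu => ?_
    have := (h2 X (p, a)).2 ⟨u, hu⟩
    omega
  · obtain ⟨q, s, h3, h4⟩ := exists_not_refuted hv
    exact ⟨q, s, h3, jump_eq_zero_of fun hc => by
      obtain ⟨u, hu⟩ := (h2 X _).1 hc
      exact h4 u hu⟩

/-- A value of the map is found by a search through nodes, stages and strings for one that passes
the query to the jump. -/
theorem exists_map_index {h : Params × List ℕ × ℕ × List ℕ → ℕ} (hp : Primrec h)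
    (hh : NodeQuery h) :
    ∃ γ : Params → ℕ, Primrec γ ∧ ∀ p X σ,
      Phi (γ p) (jump X) (encode σ) = (nodeMap p X σ).map encode := by
  obtain ⟨γ, hγ, h1⟩ := exists_index (F := fun (p : Params) χ c n =>
    if nodeStr (ofNat (List ℕ × ℕ × List ℕ) c).1 = ofNat (List ℕ) n ∧
        χ[h (p, ofNat (List ℕ × ℕ × List ℕ) c)]? = some 0
      then some (encode (ofNat (List ℕ × ℕ × List ℕ) c).2.2) else none) (by fun_prop)
  refine ⟨γ, hγ, fun p X σ => h1 p _ _ _ ?_ ?_⟩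
  · intro j c m hm
    split_ifs at hm with h2
    · rw [ofNat_encode, getElem?_initSeg_eq_some] at h2
      refine Part.mem_map_iff _ |>.2 ⟨_, h2.1 ▸ (hh p X).1 _ h2.2.2, by simpa using hm⟩
    · simp at hm
  · intro hd
    obtain ⟨v, hv⟩ := Part.dom_iff_mem.1 (show (nodeMap p X σ).Dom from hd)
    obtain ⟨q, s, h2, h3⟩ := (hh p X).2 σ v hv
    refine ⟨h (p, q, s, v) + 1, encode (q, s, v), ?_⟩
    rw [ofNat_encode, if_pos ⟨by rw [ofNat_encode]; exact h2,
      getElem?_initSeg_eq_some.2 ⟨Nat.lt_succ_self _, h3⟩⟩]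
    rfl

end
end Pulldown

namespace Pulldown

open Encodable Denumerable Filter

section
variable {p : Params} {X : ℕ → ℕ}

/-! #### The graph -/

/-- The string `ρ` has been found not to satisfy the condition for membership in the upper tree,
with an initial segment `χ` of the jump as oracle. -/
def Rejected (p : Params) (χ ρ : List ℕ) : Prop :=
  (ρ.length % 4 = 3 ∧ 1 < ρ.getLastD 0) ∨
    ∃ τ ∈ required ρ, (phiVal p.2.1 χ (encode τ)).isSome ∧ phiVal p.2.1 χ (encode τ) ≠ some 1

theorem Rejected.not_good {j : ℕ} {ρ : List ℕ} (h : Rejected p (initSeg (jump X) j) ρ) :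
    ¬ Good p X ρ := by
  rintro ⟨-, h1, h2⟩
  rcases h with ⟨h3, h4⟩ | ⟨τ, h3, h4, h5⟩
  · exact absurd (h1 h3) (by omega)
  · obtain ⟨m, hm⟩ := Option.isSome_iff_exists.1 h4
    rw [Part.mem_unique (mem_Phi_of_phiVal hm) (h2 τ h3)] at hm
    exact h5 hm

theorem exists_rejected (hd : ∀ n, (Phi p.2.1 (jump X) n).Dom) {ρ : List ℕ}
    (hb : ρ.take p.1 ∈ base p X) (h : ¬ Good p X ρ) :
    ∃ j, Rejected p (initSeg (jump X) j) ρ := by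
  by_contra hc
  push Not at hc
  refine h ⟨hb, fun h3 => ?_, fun τ hτ => ?_⟩
  · by_contra h4
    exact hc 0 (Or.inl ⟨h3, not_le.1 h4⟩)
  · obtain ⟨j, hj⟩ := Phi_dom_iff.1 (hd (encode τ))
    refine (mem_Phi_iff _ _ _ _).2 ⟨j, ?_⟩
    by_contra h1
    exact hc j (Or.inr ⟨τ, hτ, hj, h1⟩)

open Classical in
/-- If the functional that accepts strings is total, then the domain of the map is computable in the
jump, and so is its graph. -/
theorem exists_graph_index {h : Params × List ℕ × ℕ × List ℕ → ℕ} (hp : Primrec h)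
    (hh : NodeQuery h) : ∃ d : Params → ℕ, Primrec d ∧ ∀ p X,
      (∀ n, (Phi p.2.1 (jump X) n).Dom) → Decides (d p) (jump X) (graphOf (nodeMap p X)) := by
  obtain ⟨h', hp', h1⟩ := exists_query (Q := fun (a : Params × List ℕ) χ =>
    phiVal a.1.2.2 χ (encode (a.2.take a.1.1)) = some 1) (by fun_prop)
  have hrej : PrimrecPred fun a : Params × List ℕ × List ℕ => ∃ n < a.2.2.length + 1,
      a.1.1 < n ∧ Rejected a.1 a.2.1 (a.2.2.take n) := by
    refine primrecPred_exists_lt (by fun_prop) (primrecPred_and (by fun_prop) ?_)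
    have : PrimrecPred fun a : (Params × List ℕ × List ℕ) × ℕ =>
        ∃ τ ∈ required (a.1.2.2.take a.2), (phiVal a.1.1.2.1 a.1.2.1 (encode τ)).isSome ∧
          phiVal a.1.1.2.1 a.1.2.1 (encode τ) ≠ some 1 :=
      primrecPred_exists_mem (by fun_prop) (by fun_prop)
    unfold Rejected
    fun_prop
  obtain ⟨d, hd, h2⟩ := exists_index (F := fun (p : Params) χ c n =>
    if nodeStr (ofNat (List ℕ × ℕ × List ℕ) c).1 = (ofNat (List ℕ × List ℕ) n).1 ∧
        χ[h (p, ofNat (List ℕ × ℕ × List ℕ) c)]? = some 0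
    then some (if (ofNat (List ℕ × ℕ × List ℕ) c).2.2 = (ofNat (List ℕ × List ℕ) n).2 then 1 else 0)
    else if χ[h' (p, (ofNat (List ℕ × List ℕ) n).1)]? = some 0 ∨
        ∃ k < (ofNat (List ℕ × List ℕ) n).1.length + 1,
          p.1 < k ∧ Rejected p χ ((ofNat (List ℕ × List ℕ) n).1.take k)
    then some 0 else none) (by
      have h3 : PrimrecPred fun a : Params × List ℕ × ℕ × ℕ =>
          ∃ k < (ofNat (List ℕ × List ℕ) a.2.2.2).1.length + 1, a.1.1 < k ∧
            Rejected a.1 a.2.1 ((ofNat (List ℕ × List ℕ) a.2.2.2).1.take k) :=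
        hrej.comp (show Primrec fun a : Params × List ℕ × ℕ × ℕ =>
          (a.1, a.2.1, (ofNat (List ℕ × List ℕ) a.2.2.2).1) by fun_prop)
      fun_prop)
  refine ⟨d, hd, fun p X htot => decides_of_phi_eq fun ⟨σ, τ⟩ => h2 p _ _ _ ?_ ?_⟩
  · intro j c m hm
    rw [ofNat_encode] at hm
    dsimp only at hm
    have hiff : (σ, τ) ∈ graphOf (nodeMap p X) ↔ τ ∈ nodeMap p X σ := Iff.rfl
    split_ifs at hm with h3 h4 h5
    · rw [getElem?_initSeg_eq_some] at h3
      rw [if_pos (hiff.2 (h4 ▸ h3.1 ▸ (hh p X).1 _ h3.2.2))]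
      simpa [eq_comm] using hm
    · rw [getElem?_initSeg_eq_some] at h3
      rw [if_neg fun hc => h4 (Part.mem_unique (h3.1 ▸ (hh p X).1 _ h3.2.2) (hiff.1 hc))]
      simpa [eq_comm] using hm
    · rw [if_neg fun hc => ?_]
      · simpa [eq_comm] using hm
      · have hσ := (mem_nodeMap.1 (hiff.1 hc)).1
        rcases h5 with h5 | ⟨k, hk, hpk, h5⟩
        · rw [getElem?_initSeg_eq_some] at h5
          have := (h1 X (p, σ)).2 (base_iff.1 hσ.1)
          omega
        · exact h5.not_good (hσ.2 k hpk (by omega))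
    · simp at hm
  · intro _
    by_cases hσ : σ ∈ upperTree p X
    · obtain ⟨v, hv⟩ := Part.dom_iff_mem.1 (nodeMap_dom.2 hσ)
      obtain ⟨q, s, h3, h4⟩ := (hh p X).2 σ v hv
      refine ⟨h (p, q, s, v) + 1, encode (q, s, v), ?_⟩
      rw [ofNat_encode, if_pos ⟨by rw [ofNat_encode]; exact h3,
        getElem?_initSeg_eq_some.2 ⟨Nat.lt_succ_self _, h4⟩⟩]
      rfl
    · have h3 : ∃ j, (initSeg (jump X) j)[h' (p, σ)]? = some 0 ∨ ∃ k < σ.length + 1,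
          p.1 < k ∧ Rejected p (initSeg (jump X) j) (σ.take k) := by
        by_cases hb : σ.take p.1 ∈ base p X
        · have h4 : ¬ ∀ n, p.1 < n → n ≤ σ.length → Good p X (σ.take n) := fun hc => hσ ⟨hb, hc⟩
          push Not at h4
          obtain ⟨n, h5, h6, h7⟩ := h4
          obtain ⟨j, hj⟩ := exists_rejected htot
            (by rwa [List.take_take, Nat.min_eq_left h5.le]) h7
          exact ⟨j, Or.inr ⟨n, by omega, h5, hj⟩⟩
        · refine ⟨h' (p, σ) + 1, Or.inl (getElem?_initSeg_eq_some.2 ⟨Nat.lt_succ_self _,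
            jump_eq_zero_of fun hc => hb (base_iff.2 ((h1 X (p, σ)).1 hc))⟩)⟩
      obtain ⟨j, hj⟩ := h3
      refine ⟨j, 0, ?_⟩
      rw [ofNat_encode]
      split_ifs
      · rfl
      · rfl
      · rfl

/-! #### The inversion of the jump -/

theorem reIn_haltsOn (n : ℕ) (X : ℕ → ℕ) :
    REIn X {τ | (phiVal n (joinStr τ X) n).isSome} := by
  have h := reIn_of_primrec (Q := fun τ χ => HaltsOn n τ χ) (by fun_prop) X
  simpa only [exists_haltsOn] using h

/-- A query about the reals `f ⊕ X'` reads an initial segment of `f` and a value of the jump. -/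
theorem getElem?_join {f g : ℕ → ℕ} {k i a : ℕ} :
    (initSeg (join f g) k)[2 * i + 1]? = some a ↔ 2 * i + 1 < k ∧ g i = a := by
  rw [getElem?_initSeg_eq_some, join_odd]

open Classical in
/-- Generic paths force the jump. To decide whether the `n`-th functional halts with oracle `f ⊕ X`,
search for an initial segment of `f` such that it halts on this segment, or that has no extension
in the tree on which it halts. Each of these questions is one query to the jump of `X`. -/
theorem exists_jump_index : ∃ r : Params → ℕ, Primrec r ∧ ∀ p X, ∀ f ∈ paths (lowerTree p X),
    Reduces (r p) (join f (jump X)) (jump (join f X)) := by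
  obtain ⟨h₁, hp₁, hq₁⟩ := exists_query (Q := fun (a : ℕ × List ℕ) χ => HaltsOn a.1 a.2 χ)
    (by fun_prop)
  obtain ⟨h₂, hp₂, hq₂⟩ := exists_query (Q := fun (a : Params × ℕ × List ℕ) χ =>
    ∃ τ ∈ (stateStr a.1 χ).1, a.2.2 <+: τ ∧ HaltsOn a.2.1 τ χ)
    (primrecPred_exists_mem (by fun_prop) (by fun_prop))
  obtain ⟨r, hr, h⟩ := exists_index (F := fun (p : Params) χ c n =>
    if 2 * c ≤ χ.length then
      if χ[2 * h₁ (n, evens χ c) + 1]? = some 1 then some 1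
      else if p.1 < c ∧ χ[2 * h₂ (p, n, evens χ c) + 1]? = some 0 then some 0 else none
    else none) (by fun_prop)
  refine ⟨r, hr, fun p X f hf n => ?_⟩
  have hyes : ∀ c, jump X (h₁ (n, initSeg f c)) = 1 ↔ (phiVal n (joinStr (initSeg f c) X) n).isSome :=
    fun c => (hq₁ X _).trans exists_haltsOn
  have hno : ∀ c, p.1 < c → (jump X (h₂ (p, n, initSeg f c)) = 1 ↔
      ∃ τ ∈ lowerTree p X, initSeg f c <+: τ ∧ (phiVal n (joinStr τ X) n).isSome) := by
    intro c hc
    rw [hq₂]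
    constructor
    · rintro ⟨s, τ, h1, h2, h3⟩
      rw [stateStr_initSeg] at h1
      refine ⟨τ, ⟨?_, fun _ => ⟨s, h1⟩⟩, h2, (haltsOn_initSeg.1 h3).2⟩
      have h4 := (hf c).1
      obtain ⟨b, rfl⟩ := h2
      rwa [List.take_append_of_le_length (by rw [length_initSeg]; exact hc.le)]
    · rintro ⟨τ, h1, h2, h3⟩
      have hl := h2.length_le
      rw [length_initSeg] at hl
      obtain ⟨s, hs⟩ := h1.2 (hc.trans_le hl)
      refine ⟨s, τ, by rwa [stateStr_initSeg], h2, ?_⟩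
      exact haltsOn_initSeg.2 ⟨length_le_of_mem_treeAt hs, h3⟩
  rw [h p _ n (Part.some (jump (join f X) n))]
  · exact Part.mem_some _
  · intro j c m hm
    rw [length_initSeg] at hm
    split_ifs at hm with h1 h2 h3
    · rw [evens_initSeg h1, getElem?_join, hyes] at h2
      rw [jump_eq_one_iff.2 (phi_join_dom_iff.2 ⟨c, h2.2⟩)]
      simpa [eq_comm] using hm
    · rw [evens_initSeg h1, getElem?_join] at h3
      obtain ⟨hc, -, h3⟩ := h3
      have h4 : ¬ (Phi n (join f X) n).Dom := by
        rw [phi_join_dom_iff]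
        rintro ⟨k, hk⟩
        have := (hno c hc).2 ⟨initSeg f (max c k), hf _, initSeg_prefix f (le_max_left _ _),
          phiVal_isSome_mono (joinStr_mono X (initSeg_prefix f (le_max_right _ _))) hk⟩
        omega
      rw [jump_eq_zero_iff.2 h4]
      simpa [eq_comm] using hm
    · simp at hm
    · simp at hm
  · intro _
    rcases meets_or_stronglyAvoids hf (reIn_haltsOn n X) with ⟨σ, hσ, hσf⟩ | ⟨σ, hσf, hσ⟩
    · have h1 := (hyes σ.length).2 (by rw [← hσf]; exact hσ)
      refine ⟨2 * σ.length + (2 * h₁ (n, initSeg f σ.length) + 1) + 1, σ.length, ?_⟩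
      rw [length_initSeg, if_pos (by omega), evens_initSeg (by omega),
        if_pos (getElem?_join.2 ⟨by omega, h1⟩)]
      rfl
    · set c := σ.length + p.1 + 1 with hc
      have h1 : jump X (h₂ (p, n, initSeg f c)) = 0 := jump_eq_zero_of fun h1 => by
        obtain ⟨τ, h2, h3, h4⟩ := (hno c (by omega)).1 h1
        exact hσ τ ((hσf.prefix_initSeg (by omega)).trans h3) ⟨h2, h4⟩
      refine ⟨2 * c + (2 * h₂ (p, n, initSeg f c) + 1) + 1, c, ?_⟩
      rw [length_initSeg, if_pos (by omega), evens_initSeg (by omega)]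
      split_ifs with h2 h3
      · rfl
      · rfl
      · exact absurd ⟨by omega, getElem?_join.2 ⟨by omega, h1⟩⟩ h3

open Classical in
/-- The jump of `f ⊕ X` computes `f` and the jump of `X`. -/
theorem exists_join_index : ∃ r : ℕ, ∀ f X : ℕ → ℕ,
    Reduces r (jump (join f X)) (join f (jump X)) := by
  obtain ⟨h₁, hp₁, hq₁⟩ := exists_query (Q := fun (a : ℕ × ℕ) χ => χ[2 * a.1]? = some a.2)
    (by fun_prop)
  obtain ⟨h₂, hp₂, hq₂⟩ := exists_query (Q := fun (n : ℕ) χ =>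
    (phiVal n (odds χ (χ.length / 2)) n).isSome) (by fun_prop)
  obtain ⟨r, -, h⟩ := exists_index (P := Unit) (F := fun _ χ c n =>
    if n % 2 = 0 then if χ[h₁ (n / 2, c)]? = some 1 then some c else none
    else χ[h₂ (n / 2)]?) (by fun_prop)
  refine ⟨r (), fun f X n => ?_⟩
  have h1 : ∀ i a, jump (join f X) (h₁ (i, a)) = 1 ↔ f i = a := by
    intro i a
    rw [hq₁]
    simp only [getElem?_initSeg_eq_some, join_even]
    exact ⟨fun ⟨_, h⟩ => h.2, fun h => ⟨_, Nat.lt_succ_self _, h⟩⟩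
  have h2 : ∀ i, jump (join f X) (h₂ i) = jump X i := by
    intro i
    have h3 : jump (join f X) (h₂ i) = 1 ↔ jump X i = 1 := by
      rw [hq₂, jump_eq_one_iff, Phi_dom_iff]
      constructor
      · rintro ⟨s, hs⟩
        rw [length_initSeg, odds_initSeg (by omega)] at hs
        exact ⟨_, hs⟩
      · rintro ⟨s, hs⟩
        refine ⟨2 * s, ?_⟩
        rw [length_initSeg, odds_initSeg (by omega), Nat.mul_div_cancel_left _ (by omega)]
        exact hs
    by_cases h4 : jump X i = 1
    · rw [h4, h3.2 h4]
    · rw [jump_eq_zero_of h4, jump_eq_zero_of fun hc => h4 (h3.1 hc)]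
  rw [h () _ n (Part.some (join f (jump X) n))]
  · exact Part.mem_some _
  · intro j c m hm
    rw [join]
    split_ifs at hm ⊢ with h3 h4
    · rw [getElem?_initSeg_eq_some, h1] at h4
      simp only [Option.mem_def, Option.some.injEq] at hm
      rw [h4.2, hm]
      exact Part.mem_some _
    · simp at hm
    · have := (getElem?_initSeg_eq_some.1 hm).2
      rw [h2] at this
      rw [this]
      exact Part.mem_some _
  · intro _
    by_cases h3 : n % 2 = 0
    · refine ⟨h₁ (n / 2, f (n / 2)) + 1, f (n / 2), ?_⟩
      rw [if_pos h3, if_pos (getElem?_initSeg_eq_some.2 ⟨Nat.lt_succ_self _, (h1 _ _).2 rfl⟩)]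
      rfl
    · refine ⟨h₂ (n / 2) + 1, 0, ?_⟩
      rw [if_neg h3, getElem?_initSeg, if_pos (Nat.lt_succ_self _)]
      rfl

open Classical in
/-- The image under the map is read off from the values at initial segments. -/
theorem exists_image_index {h : Params × List ℕ × ℕ × List ℕ → ℕ} (hp : Primrec h)
    (hh : NodeQuery h) : ∃ r : Params → ℕ, Primrec r ∧ ∀ p X, BaseOk p X → ∀ f f',
      MapsReal (nodeMap p X) f' f → Reduces (r p) (join f' (jump X)) (join f (jump X)) := by
  obtain ⟨r, hr, h1⟩ := exists_index (F := fun (p : Params) χ c n =>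
    if n % 2 = 0 then
      if 2 * c.unpair.1 ≤ χ.length ∧
        nodeStr (ofNat (List ℕ × ℕ × List ℕ) c.unpair.2).1 = evens χ c.unpair.1 ∧
        χ[2 * h (p, ofNat (List ℕ × ℕ × List ℕ) c.unpair.2) + 1]? = some 0
      then (ofNat (List ℕ × ℕ × List ℕ) c.unpair.2).2.2[n / 2]? else none
    else χ[n]?) (by fun_prop)
  refine ⟨r, hr, fun p X hb f f' hf n => ?_⟩
  rw [h1 p _ n (Part.some (join f (jump X) n))]
  · exact Part.mem_some _
  · intro j c m hm
    rw [length_initSeg] at hm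
    rw [join]
    split_ifs at hm ⊢ with h3 h4
    · obtain ⟨h5, h6, h7⟩ := h4
      rw [evens_initSeg h5] at h6
      rw [getElem?_join] at h7
      have h8 := (hh p X).1 _ h7.2
      rw [h6] at h8
      rw [isInit_iff.1 (hf.1 _ _ h8) _ _ hm]
      exact Part.mem_some _
    · simp at hm
    · have := (getElem?_initSeg_eq_some.1 hm).2
      rw [join, if_neg h3] at this
      rw [this]
      exact Part.mem_some _
  · intro _
    by_cases h3 : n % 2 = 0
    · obtain ⟨k, v, hv, hk⟩ := hf.2 (n / 2 + 1)
      obtain ⟨q, s, h4, h5⟩ := (hh p X).2 _ v hv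
      refine ⟨2 * k + (2 * h (p, q, s, v) + 1) + 1, Nat.pair k (encode (q, s, v)), ?_⟩
      rw [if_pos h3, Nat.unpair_pair, ofNat_encode, if_pos ⟨by rw [length_initSeg]; omega,
        by rw [evens_initSeg (by omega)]; exact h4, getElem?_join.2 ⟨by omega, h5⟩⟩,
        List.getElem?_eq_getElem (by dsimp only; omega)]
      rfl
    · refine ⟨n + 1, 0, ?_⟩
      rw [if_neg h3, getElem?_initSeg, if_pos (Nat.lt_succ_self _)]
      rfl

open Classical in
/-- The preimage under the map is read off from strings whose values are on the given path. -/
theorem exists_preimage_index {h : Params × List ℕ × ℕ × List ℕ → ℕ} (hp : Primrec h)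
    (hh : NodeQuery h) : ∃ r : Params → ℕ, Primrec r ∧ ∀ p X, BaseOk p X → ∀ f f',
      MapsReal (nodeMap p X) f' f → Reduces (r p) (join f (jump X)) (join f' (jump X)) := by
  obtain ⟨r, hr, h1⟩ := exists_index (F := fun (p : Params) χ c n =>
    if n % 2 = 0 then
      if 2 * c.unpair.1 ≤ χ.length ∧
        (ofNat (List ℕ × ℕ × List ℕ) c.unpair.2).2.2 = evens χ c.unpair.1 ∧
        χ[2 * h (p, ofNat (List ℕ × ℕ × List ℕ) c.unpair.2) + 1]? = some 0
      then (nodeStr (ofNat (List ℕ × ℕ × List ℕ) c.unpair.2).1)[n / 2]? else none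
    else χ[n]?) (by fun_prop)
  refine ⟨r, hr, fun p X hb f f' hf n => ?_⟩
  have hval := hb.branches.mapsReal_iff.1 hf
  rw [h1 p _ n (Part.some (join f' (jump X) n))]
  · exact Part.mem_some _
  · intro j c m hm
    rw [length_initSeg] at hm
    rw [join]
    split_ifs at hm ⊢ with h3 h4
    · obtain ⟨h5, h6, h7⟩ := h4
      rw [evens_initSeg h5] at h6
      rw [getElem?_join] at h7
      have h8 := (hh p X).1 _ h7.2
      rw [h6] at h8
      -- a string whose value is on `f` is an initial segment of the preimage
      set σ := nodeStr (ofNat (List ℕ × ℕ × List ℕ) c.unpair.2).1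
      obtain ⟨τ, h9, h10⟩ := hval σ.length
      have h11 : σ = initSeg f' σ.length := by
        have h12 : σ <+: initSeg f' σ.length ∨ initSeg f' σ.length <+: σ :=
          hb.branches.prefix_or_prefix h8 h9 (by
            rcases le_total (initSeg f c.unpair.1).length τ.length with h | h
            · exact Or.inl ((isInit_initSeg f _).prefix_of_le h10 h)
            · exact Or.inr (h10.prefix_of_le (isInit_initSeg f _) h))
        rcases h12 with h12 | h12
        · exact h12.eq_of_length (by rw [length_initSeg])
        · exact (h12.eq_of_length (by rw [length_initSeg])).symm
      have h12 : IsInit σ f' := h11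
      rw [isInit_iff.1 h12 _ _ hm]
      exact Part.mem_some _
    · simp at hm
    · have := (getElem?_initSeg_eq_some.1 hm).2
      rw [join, if_neg h3] at this
      rw [this]
      exact Part.mem_some _
  · intro _
    by_cases h3 : n % 2 = 0
    · obtain ⟨v, hv, hvf⟩ := hval (n / 2 + 1)
      obtain ⟨q, s, h4, h5⟩ := (hh p X).2 _ v hv
      refine ⟨2 * v.length + (2 * h (p, q, s, v) + 1) + 1, Nat.pair v.length (encode (q, s, v)), ?_⟩
      rw [if_pos h3, Nat.unpair_pair, ofNat_encode, if_pos ⟨by rw [length_initSeg]; omega,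
        by rw [evens_initSeg (by omega)]; exact hvf, getElem?_join.2 ⟨by omega, h5⟩⟩, h4,
        List.getElem?_eq_getElem (by rw [length_initSeg]; omega)]
      rfl
    · refine ⟨n + 1, 0, ?_⟩
      rw [if_neg h3, getElem?_initSeg, if_pos (Nat.lt_succ_self _)]
      rfl

/-! ### Paths are not computable -/

/-- If a path were computable in `X`, then the set of the strings that are not on it would be r.e. in
`X`, and the path would neither meet nor strongly avoid it. -/
theorem BaseOk.not_reducible_of_path (h : BaseOk p X) {g : ℕ → ℕ}
    (hg : g ∈ paths (lowerTree p X)) (e : ℕ) : ¬ ∀ n, g n ∈ Phi e X n := by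
  intro he
  have hQ : PrimrecPred fun a : List ℕ × List ℕ => ∃ i < a.1.length,
      (phiVal e a.2 i).isSome ∧ phiVal e a.2 i ≠ a.1[i]? :=
    primrecPred_exists_lt (by fun_prop) (by fun_prop)
  have hW := reIn_of_primrec (Q := fun σ χ => ∃ i < σ.length,
      (phiVal e χ i).isSome ∧ phiVal e χ i ≠ σ[i]?) hQ X
  have h1 : {σ | ∃ s, ∃ i < σ.length, (phiVal e (initSeg X s) i).isSome ∧
      phiVal e (initSeg X s) i ≠ σ[i]?} = {σ | ¬ IsInit σ g} := by
    ext σ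
    change (∃ s, _) ↔ ¬ IsInit σ g
    constructor
    · rintro ⟨s, i, hi, h2, h3⟩ hc
      obtain ⟨m, hm⟩ := Option.isSome_iff_exists.1 h2
      rw [hm, List.getElem?_eq_getElem hi,
        ← isInit_iff.1 hc i _ (List.getElem?_eq_getElem hi)] at h3
      exact h3 (congrArg some (Part.mem_unique (mem_Phi_of_phiVal hm) (he i)))
    · intro hc
      rw [isInit_iff] at hc
      push Not at hc
      obtain ⟨i, x, h2, h3⟩ := hc
      obtain ⟨s, hs⟩ := (mem_Phi_iff _ _ _ _).1 (he i)
      refine ⟨s, i, (List.getElem?_eq_some_iff.1 h2).1, by rw [hs]; rfl, ?_⟩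
      rw [hs, h2]
      simpa using h3
  rw [h1] at hW
  rcases meets_or_stronglyAvoids hg hW with ⟨σ, h2, h3⟩ | h2
  · exact h2 h3
  · exact h.not_stronglyAvoids hg h2

/-! ### The pulldown -/

theorem BaseOk.isPulldown (hb : BaseOk p X) (hn : IsNice (upperTree p X)) {t γ r₁ r₂ r₃ r₄ : ℕ}
    (ht : Decides t X (lowerTree p X))
    (hγ : ∀ σ, Phi γ (jump X) (encode σ) = (nodeMap p X σ).map encode)
    (hr₁ : ∀ f ∈ paths (lowerTree p X), Reduces r₁ (join f (jump X)) (jump (join f X)))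
    (hr₂ : ∀ f X : ℕ → ℕ, Reduces r₂ (jump (join f X)) (join f (jump X)))
    (hr₃ : ∀ f f', MapsReal (nodeMap p X) f' f → Reduces r₃ (join f' (jump X)) (join f (jump X)))
    (hr₄ : ∀ f f', MapsReal (nodeMap p X) f' f → Reduces r₄ (join f (jump X)) (join f' (jump X))) :
    IsPulldown X p.1 (upperTree p X) (lowerTree p X) (nodeMap p X) t γ r₁ r₂ r₃ r₄ where
  tree := hb.isTree_lowerTree
  computable := ht
  map_index := hγ
  nice := hb.isNice_lowerTree
  copy := restr_lowerTree
  map_copy σ hσ := mem_nodeMap_of_le ((mem_upperTree_of_le hσ.2).1 hσ.1) hσ.2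
  expansionary := hb.branches.isExpansionary
  map_concat := hb.branches
  dom _ := nodeMap_dom
  range _ _ h := nodeMap_mem_lowerTree h
  homeo := hb.exists_homeo
  generic _ hg _ hW := meets_or_stronglyAvoids hg hW
  jump_inversion f hf := by
    obtain ⟨H, hH⟩ := hb.exists_homeo
    refine ⟨⟨H.symm ⟨f, hf⟩, ⟨(H.symm ⟨f, hf⟩).2, ?_⟩, fun f' hf' => ?_⟩, hr₁ f hf, hr₂ f X,
      fun f' _ hf' => ⟨hr₃ f f' hf', hr₄ f f' hf'⟩⟩
    · have := hH (H.symm ⟨f, hf⟩)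
      rwa [Homeomorph.apply_symm_apply] at this
    · have := hH (H.symm ⟨f, hf⟩)
      rw [Homeomorph.apply_symm_apply] at this
      exact hb.branches.mapsReal_unique hf'.2 this
  noncomputable_path g hg hc := by
    obtain ⟨e, he⟩ := turingReducible_iff.1 hc
    exact hb.not_reducible_of_path hg e he
  incomparable g hg h hh hne hc := by
    obtain ⟨e, he⟩ := turingReducible_iff.1 hc
    exact not_reducible hg hh hne e he
  splitting _ hi _ hσ hl := nodeMap_splitting hn hi hσ hl

theorem base_eq {T₀ : Set (List ℕ)} (h : Decides p.2.2 X T₀) : base p X = T₀ := by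
  ext σ
  refine ⟨fun h1 => ?_, (h σ).1⟩
  by_contra hc
  have := Part.mem_unique h1 ((h σ).2 hc)
  omega

/-- Each nice tree with the right strings of length at most `l`, and whose longer strings are
accepted, is contained in the upper tree. -/
theorem subset_upperTree {S : Set (List ℕ)} (hS : IsTree S) (hn : IsNice S)
    (hb : restr S p.1 = base p X)
    (he : ∀ σ ∈ S, p.1 < σ.length → 1 ∈ Phi p.2.1 (jump X) (encode σ)) : S ⊆ upperTree p X := by
  intro σ hσ
  have htake : ∀ τ ∈ S, τ.take p.1 ∈ base p X := fun τ hτ => by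
    rw [← hb]
    exact ⟨hS _ _ (List.take_prefix _ _) hτ, by simp⟩
  refine ⟨htake σ hσ, fun n hl hl' => ?_⟩
  have h1 := hS _ _ (List.take_prefix n σ) hσ
  have h2 : (σ.take n).length = n := by rw [List.length_take]; omega
  generalize σ.take n = τ at h1 h2
  refine ⟨htake τ h1, fun hm => ?_, fun ρ hρ => ?_⟩
  · have hne : τ ≠ [] := by rintro rfl; simp at hm
    have h3 : τ.dropLast ++ [τ.getLast hne] = τ := List.dropLast_append_getLast hne
    have h4 := (hn τ.dropLast (τ.getLast hne) (by rwa [h3])).1 (by rwa [h3])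
    rw [List.getLastD_eq_getLast?, List.getLast?_eq_getLast_of_ne_nil hne, Option.getD_some]
    omega
  · rw [required] at hρ
    split_ifs at hρ with hm
    · have h3 : ∀ x, x = 0 ∨ x = 1 → 1 ∈ Phi p.2.1 (jump X) (encode (τ ++ [x])) := fun x hx =>
        he _ ((hn τ x (by simp; omega)).2 ⟨h1, hx⟩) (by simp; omega)
      simp only [List.mem_cons, List.not_mem_nil, or_false] at hρ
      rcases hρ with rfl | rfl | rfl
      · exact he _ h1 (by omega)
      · exact h3 0 (Or.inl rfl)
      · exact h3 1 (Or.inr rfl)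
    · rw [List.mem_singleton.1 hρ]
      exact he _ h1 (by omega)

theorem mem_Phi_of_mem_upperTree {σ : List ℕ} (h : σ ∈ upperTree p X) (hl : p.1 < σ.length) :
    1 ∈ Phi p.2.1 (jump X) (encode σ) := by
  have h1 := (h.2 σ.length hl le_rfl).2.2
  rw [List.take_length] at h1
  refine h1 σ ?_
  rw [required]
  split_ifs <;> simp

theorem restr_upperTree (h : BaseOk p X) : restr (upperTree p X) p.1 = base p X := by
  ext σ
  constructor
  · rintro ⟨h1, h2⟩
    exact (mem_upperTree_of_le h2).1 h1
  · intro h1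
    have h2 := h.length_le σ h1
    exact ⟨(mem_upperTree_of_le h2).2 h1, h2⟩

end
end Pulldown

open Pulldown
theorem mainTheorem9 :
    ∃ t γ d r₁ r₂ r₃ r₄ : ℕ × ℕ × ℕ → ℕ,
      Computable t ∧ Computable γ ∧ Computable d ∧
      Computable r₁ ∧ Computable r₂ ∧ Computable r₃ ∧ Computable r₄ ∧
      ∀ (X : ℕ → ℕ) (l e e₀ : ℕ),
        (∀ T' : Set (List ℕ), IsTree T' → IsNice T' →
          Decides e (jump X) T' → Decides e₀ X (restr T' l) →
          ∃ (T : Set (List ℕ)) (Γ : List ℕ →. List ℕ),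
            IsPulldown X l T' T Γ (t (l, e, e₀)) (γ (l, e, e₀))
              (r₁ (l, e, e₀)) (r₂ (l, e, e₀)) (r₃ (l, e, e₀)) (r₄ (l, e, e₀)) ∧
            Decides (d (l, e, e₀)) (jump X) (graphOf Γ)) ∧
        (∀ T₀ : Set (List ℕ), IsTree T₀ → IsNice T₀ → (∀ σ ∈ T₀, σ.length ≤ l) →
          Decides e₀ X T₀ →
          ∃ T' : Set (List ℕ),
            IsGreatest {S : Set (List ℕ) | IsTree S ∧ IsNice S ∧ restr S l = T₀ ∧
              ∀ σ ∈ S, σ ∉ T₀ → 1 ∈ Phi e (jump X) (Encodable.encode σ)} T' ∧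
            ∃ (T : Set (List ℕ)) (Γ : List ℕ →. List ℕ),
              IsPulldown X l T' T Γ (t (l, e, e₀)) (γ (l, e, e₀))
                (r₁ (l, e, e₀)) (r₂ (l, e, e₀)) (r₃ (l, e, e₀)) (r₄ (l, e, e₀)) ∧
              ((∀ n, (Phi e (jump X) n).Dom) →
                Decides (d (l, e, e₀)) (jump X) (graphOf Γ))) := by
  obtain ⟨t, ht, ht'⟩ := exists_tree_index
  obtain ⟨h, hp, hh⟩ := exists_nodeQuery
  obtain ⟨γ, hγ, hγ'⟩ := exists_map_index hp hh
  obtain ⟨d, hd, hd'⟩ := exists_graph_index hp hh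
  obtain ⟨r₁, hr₁, hr₁'⟩ := exists_jump_index
  obtain ⟨r₂, hr₂'⟩ := exists_join_index
  obtain ⟨r₃, hr₃, hr₃'⟩ := exists_image_index hp hh
  obtain ⟨r₄, hr₄, hr₄'⟩ := exists_preimage_index hp hh
  refine ⟨t, γ, d, r₁, fun _ => r₂, r₃, r₄, ht.to_comp, hγ.to_comp, hd.to_comp, hr₁.to_comp,
    Computable.const r₂, hr₃.to_comp, hr₄.to_comp, fun X l e e₀ => ⟨?_, ?_⟩⟩
  · intro T' hT hn he he₀
    have hbase : base (l, e, e₀) X = restr T' l := base_eq (p := (l, e, e₀)) he₀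
    have hb : BaseOk (l, e, e₀) X := by
      refine ⟨?_, ?_, ?_⟩ <;> rw [hbase]
      · exact fun σ τ hσ hτ => ⟨hT _ _ hσ hτ.1, hσ.length_le.trans hτ.2⟩
      · exact fun σ hσ => hσ.2
      · intro σ x hm hl
        have h1 : σ.length ≤ l := by simp at hl; omega
        exact ⟨fun h => ⟨⟨((hn σ x hm).1 h.1).1, h1⟩, ((hn σ x hm).1 h.1).2⟩,
          fun h => ⟨(hn σ x hm).2 ⟨h.1.1, h.2⟩, hl⟩⟩
    have hT' : T' = upperTree (l, e, e₀) X := by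
      refine Set.Subset.antisymm (subset_upperTree hT hn hbase.symm fun σ hσ _ => (he σ).1 hσ)
        fun σ hσ => ?_
      by_cases hl : σ.length ≤ l
      · have := (mem_upperTree_of_le (p := (l, e, e₀)) hl).1 hσ
        rw [hbase] at this
        exact this.1
      · by_contra hc
        have := Part.mem_unique (mem_Phi_of_mem_upperTree hσ (not_le.1 hl)) ((he σ).2 hc)
        omega
    have htot : ∀ n, (Phi e (jump X) n).Dom := by
      intro n
      rw [← Denumerable.encode_ofNat (α := List ℕ) n, Part.dom_iff_mem]
      by_cases hσ : Denumerable.ofNat (List ℕ) n ∈ T'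
      · exact ⟨_, (he _).1 hσ⟩
      · exact ⟨_, (he _).2 hσ⟩
    subst hT'
    exact ⟨lowerTree (l, e, e₀) X, nodeMap (l, e, e₀) X,
      hb.isPulldown hn (ht' _ _ (hbase ▸ he₀)) (hγ' _ _) (hr₁' _ _) hr₂' (hr₃' _ _ hb)
        (hr₄' _ _ hb), hd' _ _ htot⟩
  · intro T₀ hT hn hl he₀
    have hbase : base (l, e, e₀) X = T₀ := base_eq (p := (l, e, e₀)) he₀
    subst hbase
    have hb : BaseOk (l, e, e₀) X := ⟨hT, hl, fun σ x hm _ => hn σ x hm⟩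
    have hn' := hb.isNice_upperTree hn
    refine ⟨upperTree (l, e, e₀) X, ⟨⟨hb.isTree_upperTree, hn', restr_upperTree hb,
      fun σ hσ hσ₀ => mem_Phi_of_mem_upperTree hσ ?_⟩, ?_⟩, lowerTree (l, e, e₀) X,
      nodeMap (l, e, e₀) X, hb.isPulldown hn' (ht' _ _ he₀) (hγ' _ _) (hr₁' _ _) hr₂'
        (hr₃' _ _ hb) (hr₄' _ _ hb), hd' (l, e, e₀) X⟩
    · by_contra hle
      exact hσ₀ ((mem_upperTree_of_le (p := (l, e, e₀)) (not_lt.1 hle)).1 hσ)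
    · rintro S ⟨h1, h2, h3, h4⟩
      refine subset_upperTree h1 h2 h3 fun σ hσ hlt => h4 σ hσ fun hc => ?_
      have := hl σ hc
      exact absurd hlt (not_lt.2 this)
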